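/- Let $\mathcal{G}$ be a Grothendieck category and let $\mathbf{t}=(\mathcal{T},\mathcal{F})$ be a torsion pair in $\mathcal{G}$, that is, a pair of full subcategories closed under isomorphisms such that $\mathrm{Hom}_{\mathcal{G}}(T,F)=0$ for all $T\in\mathcal{T}$, $F\in\mathcal{F}$, and such that each object $X$ of $\mathcal{G}$ fits in a short exact sequence $0\to T_X\to X\to F_X\to 0$ with $T_X\in\mathcal{T}$ and $F_X\in\mathcal{F}$. Let $\mathcal{H}_{\mathbf{t}}$ be the heart of the associated Happel–Reiten–Smalø t-structure in the derived category $\mathcal{D}(\mathcal{G})$, i.e. the (abelian) full subcategory of the complexes $M$ with $H^{-1}(M)\in\mathcal{F}$, $H^{0}(M)\in\mathcal{T}$ and $H^{k}(M)=0$ for $k\neq -1,0$. (1) Suppose that $\mathbf{t}$ satisfies at least one of the following conditions: (a) $\mathbf{t}$ is hereditary, i.e. $\mathcal{T}$ is closed under subobjects; (b) each object of $\mathcal{H}_{\mathbf{t}}$ is isomorphic in $\mathcal{D}(\mathcal{G})$ to a complex $F$ such that $F^{k}=0$ for $k\neq -1,0$ and $F^{k}\in\mathcal{F}$ for $k=-1,0$;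 (c) each object of $\mathcal{H}_{\mathbf{t}}$ is isomorphic in $\mathcal{D}(\mathcal{G})$ to a complex $T$ such that $T^{k}=0$ for $k\neq -1,0$ and $T^{k}\in\mathcal{T}$ for $k=-1,0$. Then the following assertions are equivalent: 1) $\mathcal{H}_{\mathbf{t}}$ is a Grothendieck category; 2) $\mathcal{H}_{\mathbf{t}}$ is an AB5 abelian category; 3) $\mathcal{F}$ is closed under taking direct limits (colimits of direct systems indexed by directed sets) in $\mathcal{G}$. (2) Suppose that $\mathcal{F}$ is a generating class (every object of $\mathcal{G}$ is a quotient of an object of $\mathcal{F}$) or that $\mathcal{T}$ is a cogenerating class (every object of $\mathcal{G}$ is a subobject of an object of $\mathcal{T}$). Then $\mathcal{H}_{\mathbf{t}}$ is a Grothendieck category if and only if $\mathcal{F}$ is closed under taking direct limits in $\mathcal{G}$. -/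

import Mathlib

open CategoryTheory Limits Triangulated Pretriangulated ZeroObject

universe w v u

/-! ### The heart of a t-structure is an abelian category -/

namespace CategoryTheory.Triangulated.TStructure

section

variable {C : Type u} [Category.{v} C] [Preadditive C] [HasZeroObject C] [HasShift C ℤ]
  [∀ (n : ℤ), (shiftFunctor C n).Additive] [Pretriangulated C]

lemma heart_hom_shift_eq_zero (t : TStructure C) ⦃X Y : t.heart.FullSubcategory⦄ ⦃n : ℤ⦄
    (f : t.heart.ι.obj X ⟶ (t.heart.ι.obj Y)⟦n⟧) (hn : n < 0) : f = 0 := by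
  have h₁ : t.IsLE (t.heart.ι.obj X) 0 := ((t.mem_heart_iff _).1 X.property).1
  have h₂ : t.IsGE (t.heart.ι.obj Y) 0 := ((t.mem_heart_iff _).1 Y.property).2
  exact t.zero_of_isLE_of_isGE f 0 (-n) (by lia) h₁ (t.isGE_shift _ 0 n (-n) (by lia))

lemma heart_admissibleMorphism (t : TStructure C) :
    AbelianSubcategory.admissibleMorphism t.heart.ι = ⊤ := by
  ext X₁ X₂ f
  simp only [MorphismProperty.top_apply, iff_true]
  intro X₃ f₂ f₃ hT
  have l₁ : t.IsLE (t.heart.ι.obj X₁) 0 := ((t.mem_heart_iff _).1 X₁.property).1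
  have g₁ : t.IsGE (t.heart.ι.obj X₁) 0 := ((t.mem_heart_iff _).1 X₁.property).2
  have l₂ : t.IsLE (t.heart.ι.obj X₂) 0 := ((t.mem_heart_iff _).1 X₂.property).1
  have g₂ : t.IsGE (t.heart.ι.obj X₂) 0 := ((t.mem_heart_iff _).1 X₂.property).2
  have l₁' := t.isLE_shift (t.heart.ι.obj X₁) 0 1 (-1)
  have l₁'' : t.IsLE ((t.heart.ι.obj X₁)⟦(1 : ℤ)⟧) 0 := t.isLE_of_le _ (-1) 0
  have g₁' := t.isGE_shift (t.heart.ι.obj X₁) 0 1 (-1)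
  have g₂' : t.IsGE (t.heart.ι.obj X₂) (-1) := t.isGE_of_ge _ (-1) 0
  have l₃ : t.IsLE X₃ 0 := t.isLE₂ _ (rot_of_distTriang _ hT) 0 l₂ l₁''
  have g₃ : t.IsGE X₃ (-1) := t.isGE₂ _ (rot_of_distTriang _ hT) (-1) g₂' g₁'
  obtain ⟨A, B, hA, hB, a, b, c, hT'⟩ := t.exists_triangle X₃ (-1) 0 (by simp)
  replace hA : t.IsLE A (-1) := ⟨hA⟩
  replace hB : t.IsGE B 0 := ⟨hB⟩
  have lA := t.isLE_shift A (-1) 1 (-2)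
  have lA' : t.IsLE (A⟦(1 : ℤ)⟧) 0 := t.isLE_of_le _ (-2) 0
  have gB := t.isGE_shift B 0 (-1) 1
  have gB' : t.IsGE (B⟦(-1 : ℤ)⟧) (-1) := t.isGE_of_ge _ (-1) 1
  have hA' : t.IsGE A (-1) := t.isGE₂ _ (inv_rot_of_distTriang _ hT') (-1) gB' g₃
  have hB' : t.IsLE B 0 := t.isLE₂ _ (rot_of_distTriang _ hT') 0 l₃ lA'
  let K : t.heart.FullSubcategory := ⟨A⟦(-1 : ℤ)⟧, (t.mem_heart_iff _).2
    ⟨t.isLE_shift A (-1) (-1) 0, t.isGE_shift A (-1) (-1) 0⟩⟩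
  let Q : t.heart.FullSubcategory := ⟨B, (t.mem_heart_iff _).2 ⟨hB', hB⟩⟩
  let e : (t.heart.ι.obj K)⟦(1 : ℤ)⟧ ≅ A := (shiftEquiv C (1 : ℤ)).counitIso.app A
  refine ⟨K, Q, e.hom ≫ a, b, c ≫ e.inv⟦(1 : ℤ)⟧', ?_⟩
  refine isomorphic_distinguished _ hT' _
    (Triangle.isoMk _ _ e (Iso.refl _) (Iso.refl _) ?_ ?_ ?_)
  · exact Category.comp_id _
  · exact (Category.comp_id _).trans (Category.id_comp _).symm
  · refine Eq.trans ?_ (Category.id_comp _).symm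
    change (c ≫ e.inv⟦(1 : ℤ)⟧') ≫ e.hom⟦(1 : ℤ)⟧' = c
    rw [Category.assoc, ← Functor.map_comp, e.inv_hom_id, Functor.map_id, Category.comp_id]

instance heart_containsZero (t : TStructure C) : t.heart.ContainsZero :=
  ⟨0, isZero_zero C, (t.mem_heart_iff _).2 ⟨inferInstance, inferInstance⟩⟩

instance heart_isClosedUnderBinaryProducts (t : TStructure C) :
    t.heart.IsClosedUnderBinaryProducts := by
  refine ObjectProperty.IsClosedUnderLimitsOfShape.mk' ?_
  rintro _ ⟨F, hF⟩
  have e : limit F ≅ F.obj ⟨.left⟩ ⨯ F.obj ⟨.right⟩ := lim.mapIso (diagramIsoPair F)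
  refine t.heart.prop_of_iso e.symm ?_
  have h₁ := (t.mem_heart_iff _).1 (hF ⟨.left⟩)
  have h₂ := (t.mem_heart_iff _).1 (hF ⟨.right⟩)
  have hT := binaryProductTriangle_distinguished (F.obj ⟨.left⟩) (F.obj ⟨.right⟩)
  exact (t.mem_heart_iff _).2 ⟨t.isLE₂ _ hT 0 h₁.1 h₂.1, t.isGE₂ _ hT 0 h₁.2 h₂.2⟩

instance heart_isClosedUnderFiniteProducts (t : TStructure C) :
    t.heart.IsClosedUnderFiniteProducts := .mk'

/-- The abelian structure on the heart, on top of the preadditive structure that the heart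
inherits as a full subcategory. -/
noncomputable instance heartAbelian [IsTriangulated C] (t : TStructure C) :
    Abelian t.heart.FullSubcategory :=
  AbelianSubcategory.abelian t.heart.ι t.heart_hom_shift_eq_zero t.heart_admissibleMorphism

end

end CategoryTheory.Triangulated.TStructure

/-! ### Torsion pairs and the Happel-Reiten-Smalø t-structure -/

section

variable {A : Type u} [Category.{v} A] [Abelian A]

variable (A) in
/-- A torsion pair `(T, F)` in an abelian category: two full subcategories, closed under
isomorphisms, with `Hom(T, F) = 0`, such that every object `X` is the middle term of a short exact
sequence `0 ⟶ T_X ⟶ X ⟶ F_X ⟶ 0` with `T_X` in `T` and `F_X` in `F`. -/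
structure TorsionPair where
  /-- The torsion class `T`. -/
  torsion : ObjectProperty A
  /-- The torsion-free class `F`. -/
  torsionFree : ObjectProperty A
  torsion_iso : torsion.IsClosedUnderIsomorphisms
  torsionFree_iso : torsionFree.IsClosedUnderIsomorphisms
  hom_eq_zero : ∀ ⦃X Y : A⦄ (f : X ⟶ Y), torsion X → torsionFree Y → f = 0
  exists_shortExact : ∀ X : A, ∃ (T F : A) (i : T ⟶ X) (p : X ⟶ F) (w : i ≫ p = 0),
    torsion T ∧ torsionFree F ∧ (ShortComplex.mk i p w).ShortExact

namespace TorsionPair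

attribute [instance] torsion_iso torsionFree_iso

variable (t : TorsionPair A)

lemma torsion_of_isZero {X : A} (hX : IsZero X) : t.torsion X := by
  obtain ⟨T, F, i, p, w, hT, hF, h⟩ := t.exists_shortExact X
  have := h.mono_f
  have hT' : IsZero T := IsZero.of_mono i hX
  exact t.torsion.prop_of_iso (hT'.iso hX) hT

lemma torsionFree_of_isZero {X : A} (hX : IsZero X) : t.torsionFree X := by
  obtain ⟨T, F, i, p, w, hT, hF, h⟩ := t.exists_shortExact X
  have := h.epi_g
  have hT' : IsZero F := IsZero.of_epi p hX
  exact t.torsionFree.prop_of_iso (hT'.iso hX) hF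

end TorsionPair

namespace DerivedCategory

variable [HasDerivedCategory.{w} A]


open HomologySequence in
lemma isIso_homologyMap_mor₂ (T : Triangle (DerivedCategory A)) (hT : T ∈ distTriang _) (n m : ℤ)
    (hm : n + 1 = m)
    (h₁ : IsZero ((homologyFunctor A n).obj T.obj₁))
    (h₂ : IsZero ((homologyFunctor A m).obj T.obj₁)) :
    IsIso ((homologyFunctor A n).map T.mor₂) := by
  have := (mono_homologyMap_mor₂_iff T hT n).2 (h₁.eq_of_src _ _)
  have := (epi_homologyMap_mor₂_iff T hT n m hm).2 (h₂.eq_of_tgt _ _)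
  exact isIso_of_mono_of_epi _

open HomologySequence in
lemma isIso_homologyMap_mor₁ (T : Triangle (DerivedCategory A)) (hT : T ∈ distTriang _) (m n : ℤ)
    (hm : m + 1 = n)
    (h₁ : IsZero ((homologyFunctor A m).obj T.obj₃))
    (h₂ : IsZero ((homologyFunctor A n).obj T.obj₃)) :
    IsIso ((homologyFunctor A n).map T.mor₁) := by
  have := (mono_homologyMap_mor₁_iff T hT m n hm).2 (h₁.eq_of_src _ _)
  have := (epi_homologyMap_mor₁_iff T hT n).2 (h₂.eq_of_tgt _ _)
  exact isIso_of_mono_of_epi _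

lemma exists_to_single (X : DerivedCategory A) [X.IsLE 0] :
    ∃ (N : A) (g : X ⟶ (singleFunctor A 0).obj N), IsIso ((homologyFunctor A 0).map g) ∧
      ∀ (Y : DerivedCategory A) [Y.IsGE 0] (f : X ⟶ Y), ∃ φ, f = g ≫ φ := by
  obtain ⟨B, C, hB, hC, a, b, c, hT⟩ := DerivedCategory.TStructure.t.exists_triangle X (-1) 0 (by simp)
  replace hB : B.IsLE (-1) := ⟨hB⟩
  replace hC : C.IsGE 0 := ⟨hC⟩
  have lB : IsLE (B⟦(1 : ℤ)⟧) (-2) := DerivedCategory.TStructure.t.isLE_shift B (-1) 1 (-2)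
  have lB' : IsLE (B⟦(1 : ℤ)⟧) 0 := DerivedCategory.TStructure.t.isLE_of_le _ (-2) 0
  have lC : C.IsLE 0 := DerivedCategory.TStructure.t.isLE₂ _ (rot_of_distTriang _ hT) 0 ‹_› lB'
  obtain ⟨N, ⟨e⟩⟩ := exists_iso_singleFunctor_obj_of_isGE_of_isLE C 0
  have h := isIso_homologyMap_mor₂ _ hT 0 1 rfl (isZero_of_isLE B (-1) 0 (by simp))
    (isZero_of_isLE B (-1) 1 (by simp))
  replace h : IsIso ((homologyFunctor A 0).map b) := h
  refine ⟨N, b ≫ e.hom, ?_, fun Y _ f ↦ ?_⟩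
  · rw [Functor.map_comp]; infer_instance
  · obtain ⟨φ, hφ⟩ : ∃ φ : C ⟶ Y, f = b ≫ φ := Triangle.yoneda_exact₂ _ hT f
      (DerivedCategory.TStructure.t.zero_of_isLE_of_isGE _ (-1) 0 (by simp) hB ‹_›)
    exact ⟨e.inv ≫ φ, by simp [hφ]⟩

lemma exists_from_single (Y : DerivedCategory A) [Y.IsGE 0] :
    ∃ (N : A) (g : (singleFunctor A 0).obj N ⟶ Y), IsIso ((homologyFunctor A 0).map g) ∧
      ∀ (X : DerivedCategory A) [X.IsLE 0] (f : X ⟶ Y), ∃ φ, f = φ ≫ g := by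
  obtain ⟨B, C, hB, hC, a, b, c, hT⟩ := DerivedCategory.TStructure.t.exists_triangle Y 0 1 (by simp)
  replace hB : B.IsLE 0 := ⟨hB⟩
  replace hC : C.IsGE 1 := ⟨hC⟩
  have gC : IsGE (C⟦(-1 : ℤ)⟧) 2 := DerivedCategory.TStructure.t.isGE_shift C 1 (-1) 2
  have gC' : IsGE (C⟦(-1 : ℤ)⟧) 0 := DerivedCategory.TStructure.t.isGE_of_ge _ 0 2
  have gB : B.IsGE 0 := DerivedCategory.TStructure.t.isGE₂ _ (inv_rot_of_distTriang _ hT) 0 gC' ‹_›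
  obtain ⟨N, ⟨e⟩⟩ := exists_iso_singleFunctor_obj_of_isGE_of_isLE B 0
  have h := isIso_homologyMap_mor₁ _ hT (-1) 0 rfl (isZero_of_isGE C 1 (-1) (by simp))
    (isZero_of_isGE C 1 0 (by simp))
  replace h : IsIso ((homologyFunctor A 0).map a) := h
  refine ⟨N, e.inv ≫ a, ?_, fun X _ f ↦ ?_⟩
  · rw [Functor.map_comp]; infer_instance
  · obtain ⟨φ, hφ⟩ : ∃ φ : X ⟶ B, f = φ ≫ a := Triangle.coyoneda_exact₂ _ hT f
      (DerivedCategory.TStructure.t.zero_of_isLE_of_isGE _ 0 1 (by simp) ‹_› hC)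
    exact ⟨φ ≫ e.hom, by simp [hφ]⟩

end DerivedCategory

namespace TorsionPair

open DerivedCategory HomologySequence

variable (t : TorsionPair A) [HasDerivedCategory.{w} A]

/-- The isomorphism `H^m(X[a]) ≅ H^n(X)` for `a + m = n`. -/
noncomputable def homologyShiftIso (X : DerivedCategory A) (a m n : ℤ) (h : a + m = n) :
    (homologyFunctor A m).obj (X⟦a⟧) ≅ (homologyFunctor A n).obj X :=
  ((homologyFunctor A 0).shiftIso a m n h).app X

lemma exists_triangle_hrs (X : DerivedCategory A) :
    ∃ (U W : DerivedCategory A) (_ : U.IsLE 0 ∧ t.torsion ((homologyFunctor A 0).obj U))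
      (_ : W.IsGE 0 ∧ t.torsionFree ((homologyFunctor A 0).obj W))
      (f : U ⟶ X) (g : X ⟶ W) (h : W ⟶ U⟦(1 : ℤ)⟧), Triangle.mk f g h ∈ distTriang _ := by
  obtain ⟨B, C, hB, hC, a, b, c, hT⟩ := DerivedCategory.TStructure.t.exists_triangle X 0 1 (by simp)
  replace hB : B.IsLE 0 := ⟨hB⟩
  replace hC : C.IsGE 1 := ⟨hC⟩
  obtain ⟨N, g, hg, -⟩ := exists_to_single B
  obtain ⟨T, F, i, p, w, hT', hF, hS⟩ := t.exists_shortExact N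
  have := hS.mono_f
  have := hS.epi_g
  let q := g ≫ (singleFunctor A 0).map p
  let eN : ∀ N : A, (homologyFunctor A 0).obj ((singleFunctor A 0).obj N) ≅ N :=
    (singleFunctorCompHomologyFunctorIso A 0).app
  have hp : (homologyFunctor A 0).map ((singleFunctor A 0).map p) ≫ (eN F).hom =
      (eN N).hom ≫ p := (singleFunctorCompHomologyFunctorIso A 0).hom.naturality p
  have hq : (homologyFunctor A 0).map q ≫ (eN F).hom =
      ((homologyFunctor A 0).map g ≫ (eN N).hom) ≫ p := by
    simp only [q, Functor.map_comp, Category.assoc, hp]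
  have hq_epi : Epi ((homologyFunctor A 0).map q) := by
    have : Epi ((homologyFunctor A 0).map q ≫ (eN F).hom) := by rw [hq]; infer_instance
    have h2 : (homologyFunctor A 0).map q = ((homologyFunctor A 0).map q ≫ (eN F).hom) ≫
      (eN F).inv := by simp
    rw [h2]; infer_instance
  obtain ⟨U, u, δ', hU⟩ := distinguished_cocone_triangle₁ q
  obtain ⟨W, v, δ'', hW⟩ := distinguished_cocone_triangle (u ≫ a)
  have O := someOctahedron rfl hU hT hW
  have hO := O.mem
  refine ⟨U, W, ⟨?_, ?_⟩, ⟨?_, ?_⟩, _, _, _, hW⟩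
  · rw [isLE_iff]
    intro k hk
    have h1 : Epi ((homologyFunctor A (k - 1)).map q) := by
      by_cases hk' : k = 1
      · subst hk'; exact hq_epi
      · exact ⟨fun _ _ _ ↦ (isZero_of_isLE _ 0 (k - 1) (by lia)).eq_of_src _ _⟩
    have h2 : Mono ((homologyFunctor A k).map u) := (mono_homologyMap_mor₁_iff _ hU (k - 1) k (by lia)).2
      ((epi_homologyMap_mor₂_iff _ hU (k - 1) k (by lia)).1 h1)
    exact IsZero.of_mono ((homologyFunctor A k).map u) (isZero_of_isLE B 0 k hk)
  · have h1 : Mono ((homologyFunctor A 0).map u) := (mono_homologyMap_mor₁_iff _ hU (-1) 0 rfl).2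
      ((isZero_of_isGE ((singleFunctor A 0).obj F) 0 (-1) (by simp)).eq_of_src _ _)
    have wuq : u ≫ q = 0 := comp_distTriang_mor_zero₁₂ _ hU
    have h2 : (ShortComplex.mk ((homologyFunctor A 0).map u) ((homologyFunctor A 0).map q)
      (by rw [← Functor.map_comp, wuq, Functor.map_zero])).Exact := exact₂ _ hU 0
    have : Mono (ShortComplex.mk ((homologyFunctor A 0).map u) ((homologyFunctor A 0).map q)
      (by rw [← Functor.map_comp, wuq, Functor.map_zero])).f := h1
    have k₁ := ShortComplex.Exact.fIsKernel h2
    have k₂ := hS.fIsKernel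
    refine t.torsion.prop_of_iso ?_ hT'
    exact k₂.conePointUniqueUpToIso (limit.isLimit _) ≪≫
      (kernel.mapIso ((homologyFunctor A 0).map q) p
        (asIso ((homologyFunctor A 0).map g) ≪≫ eN N) (eN F) (by simpa using hq)).symm ≪≫
      (k₁.conePointUniqueUpToIso (limit.isLimit _)).symm
  · have : C.IsGE 0 := DerivedCategory.TStructure.t.isGE_of_ge _ 0 1
    exact DerivedCategory.TStructure.t.isGE₂ _ hO 0 (inferInstanceAs (((singleFunctor A 0).obj F).IsGE 0)) this
  · have h := isIso_homologyMap_mor₁ _ hO (-1) 0 rfl (isZero_of_isGE C 1 (-1) (by simp))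
      (isZero_of_isGE C 1 0 (by simp))
    exact t.torsionFree.prop_of_iso ((eN F).symm ≪≫ @asIso _ _ _ _ _ h) hF

lemma hrs_zero {X Y : DerivedCategory A} (f : X ⟶ Y)
    (hX : X.IsLE 0 ∧ t.torsion ((homologyFunctor A 0).obj X))
    (hY : Y.IsGE 0 ∧ t.torsionFree ((homologyFunctor A 0).obj Y)) : f = 0 := by
  obtain ⟨hX, hX'⟩ := hX
  obtain ⟨hY, hY'⟩ := hY
  let eN : ∀ N : A, (homologyFunctor A 0).obj ((singleFunctor A 0).obj N) ≅ N :=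
    (singleFunctorCompHomologyFunctorIso A 0).app
  obtain ⟨M, g, hg, h⟩ := exists_to_single X
  obtain ⟨N, g', hg', h'⟩ := exists_from_single Y
  obtain ⟨φ, rfl⟩ := h Y f
  obtain ⟨ψ, rfl⟩ := h' _ φ
  obtain ⟨ψ, rfl⟩ := (singleFunctor A 0).map_surjective ψ
  rw [t.hom_eq_zero ψ (t.torsion.prop_of_iso (asIso ((homologyFunctor A 0).map g) ≪≫ eN M) hX')
    (t.torsionFree.prop_of_iso ((asIso ((homologyFunctor A 0).map g')).symm ≪≫ eN N) hY')]
  simp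

/-- The Happel-Reiten-Smalø t-structure attached to a torsion pair `(T, F)`. Its aisle `le 0`
consists of the `X` with `H^i(X) = 0` for `i > 0` and `H^0(X)` in `T`, and its co-aisle `ge 0`
of the `X` with `H^i(X) = 0` for `i < -1` and `H^{-1}(X)` in `F`; `le n` and `ge n` are the shifts
of these by `-n`. -/
noncomputable def tStructure : CategoryTheory.Triangulated.TStructure (DerivedCategory A) where
  le n X := X.IsLE n ∧ t.torsion ((homologyFunctor A n).obj X)
  ge n X := X.IsGE (n - 1) ∧ t.torsionFree ((homologyFunctor A (n - 1)).obj X)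
  le_isClosedUnderIsomorphisms n := ⟨fun {X Y} e h ↦
    have := h.1
    ⟨DerivedCategory.TStructure.t.isLE_of_iso e n,
      t.torsion.prop_of_iso ((homologyFunctor A n).mapIso e) h.2⟩⟩
  ge_isClosedUnderIsomorphisms n := ⟨fun {X Y} e h ↦
    have := h.1
    ⟨DerivedCategory.TStructure.t.isGE_of_iso e (n - 1),
      t.torsionFree.prop_of_iso ((homologyFunctor A (n - 1)).mapIso e) h.2⟩⟩
  le_shift n a n' h X hX :=
    have := hX.1
    ⟨DerivedCategory.TStructure.t.isLE_shift X n a n' h,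
      t.torsion.prop_of_iso (homologyShiftIso X a n' n h).symm hX.2⟩
  ge_shift n a n' h X hX :=
    have := hX.1
    ⟨DerivedCategory.TStructure.t.isGE_shift X (n - 1) a (n' - 1) (by lia),
      t.torsionFree.prop_of_iso (homologyShiftIso X a (n' - 1) (n - 1) (by lia)).symm hX.2⟩
  zero' X Y f hX hY := t.hrs_zero f hX (by simpa using hY)
  le_zero_le X hX :=
    have := hX.1
    ⟨DerivedCategory.TStructure.t.isLE_of_le X 0 1,
      t.torsion_of_isZero (isZero_of_isLE X 0 1 (by simp))⟩
  ge_one_le X hX :=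
    have : X.IsGE 0 := by simpa using hX.1
    ⟨DerivedCategory.TStructure.t.isGE_of_ge X (0 - 1) 0,
      t.torsionFree_of_isZero (isZero_of_isGE X 0 (0 - 1) (by simp))⟩
  exists_triangle_zero_one X := by
    simpa using t.exists_triangle_hrs X

/-- The heart of the Happel-Reiten-Smalø t-structure, a full subcategory of the derived
category. -/
abbrev Heart : Type (max u v) := t.tStructure.heart.FullSubcategory

/-- A torsion pair is hereditary if its torsion class is closed under subobjects. -/
def IsHereditary {A : Type u} [Category.{v} A] [Abelian A] (t : TorsionPair A) : Prop :=
  t.torsion.IsClosedUnderSubobjects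

/-- Each object of the heart is isomorphic in the derived category to a complex which is
concentrated in degrees `-1` and `0` and has its terms in `P`. -/
def HeartRepresentedByTwoTermComplexes (P : ObjectProperty A) : Prop :=
  ∀ M : t.Heart, ∃ K : CochainComplex A ℤ,
    Nonempty (M.obj ≅ DerivedCategory.Q.obj K) ∧
      (∀ k : ℤ, k ≠ -1 → k ≠ 0 → IsZero (K.X k)) ∧ P (K.X (-1)) ∧ P (K.X 0)

end TorsionPair

end

/-! ### Categorical conditions -/

/-- An abelian category is AB5 (with respect to the universe `w`) if filtered colimits, equivalently
direct limits over directed sets, of size `w` exist and are exact. As an abelian category has finite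
colimits, the existence of filtered colimits is the same as the existence of coproducts (AB3). -/
def IsAB5 (C : Type u) [Category.{v} C] [Abelian C] : Prop :=
  ∃ _ : HasFilteredColimitsOfSize.{w, w} C, AB5OfSize.{w, w} C

/-- A class of objects is closed under direct limits if it contains the colimit of every direct
system, indexed by a directed set of size `w`, of objects of the class. -/
def IsClosedUnderDirectLimits {C : Type u} [Category.{v} C] (P : ObjectProperty C) : Prop :=
  ∀ (I : Type w) [PartialOrder I] [IsDirectedOrder I] [Nonempty I],
    P.IsClosedUnderColimitsOfShape I

/-- A class of objects is generating if every object is a quotient of an object of the class. -/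
def IsGeneratingClass {C : Type u} [Category.{v} C] (P : ObjectProperty C) : Prop :=
  ∀ X : C, ∃ (Y : C) (p : Y ⟶ X), P Y ∧ Epi p

/-- A class of objects is cogenerating if every object embeds in an object of the class. -/
def IsCogeneratingClass {C : Type u} [Category.{v} C] (P : ObjectProperty C) : Prop :=
  ∀ X : C, ∃ (Y : C) (i : X ⟶ Y), P Y ∧ Mono i

/-! Everything rests on `isGrothendieckAbelian_heart_tfae`. An object `M` of the heart is an
extension of the torsion object `H⁰(M)`, in degree `0`, by the torsion-free object `H⁻¹(M)`, in
degree `-1` (`exists_shortExact_heart`). Since `Hom(F[1], T[0]) = 0`, most arguments reduce to these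
two pieces.

Closure of `F` implies AB5. For `I` directed, `colim` on `I ⥤ G` is exact, so it acts on derived
categories and is left adjoint to constant diagrams. Give `I ⥤ G` the pointwise torsion pair:
closure of `F` makes `colim` respect the hearts, and it is exact there because short exact sequences
in a heart are triangles. It remains to identify the heart over `I ⥤ G` with the diagrams `I ⥤
t.Heart` (`isEquivalence_toHeartFunctor`). This is not formal, as the objects of `D(I ⥤ G)` are not
merely diagrams in `D(G)`. For discrete `I`, fractions and homotopies are chosen pointwise. For a
poset, the evaluations have exact adjoints on both sides; they yield free objects, which present
everything.

Closure of `F` implies a separator (`hasSeparator_heart`). Let `X` separate `G`. A nonzero `f : M ⟶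
P` either is nonzero on `H⁻¹(M)[1]`, and a shifted quotient of `X` detects it, or factors through
`H⁰(M)[0]`. Now `H⁰(M)` is a filtered colimit of torsion parts `T` of quotients of finite sums of
copies of `X`, and each map `T ⟶ H⁰(M)` is reached by mapping to `M` the cone of some `Z ⟶ B`, with
`B` a sum of copies of `X`, `Z` a quotient of such a sum, and sizes bounded independently of `M`.

AB5 implies closure of `F`. It suffices that a torsion colimit `C` of torsion-free `F_i` vanishes.
Take an epimorphism `P ⟶ C` with `P` torsion-free and kernel `K`, and `Q_i = P ×_C F_i`. The
sequences `0 ⟶ K ⟶ Q_i ⟶ F_i ⟶ 0` shift into the heart, where the `F_i[1]` have colimit zero. By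
AB5, `K[1]` is the colimit of the `Q_i[1]`, whence compatible retractions `Q_i ⟶ K`. So `colim Q_i ⟶
C` splits in `G`; as it factors through `P` and `Hom(C, P) = 0`, `C` is zero. -/

/-! ### Functors between derived categories induced by exact functors -/

section

universe w' v' u'

variable {A : Type u} [Category.{v} A] [Abelian A] {B : Type u'} [Category.{v'} B] [Abelian B]

namespace CategoryTheory

/-- The adjunction between categories of complexes induced by an adjunction between additive
functors. -/
def Adjunction.mapHomologicalComplex {Φ : A ⥤ B} {Ψ : B ⥤ A} (adj : Φ ⊣ Ψ)
    [Φ.PreservesZeroMorphisms] [Ψ.PreservesZeroMorphisms] {ι : Type*} (c : ComplexShape ι) :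
    Φ.mapHomologicalComplex c ⊣ Ψ.mapHomologicalComplex c where
  unit := { app K := { f i := adj.unit.app (K.X i)
                       comm' _ _ _ := adj.unit_naturality _ }
            naturality _ _ f := by ext i; exact (adj.unit_naturality (f.f i)).symm }
  counit := { app K := { f i := adj.counit.app (K.X i)
                         comm' _ _ _ := (adj.counit_naturality _).symm }
              naturality _ _ f := by ext i; exact adj.counit_naturality (f.f i) }
  left_triangle_components K := by ext i; exact adj.left_triangle_components (K.X i)
  right_triangle_components K := by ext i; exact adj.right_triangle_components (K.X i)

end CategoryTheory

namespace DerivedCategory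

variable [HasDerivedCategory.{w} A] [HasDerivedCategory.{w'} B]

lemma exists_iso_Q_obj (X : DerivedCategory A) : ∃ K : CochainComplex A ℤ, Nonempty (Q.obj K ≅ X) :=
  ⟨Q.objPreimage X, ⟨Q.objObjPreimageIso X⟩⟩

noncomputable instance (Φ : A ⥤ B) [Φ.Additive] [PreservesFiniteLimits Φ] [PreservesFiniteColimits Φ] :
    CatCommSq (Φ.mapHomologicalComplex (ComplexShape.up ℤ)) Q Q Φ.mapDerivedCategory where
  iso := Φ.mapDerivedCategoryFactors.symm

/-- Exact functors commute with the homology of complexes. The functor `Φ'` is only required to lie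
over `Φ`, so that the evaluations `eval` are covered as well as `mapDerivedCategory`. -/
lemma nonempty_homologyFunctor_obj_iso
    (Φ : A ⥤ B) [Φ.Additive] [PreservesFiniteLimits Φ] [PreservesFiniteColimits Φ]
    (Φ' : DerivedCategory A ⥤ DerivedCategory B)
    [CatCommSq (Φ.mapHomologicalComplex (ComplexShape.up ℤ)) Q Q Φ']
    (X : DerivedCategory A) (n : ℤ) :
    Nonempty ((homologyFunctor B n).obj (Φ'.obj X) ≅ Φ.obj ((homologyFunctor A n).obj X)) := by
  obtain ⟨K, ⟨e⟩⟩ := exists_iso_Q_obj X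
  exact ⟨(homologyFunctor B n).mapIso (Φ'.mapIso e.symm ≪≫
      ((CatCommSq.iso (Φ.mapHomologicalComplex (ComplexShape.up ℤ)) Q Q Φ').app K).symm) ≪≫
    (homologyFunctorFactors B n).app _ ≪≫ (K.sc n).mapHomologyIso Φ ≪≫
    Φ.mapIso (((homologyFunctorFactors A n).app K).symm ≪≫ (homologyFunctor A n).mapIso e)⟩

lemma isLE_obj_of_exact
    (Φ : A ⥤ B) [Φ.Additive] [PreservesFiniteLimits Φ] [PreservesFiniteColimits Φ]
    (Φ' : DerivedCategory A ⥤ DerivedCategory B)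
    [CatCommSq (Φ.mapHomologicalComplex (ComplexShape.up ℤ)) Q Q Φ']
    (X : DerivedCategory A) (n : ℤ) (hX : X.IsLE n) : (Φ'.obj X).IsLE n := by
  rw [isLE_iff] at hX ⊢
  intro k hk
  obtain ⟨e⟩ := nonempty_homologyFunctor_obj_iso Φ Φ' X k
  exact (Φ.map_isZero (hX k hk)).of_iso e

lemma isGE_obj_of_exact
    (Φ : A ⥤ B) [Φ.Additive] [PreservesFiniteLimits Φ] [PreservesFiniteColimits Φ]
    (Φ' : DerivedCategory A ⥤ DerivedCategory B)
    [CatCommSq (Φ.mapHomologicalComplex (ComplexShape.up ℤ)) Q Q Φ']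
    (X : DerivedCategory A) (n : ℤ) (hX : X.IsGE n) : (Φ'.obj X).IsGE n := by
  rw [isGE_iff] at hX ⊢
  intro k hk
  obtain ⟨e⟩ := nonempty_homologyFunctor_obj_iso Φ Φ' X k
  exact (Φ.map_isZero (hX k hk)).of_iso e

/-- The adjunction between derived categories induced by an adjunction between exact functors. -/
noncomputable def adjunctionOfExact {Φ : A ⥤ B} {Ψ : B ⥤ A} (adj : Φ ⊣ Ψ) [Φ.Additive] [Ψ.Additive]
    (Φ' : DerivedCategory A ⥤ DerivedCategory B) (Ψ' : DerivedCategory B ⥤ DerivedCategory A)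
    [CatCommSq (Φ.mapHomologicalComplex (ComplexShape.up ℤ)) Q Q Φ']
    [CatCommSq (Ψ.mapHomologicalComplex (ComplexShape.up ℤ)) Q Q Ψ'] : Φ' ⊣ Ψ' :=
  (adj.mapHomologicalComplex (ComplexShape.up ℤ)).localization
    Q (HomologicalComplex.quasiIso A (ComplexShape.up ℤ))
    Q (HomologicalComplex.quasiIso B (ComplexShape.up ℤ)) Φ' Ψ'

lemma adjunctionOfExact_counit_app {Φ : A ⥤ B} {Ψ : B ⥤ A} (adj : Φ ⊣ Ψ) [Φ.Additive] [Ψ.Additive]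
    (Φ' : DerivedCategory A ⥤ DerivedCategory B) (Ψ' : DerivedCategory B ⥤ DerivedCategory A)
    [CatCommSq (Φ.mapHomologicalComplex (ComplexShape.up ℤ)) Q Q Φ']
    [CatCommSq (Ψ.mapHomologicalComplex (ComplexShape.up ℤ)) Q Q Ψ'] (K : CochainComplex B ℤ) :
    (adjunctionOfExact adj Φ' Ψ').counit.app (Q.obj K) =
      Φ'.map ((CatCommSq.iso (Ψ.mapHomologicalComplex (ComplexShape.up ℤ)) Q Q Ψ').inv.app K) ≫
        (CatCommSq.iso (Φ.mapHomologicalComplex (ComplexShape.up ℤ)) Q Q Φ').inv.app _ ≫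
          Q.map ((adj.mapHomologicalComplex (ComplexShape.up ℤ)).counit.app K) :=
  Adjunction.localization_counit_app ..

end DerivedCategory

namespace TorsionPair

open DerivedCategory

variable [HasDerivedCategory.{w} A] [HasDerivedCategory.{w'} B] (t : TorsionPair A)
  (s : TorsionPair B)

lemma mem_heart_iff (X : DerivedCategory A) :
    t.tStructure.heart X ↔ (X.IsLE 0 ∧ t.torsion ((homologyFunctor A 0).obj X)) ∧
      (X.IsGE (-1) ∧ t.torsionFree ((homologyFunctor A (-1)).obj X)) := Iff.rfl

/-- Membership in the heart is a condition on homology objects, and these are carried along by `Φ`.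
-/
lemma heart_of_exact (Φ : A ⥤ B) [Φ.Additive] [PreservesFiniteLimits Φ] [PreservesFiniteColimits Φ]
    (Φ' : DerivedCategory A ⥤ DerivedCategory B)
    [CatCommSq (Φ.mapHomologicalComplex (ComplexShape.up ℤ)) Q Q Φ']
    (hT : ∀ X, t.torsion X → s.torsion (Φ.obj X))
    (hF : ∀ X, t.torsionFree X → s.torsionFree (Φ.obj X)) (X : DerivedCategory A)
    (hX : t.tStructure.heart X) : s.tStructure.heart (Φ'.obj X) := by
  rw [mem_heart_iff] at hX ⊢
  obtain ⟨e⟩ := nonempty_homologyFunctor_obj_iso Φ Φ' X 0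
  obtain ⟨e'⟩ := nonempty_homologyFunctor_obj_iso Φ Φ' X (-1)
  exact ⟨⟨isLE_obj_of_exact Φ Φ' X 0 hX.1.1, s.torsion.prop_of_iso e.symm (hT _ hX.1.2)⟩,
    ⟨isGE_obj_of_exact Φ Φ' X (-1) hX.2.1, s.torsionFree.prop_of_iso e'.symm (hF _ hX.2.2)⟩⟩

variable {t s} in
/-- The functor between hearts which is induced by a functor between derived categories. -/
noncomputable abbrev heartFunctor (Φ' : DerivedCategory A ⥤ DerivedCategory B)
    (hΦ : ∀ X, t.tStructure.heart X → s.tStructure.heart (Φ'.obj X)) : t.Heart ⥤ s.Heart :=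
  s.tStructure.heart.lift (t.tStructure.heart.ι ⋙ Φ') fun X ↦ hΦ _ X.property

variable {t s} in
/-- The adjunction between hearts which is induced by an adjunction between derived categories. -/
noncomputable def heartAdjunction {Φ' : DerivedCategory A ⥤ DerivedCategory B}
    {Ψ' : DerivedCategory B ⥤ DerivedCategory A} (adj : Φ' ⊣ Ψ')
    (hΦ : ∀ X, t.tStructure.heart X → s.tStructure.heart (Φ'.obj X))
    (hΨ : ∀ X, s.tStructure.heart X → t.tStructure.heart (Ψ'.obj X)) :
    heartFunctor Φ' hΦ ⊣ heartFunctor Ψ' hΨ :=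
  adj.restrictFullyFaithful t.tStructure.heart.fullyFaithfulι s.tStructure.heart.fullyFaithfulι
    (Iso.refl _) (Iso.refl _)

end TorsionPair

end

/-! ### Evaluation of objects in the derived category of a functor category -/

section

universe w' v' u'

namespace DerivedCategory

variable (I : Type u') [Category.{v'} I] (A : Type u) [Category.{v} A] [Abelian A]
  [HasDerivedCategory.{w} A]

/-- The functor which sends a complex of functors to the corresponding functor to the derived
category. -/
noncomputable abbrev complexToFunctor : CochainComplex (I ⥤ A) ℤ ⥤ I ⥤ DerivedCategory A :=
  HomologicalComplex.complexOfFunctorsToFunctorToComplex ⋙ (Functor.whiskeringRight I _ _).obj Q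

lemma complexToFunctor_inverts :
    (HomologicalComplex.quasiIso (I ⥤ A) (ComplexShape.up ℤ)).IsInvertedBy
      (complexToFunctor I A) := by
  intro K L f hf
  rw [NatTrans.isIso_iff_isIso_app]
  intro i
  exact (isIso_Q_map_iff_quasiIso _ _).2 ((HomologicalComplex.quasiIso_iff_evaluation f).1 hf i)

variable [HasDerivedCategory.{w'} (I ⥤ A)]

/-- The functor which sends an object of the derived category of a functor category to the diagram
of its evaluations. -/
noncomputable def toFunctor : DerivedCategory (I ⥤ A) ⥤ I ⥤ DerivedCategory A :=
  Localization.lift (complexToFunctor I A) (complexToFunctor_inverts I A) Q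

/-- The functor `toFunctor I A` is induced by `complexToFunctor I A`. -/
noncomputable def toFunctorFactors : Q ⋙ toFunctor I A ≅ complexToFunctor I A :=
  Localization.fac _ _ _

/-- The evaluation at an object of an object of the derived category of a functor category. -/
noncomputable abbrev eval (i : I) : DerivedCategory (I ⥤ A) ⥤ DerivedCategory A :=
  toFunctor I A ⋙ (evaluation I _).obj i

noncomputable instance (i : I) :
    CatCommSq (((evaluation I A).obj i).mapHomologicalComplex (ComplexShape.up ℤ)) Q Q
      (eval I A i) where
  iso := (Functor.isoWhiskerRight (toFunctorFactors I A) ((evaluation I _).obj i)).symm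

/-- The evaluation functor on the derived category is induced by the (exact) evaluation functor. -/
noncomputable def evalIso (i : I) : eval I A i ≅ ((evaluation I A).obj i).mapDerivedCategory :=
  letI : Localization.Lifting Q (HomologicalComplex.quasiIso (I ⥤ A) (ComplexShape.up ℤ))
      (((evaluation I A).obj i).mapHomologicalComplex (ComplexShape.up ℤ) ⋙ Q) (eval I A i) :=
    ⟨(CatCommSq.iso (((evaluation I A).obj i).mapHomologicalComplex (ComplexShape.up ℤ)) Q Q
      (eval I A i)).symm⟩
  Localization.liftNatIso Q (HomologicalComplex.quasiIso (I ⥤ A) (ComplexShape.up ℤ))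
    (((evaluation I A).obj i).mapHomologicalComplex (ComplexShape.up ℤ) ⋙ Q)
    (((evaluation I A).obj i).mapHomologicalComplex (ComplexShape.up ℤ) ⋙ Q) _ _ (Iso.refl _)

instance (i : I) : (eval I A i).Additive :=
  Functor.additive_of_iso (evalIso I A i).symm

instance : (toFunctor I A).Additive where
  map_add {X Y f g} := by
    ext i
    exact (eval I A i).map_add

variable {I A} in
lemma isZero_of_isZero_eval (X : DerivedCategory (I ⥤ A)) (hX : ∀ i, IsZero ((eval I A i).obj X)) :
    IsZero X := by
  obtain ⟨K, ⟨e⟩⟩ := exists_iso_Q_obj X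
  refine IsZero.of_iso ?_ e.symm
  -- Acyclicity is encoded as a quasi-isomorphism to the zero complex, a condition which can be
  -- checked pointwise.
  have : QuasiIso (0 : K ⟶ 0) := by
    rw [HomologicalComplex.quasiIso_iff_evaluation]
    intro i
    have hz : IsZero (Q.obj ((((evaluation I A).obj i).mapHomologicalComplex
        (ComplexShape.up ℤ)).obj K)) :=
      (hX i).of_iso ((CatCommSq.iso (((evaluation I A).obj i).mapHomologicalComplex
        (ComplexShape.up ℤ)) Q Q (eval I A i)).app K ≪≫ (eval I A i).mapIso e)
    rw [← isIso_Q_map_iff_quasiIso]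
    refine ⟨0, hz.eq_of_src _ _, IsZero.eq_of_src ?_ _ _⟩
    exact Functor.map_isZero _ (Functor.map_isZero _ (isZero_zero _))
  have := (isIso_Q_map_iff_quasiIso _ _).2 this
  exact (Functor.map_isZero Q (isZero_zero _)).of_iso (asIso (Q.map (0 : K ⟶ 0)))

end DerivedCategory

end

/-! ### Families of objects in the derived category -/

section

universe w' v' u' u''

namespace DerivedCategory

variable {S : Type u''} {A : Type u} [Category.{v} A] [Abelian A]

/-- The complex of functors on a discrete category given by a family of complexes. -/
@[simps]
def familyComplex (K : S → CochainComplex A ℤ) : CochainComplex (Discrete S ⥤ A) ℤ where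
  X n := Discrete.functor fun s ↦ (K s).X n
  d i j := Discrete.natTrans fun s ↦ (K s.as).d i j
  shape i j h := by
    ext ⟨s⟩
    exact (K s).shape i j h

/-- A morphism from `familyComplex K` given by a family of morphisms. -/
@[simps]
def familyComplexDesc (K : S → CochainComplex A ℤ) {L : CochainComplex (Discrete S ⥤ A) ℤ}
    (f : ∀ s, K s ⟶ (((evaluation _ A).obj ⟨s⟩).mapHomologicalComplex (ComplexShape.up ℤ)).obj L) :
    familyComplex K ⟶ L where
  f n := Discrete.natTrans fun s ↦ (f s.as).f n
  comm' i j _ := by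
    ext ⟨s⟩
    exact (f s).comm i j

/-- A discrete index category imposes no naturality, so homotopies chosen separately assemble into
one. -/
lemma homotopic_zero_of_discrete {K L : CochainComplex (Discrete S ⥤ A) ℤ} (f : K ⟶ L)
    (h : ∀ s, Nonempty (Homotopy ((((evaluation _ A).obj s).mapHomologicalComplex
      (ComplexShape.up ℤ)).map f) 0)) : Nonempty (Homotopy f 0) := by
  replace h := fun s ↦ (h s).some
  exact ⟨
    { hom := fun i j ↦ Discrete.natTrans fun s ↦ (h s).hom i j
      zero := fun i j hij ↦ by
        ext s
        exact (h s).zero i j hij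
      comm := fun i ↦ by
        ext s
        exact (h s).comm i }⟩

variable [HasDerivedCategory.{w} A]

/-- Calculus of fractions in the homotopy category: what the localization kills is already killed by
precomposing with a quasi-isomorphism. -/
lemma exists_quasiIso_homotopy_zero {K L : CochainComplex A ℤ} (f : K ⟶ L)
    (hf : Q.map f = 0) :
    ∃ (K' : CochainComplex A ℤ) (s : K' ⟶ K), QuasiIso s ∧ Nonempty (Homotopy (s ≫ f) 0) := by
  have hf' : Qh.map ((HomotopyCategory.quotient _ _).map f) = Qh.map 0 := by
    rw [← cancel_mono ((quotientCompQhIso A).hom.app L), quotientCompQhIso_hom_naturality, hf]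
    simp
  obtain ⟨K', s, hs, h⟩ := (MorphismProperty.map_eq_iff_precomp Qh
    (HomotopyCategory.quasiIso A (ComplexShape.up ℤ)) _ _).1 hf'
  obtain ⟨K', rfl⟩ := HomotopyCategory.quotient_obj_surjective K'
  obtain ⟨s, rfl⟩ := (HomotopyCategory.quotient _ _).map_surjective s
  refine ⟨K', s, (HomotopyCategory.quotient_map_mem_quasiIso_iff s).1 hs,
    ⟨HomotopyCategory.homotopyOfEq _ _ ?_⟩⟩
  rw [Functor.map_comp, h, comp_zero, Functor.map_zero]

variable [HasDerivedCategory.{w'} (Discrete S ⥤ A)]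

/-- Each component is a right fraction. The chosen denominators form one morphism of complexes of
functors, which is a quasi-isomorphism because this is tested pointwise. -/
lemma exists_complexToFunctor_lift {K L : CochainComplex (Discrete S ⥤ A) ℤ}
    (ψ : (complexToFunctor _ A).obj K ⟶ (complexToFunctor _ A).obj L) :
    ∃ f : Q.obj K ⟶ Q.obj L, (toFunctorFactors _ A).inv.app K ≫ (toFunctor _ A).map f ≫
      (toFunctorFactors _ A).hom.app L = ψ := by
  choose K' σ hσ g hg using fun s ↦ right_fac (ψ.app ⟨s⟩)
  let σ' : familyComplex K' ⟶ K := familyComplexDesc K' σ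
  let g' : familyComplex K' ⟶ L := familyComplexDesc K' g
  have h₁ : IsIso ((complexToFunctor _ A).map σ') := by
    rw [NatTrans.isIso_iff_isIso_app]
    exact fun s ↦ hσ s.as
  have h₂ : IsIso (Q.map σ') := by
    rw [isIso_Q_map_iff_quasiIso, HomologicalComplex.quasiIso_iff_evaluation]
    exact fun s ↦ (isIso_Q_map_iff_quasiIso _ _).1 (hσ s.as)
  have h₃ : (complexToFunctor _ A).map σ' ≫ ψ = (complexToFunctor _ A).map g' := by
    ext s
    change Q.map (σ s.as) ≫ ψ.app s = Q.map (g s.as)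
    rw [show ψ.app s = _ from hg s.as]
    simp
  refine ⟨inv (Q.map σ') ≫ Q.map g', ?_⟩
  rw [← cancel_epi ((complexToFunctor _ A).map σ'), h₃]
  rw [← NatIso.naturality_1 (toFunctorFactors (Discrete S) A) σ',
    ← NatIso.naturality_1 (toFunctorFactors (Discrete S) A) g']
  simp

/-- With faithfulness and essential surjectivity, this identifies `D(A^S)` with the families of
objects of `D(A)` indexed by `S`. -/
instance : (toFunctor (Discrete S) A).Full where
  map_surjective {X Y} φ := by
    obtain ⟨K, ⟨e⟩⟩ := exists_iso_Q_obj X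
    obtain ⟨L, ⟨e'⟩⟩ := exists_iso_Q_obj Y
    obtain ⟨f, hf⟩ := exists_complexToFunctor_lift ((toFunctorFactors _ A).inv.app K ≫
      (toFunctor _ A).map e.hom ≫ φ ≫ (toFunctor _ A).map e'.inv ≫
        (toFunctorFactors _ A).hom.app L)
    refine ⟨e.inv ≫ f ≫ e'.hom, ?_⟩
    rw [cancel_epi, ← Category.assoc, ← Category.assoc, cancel_mono] at hf
    rw [Functor.map_comp, Functor.map_comp, hf]
    simp [← Functor.map_comp, ← Functor.map_comp_assoc]

instance : (toFunctor (Discrete S) A).Faithful where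
  map_injective {X Y} f g hfg := by
    suffices ∀ {X Y} (f : X ⟶ Y) (_ : (toFunctor (Discrete S) A).map f = 0), f = 0 by
      rw [← sub_eq_zero]
      exact this _ (by rw [Functor.map_sub, hfg, sub_self])
    clear f g hfg
    intro X Y f hf
    obtain ⟨K, ⟨e⟩⟩ := exists_iso_Q_obj X
    obtain ⟨L, ⟨e'⟩⟩ := exists_iso_Q_obj Y
    obtain ⟨K', s, hs, g, hg⟩ := right_fac (e.hom ≫ f ≫ e'.inv)
    have h₁ : (toFunctor (Discrete S) A).map (Q.map g) = 0 := by
      have : Q.map g = Q.map s ≫ e.hom ≫ f ≫ e'.inv := by rw [hg]; simp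
      rw [this]
      simp [hf]
    have h₂ : (complexToFunctor (Discrete S) A).map g = 0 := by
      have := (toFunctorFactors (Discrete S) A).hom.naturality g
      rw [Functor.comp_map, h₁, zero_comp] at this
      rw [← cancel_epi ((toFunctorFactors (Discrete S) A).hom.app K'), ← this, comp_zero]
    choose K'' σ hσ hh using fun s ↦ exists_quasiIso_homotopy_zero _ (NatTrans.congr_app h₂ ⟨s⟩)
    let σ' : familyComplex K'' ⟶ K' := familyComplexDesc K'' σ
    have h₃ : IsIso (Q.map σ') := by
      rw [isIso_Q_map_iff_quasiIso, HomologicalComplex.quasiIso_iff_evaluation]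
      exact fun s ↦ hσ s.as
    obtain ⟨h₄⟩ := homotopic_zero_of_discrete (σ' ≫ g) fun s ↦ hh s.as
    have h₅ : Q.map g = 0 := by
      rw [← cancel_epi (Q.map σ'), ← Functor.map_comp, Q_map_eq_of_homotopy _ h₄, Functor.map_zero,
        comp_zero]
    rw [h₅, comp_zero] at hg
    rw [← cancel_epi e.hom, ← cancel_mono e'.inv, Category.assoc, hg]
    simp

instance : (toFunctor (Discrete S) A).EssSurj where
  mem_essImage M := by
    choose K e using fun s ↦ exists_iso_Q_obj (M.obj s)
    replace e := fun s ↦ (e s).some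
    exact ⟨Q.obj (familyComplex fun s ↦ K ⟨s⟩),
      ⟨(toFunctorFactors _ A).app _ ≪≫ Discrete.natIso fun s ↦ e s⟩⟩

end DerivedCategory

end

/-! ### Torsion pairs in functor categories -/

section

universe w' v' u'

namespace CategoryTheory.ShortComplex

lemma exact_of_evaluation {I : Type u'} [Category.{v'} I] {A : Type u} [Category.{v} A] [Abelian A]
    (S : ShortComplex (I ⥤ A)) (h : ∀ i, (S.map ((evaluation I A).obj i)).Exact) : S.Exact := by
  rw [exact_iff_isZero_homology, Functor.isZero_iff]
  intro i
  exact ((exact_iff_isZero_homology _).1 (h i)).of_iso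
    (S.mapHomologyIso ((evaluation I A).obj i)).symm

lemma shortExact_of_evaluation {I : Type u'} [Category.{v'} I] {A : Type u} [Category.{v} A]
    [Abelian A] (S : ShortComplex (I ⥤ A))
    (h : ∀ i, (S.map ((evaluation I A).obj i)).ShortExact) : S.ShortExact where
  exact := exact_of_evaluation S fun i ↦ (h i).exact
  mono_f := by
    have (i : I) : Mono (S.f.app i) := (h i).mono_f
    exact NatTrans.mono_of_mono_app _
  epi_g := by
    have (i : I) : Epi (S.g.app i) := (h i).epi_g
    exact NatTrans.epi_of_epi_app _

end CategoryTheory.ShortComplex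

namespace TorsionPair

variable {A : Type u} [Category.{v} A] [Abelian A] (t : TorsionPair A)

/-! #### Closure properties -/

/-- Each class is the orthogonal of the other; all closure properties of the two classes come from
this. -/
lemma torsion_iff (X : A) :
    t.torsion X ↔ ∀ ⦃Y : A⦄ (f : X ⟶ Y), t.torsionFree Y → f = 0 := by
  refine ⟨fun hX Y f hY ↦ t.hom_eq_zero f hX hY, fun h ↦ ?_⟩
  obtain ⟨T, F, i, p, w, hT, hF, hS⟩ := t.exists_shortExact X
  have := hS.mono_f
  have : Epi i := hS.exact.epi_f (h p hF)
  have := isIso_of_mono_of_epi i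
  exact t.torsion.prop_of_iso (asIso i) hT

lemma torsionFree_iff (Y : A) :
    t.torsionFree Y ↔ ∀ ⦃X : A⦄ (f : X ⟶ Y), t.torsion X → f = 0 := by
  refine ⟨fun hY X f hX ↦ t.hom_eq_zero f hX hY, fun h ↦ ?_⟩
  obtain ⟨T, F, i, p, w, hT, hF, hS⟩ := t.exists_shortExact Y
  have := hS.epi_g
  have : Mono p := hS.exact.mono_g (h i hT)
  have := isIso_of_mono_of_epi p
  exact t.torsionFree.prop_of_iso (asIso p).symm hF

lemma torsion_of_epi {X Y : A} (f : X ⟶ Y) [Epi f] (hX : t.torsion X) : t.torsion Y := by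
  rw [torsion_iff]
  intro Z g hZ
  rw [← cancel_epi f, t.hom_eq_zero (f ≫ g) hX hZ, comp_zero]

lemma torsionFree_of_mono {X Y : A} (f : X ⟶ Y) [Mono f] (hY : t.torsionFree Y) :
    t.torsionFree X := by
  rw [torsionFree_iff]
  intro Z g hZ
  rw [← cancel_mono f, t.hom_eq_zero (g ≫ f) hZ hY, zero_comp]

instance (J : Type u') [Category.{v'} J] : t.torsion.IsClosedUnderColimitsOfShape J where
  colimitsOfShape_le X := by
    rintro ⟨h⟩
    rw [torsion_iff]
    intro Z g hZ
    exact h.isColimit.hom_ext fun j ↦ by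
      rw [comp_zero]
      exact t.hom_eq_zero _ (h.prop_diag_obj j) hZ

instance (J : Type u') [Category.{v'} J] : t.torsionFree.IsClosedUnderLimitsOfShape J where
  limitsOfShape_le X := by
    rintro ⟨h⟩
    rw [torsionFree_iff]
    intro Z g hZ
    exact h.isLimit.hom_ext fun j ↦ by
      rw [zero_comp]
      exact t.hom_eq_zero _ hZ (h.prop_diag_obj j)

/-! #### The torsion radical -/

/-- The torsion part of an object. -/
noncomputable def torsionPart (X : A) : A := (t.exists_shortExact X).choose

/-- The torsion-free part of an object. -/
noncomputable def freePart (X : A) : A := (t.exists_shortExact X).choose_spec.choose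

/-- The inclusion of the torsion part of an object. -/
noncomputable def torsionPartι (X : A) : t.torsionPart X ⟶ X :=
  (t.exists_shortExact X).choose_spec.choose_spec.choose

/-- The projection to the torsion-free part of an object. -/
noncomputable def freePartπ (X : A) : X ⟶ t.freePart X :=
  (t.exists_shortExact X).choose_spec.choose_spec.choose_spec.choose

lemma torsionPartι_freePartπ (X : A) : t.torsionPartι X ≫ t.freePartπ X = 0 :=
  (t.exists_shortExact X).choose_spec.choose_spec.choose_spec.choose_spec.choose

lemma torsion_torsionPart (X : A) : t.torsion (t.torsionPart X) :=
  (t.exists_shortExact X).choose_spec.choose_spec.choose_spec.choose_spec.choose_spec.1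

lemma torsionFree_freePart (X : A) : t.torsionFree (t.freePart X) :=
  (t.exists_shortExact X).choose_spec.choose_spec.choose_spec.choose_spec.choose_spec.2.1

lemma shortExact_torsionPart (X : A) :
    (ShortComplex.mk _ _ (t.torsionPartι_freePartπ X)).ShortExact :=
  (t.exists_shortExact X).choose_spec.choose_spec.choose_spec.choose_spec.choose_spec.2.2

instance (X : A) : Mono (t.torsionPartι X) := (t.shortExact_torsionPart X).mono_f

instance (X : A) : Epi (t.freePartπ X) := (t.shortExact_torsionPart X).epi_g

lemma exists_torsionPart_map {X Y : A} (f : X ⟶ Y) :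
    ∃ g : t.torsionPart X ⟶ t.torsionPart Y, g ≫ t.torsionPartι Y = t.torsionPartι X ≫ f := by
  have : Mono (ShortComplex.mk _ _ (t.torsionPartι_freePartπ Y)).f :=
    inferInstanceAs (Mono (t.torsionPartι Y))
  exact ⟨(t.shortExact_torsionPart Y).exact.lift (t.torsionPartι X ≫ f)
    (t.hom_eq_zero _ (t.torsion_torsionPart X) (t.torsionFree_freePart Y)),
    (t.shortExact_torsionPart Y).exact.lift_f _ _⟩

lemma exists_freePart_map {X Y : A} (f : X ⟶ Y) :
    ∃ g : t.freePart X ⟶ t.freePart Y, t.freePartπ X ≫ g = f ≫ t.freePartπ Y := by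
  have : Epi (ShortComplex.mk _ _ (t.torsionPartι_freePartπ X)).g :=
    inferInstanceAs (Epi (t.freePartπ X))
  exact ⟨(t.shortExact_torsionPart X).exact.desc (f ≫ t.freePartπ Y)
    (t.hom_eq_zero _ (t.torsion_torsionPart X) (t.torsionFree_freePart Y)),
    (t.shortExact_torsionPart X).exact.g_desc _ _⟩

/-- The torsion radical as a functor. -/
@[simps obj]
noncomputable def torsionFunctor : A ⥤ A where
  obj := t.torsionPart
  map f := (t.exists_torsionPart_map f).choose
  map_id X := by
    rw [← cancel_mono (t.torsionPartι X), (t.exists_torsionPart_map _).choose_spec]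
    simp
  map_comp {X Y Z} f g := by
    rw [← cancel_mono (t.torsionPartι Z), (t.exists_torsionPart_map _).choose_spec, Category.assoc,
      (t.exists_torsionPart_map g).choose_spec, ← Category.assoc, ← Category.assoc,
      (t.exists_torsionPart_map f).choose_spec]

/-- The torsion-free quotient as a functor. -/
@[simps obj]
noncomputable def freeFunctor : A ⥤ A where
  obj := t.freePart
  map f := (t.exists_freePart_map f).choose
  map_id X := by
    rw [← cancel_epi (t.freePartπ X), (t.exists_freePart_map _).choose_spec]
    simp
  map_comp {X Y Z} f g := by
    rw [← cancel_epi (t.freePartπ X), (t.exists_freePart_map _).choose_spec, ← Category.assoc,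
      (t.exists_freePart_map f).choose_spec, Category.assoc, Category.assoc,
      (t.exists_freePart_map g).choose_spec]

/-- The inclusion of the torsion radical. -/
@[simps]
noncomputable def torsionFunctorι : t.torsionFunctor ⟶ 𝟭 A where
  app := t.torsionPartι
  naturality _ _ f := (t.exists_torsionPart_map f).choose_spec

/-- The projection to the torsion-free quotient. -/
@[simps]
noncomputable def freeFunctorπ : 𝟭 A ⟶ t.freeFunctor where
  app := t.freePartπ
  naturality _ _ f := (t.exists_freePart_map f).choose_spec.symm

/-- The short complex formed by the torsion part and the torsion-free part of a functor. -/
@[simps]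
noncomputable def functorShortComplex {I : Type u'} [Category.{v'} I] (X : I ⥤ A) :
    ShortComplex (I ⥤ A) where
  X₁ := X ⋙ t.torsionFunctor
  X₂ := X
  X₃ := X ⋙ t.freeFunctor
  f := Functor.whiskerLeft X t.torsionFunctorι
  g := Functor.whiskerLeft X t.freeFunctorπ
  zero := by
    ext i
    exact t.torsionPartι_freePartπ (X.obj i)

lemma functorShortComplex_shortExact {I : Type u'} [Category.{v'} I] (X : I ⥤ A) :
    (t.functorShortComplex X).ShortExact :=
  ShortComplex.shortExact_of_evaluation _ fun i ↦ t.shortExact_torsionPart (X.obj i)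

/-- The torsion pair in a functor category whose classes are defined pointwise. -/
def functorCategory (I : Type u') [Category.{v'} I] : TorsionPair (I ⥤ A) where
  torsion X := ∀ i, t.torsion (X.obj i)
  torsionFree X := ∀ i, t.torsionFree (X.obj i)
  torsion_iso := ⟨fun e h i ↦ t.torsion.prop_of_iso (e.app i) (h i)⟩
  torsionFree_iso := ⟨fun e h i ↦ t.torsionFree.prop_of_iso (e.app i) (h i)⟩
  hom_eq_zero X Y f hX hY := by
    ext i
    exact t.hom_eq_zero _ (hX i) (hY i)
  exists_shortExact X := ⟨_, _, _, _, _, fun i ↦ t.torsion_torsionPart (X.obj i),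
    fun i ↦ t.torsionFree_freePart (X.obj i), t.functorShortComplex_shortExact X⟩

open DerivedCategory

variable [HasDerivedCategory.{w} A] {I : Type u'} [Category.{v'} I]
  [HasDerivedCategory.{w'} (I ⥤ A)]

/-- An object of the derived category of a functor category is in the heart of the pointwise torsion
pair if and only if its evaluations are in the heart. -/
lemma functorCategory_heart_iff (X : DerivedCategory (I ⥤ A)) :
    (t.functorCategory I).tStructure.heart X ↔
      ∀ i, t.tStructure.heart ((eval I A i).obj X) := by
  refine ⟨fun hX i ↦ heart_of_exact (t.functorCategory I) t ((evaluation I A).obj i) (eval I A i)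
    (fun _ h ↦ h i) (fun _ h ↦ h i) X hX, fun h ↦ ?_⟩
  have e (i : I) (n : ℤ) :=
    (nonempty_homologyFunctor_obj_iso ((evaluation I A).obj i) (eval I A i) X n).some
  rw [mem_heart_iff]
  simp only [mem_heart_iff] at h
  refine ⟨⟨?_, fun i ↦ t.torsion.prop_of_iso (e i 0) (h i).1.2⟩,
    ⟨?_, fun i ↦ t.torsionFree.prop_of_iso (e i (-1)) (h i).2.2⟩⟩
  · rw [isLE_iff]
    intro n hn
    rw [Functor.isZero_iff]
    intro i
    exact ((isLE_iff _ _).1 (h i).1.1 n hn).of_iso (e i n).symm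
  · rw [isGE_iff]
    intro n hn
    rw [Functor.isZero_iff]
    intro i
    exact ((isGE_iff _ _).1 (h i).2.1 n hn).of_iso (e i n).symm

variable (I)

/-- The functor from the heart of a pointwise torsion pair to diagrams in the heart. -/
@[simps]
noncomputable def toHeartFunctor : (t.functorCategory I).Heart ⥤ I ⥤ t.Heart where
  obj X := t.tStructure.heart.lift ((toFunctor I A).obj X.obj)
    ((t.functorCategory_heart_iff X.obj).1 X.property)
  map f :=
    { app i := ObjectProperty.homMk (((toFunctor I A).map f.hom).app i)
      naturality i j g := by
        ext
        exact ((toFunctor I A).map f.hom).naturality g }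

instance : (t.toHeartFunctor I).Additive where
  map_add {X Y f g} := by
    ext i
    exact (eval I A i).map_add

lemma isZero_of_isZero_toHeartFunctor (X : (t.functorCategory I).Heart)
    (h : ∀ i, IsZero (((t.toHeartFunctor I).obj X).obj i)) : IsZero X := by
  have : IsZero X.obj := isZero_of_isZero_eval _ fun i ↦ t.tStructure.heart.ι.map_isZero (h i)
  rw [IsZero.iff_id_eq_zero]
  ext
  exact this.eq_of_src _ _

section

variable [(toFunctor I A).Full]

instance : (t.toHeartFunctor I).Full where
  map_surjective {X Y} φ := by
    obtain ⟨f, hf⟩ := (toFunctor I A).map_surjective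
      (X := X.obj) (Y := Y.obj) (Functor.whiskerRight φ t.tStructure.heart.ι)
    refine ⟨ObjectProperty.homMk f, ?_⟩
    ext i
    exact NatTrans.congr_app hf i

end

instance [(toFunctor I A).Faithful] : (t.toHeartFunctor I).Faithful where
  map_injective {X Y} f g h := by
    ext
    apply (toFunctor I A).map_injective
    ext i
    exact congr_arg (fun φ ↦ (φ.app i).hom) h

instance [(toFunctor I A).EssSurj] [(toFunctor I A).Full] [(toFunctor I A).Faithful] :
    (t.toHeartFunctor I).EssSurj where
  mem_essImage M := by
    let e := (toFunctor I A).objObjPreimageIso (M ⋙ t.tStructure.heart.ι)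
    refine ⟨⟨(toFunctor I A).objPreimage (M ⋙ t.tStructure.heart.ι),
      (t.functorCategory_heart_iff _).2 fun i ↦
        t.tStructure.heart.prop_of_iso (e.app i).symm (M.obj i).property⟩,
      ⟨NatIso.ofComponents (fun i ↦ t.tStructure.heart.isoMk (e.app i)) fun f ↦ ?_⟩⟩
    ext
    exact e.hom.naturality f

end TorsionPair

end

/-! ### Short exact sequences in the heart of a t-structure -/

namespace CategoryTheory.Triangulated.TStructure

section

variable {C : Type u} [Category.{v} C] [Preadditive C] [HasZeroObject C] [HasShift C ℤ]
  [∀ (n : ℤ), (shiftFunctor C n).Additive] [Pretriangulated C] [IsTriangulated C]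

/-- Negative Homs between objects of the heart vanish, so the long exact Hom sequences make the
first map a kernel and the second a cokernel. -/
lemma heart_shortExact_of_distTriang (t : TStructure C) (S : ShortComplex t.heart.FullSubcategory)
    (h : S.X₃.obj ⟶ S.X₁.obj⟦(1 : ℤ)⟧) (hT : Triangle.mk S.f.hom S.g.hom h ∈ distTriang C) :
    S.ShortExact := by
  have h₁ := AbelianSubcategory.isLimitKernelForkOfDistTriang (ι := t.heart.ι)
    t.heart_hom_shift_eq_zero S.f S.g h hT
  have h₂ := AbelianSubcategory.isColimitCokernelCoforkOfDistTriang (ι := t.heart.ι)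
    t.heart_hom_shift_eq_zero S.f S.g h hT
  exact
    { exact := S.exact_of_f_is_kernel h₁
      mono_f := mono_of_isLimit_fork h₁
      epi_g := epi_of_isColimit_cofork h₂ }

/-- The cone of `S.f` sits in a triangle between `K[1]` and `Q`, where `K` and `Q` are the kernel
and cokernel of `S.f` in the heart. Here `K` is zero, so the cone is `Q`, that is `S.X₃`. -/
lemma heart_exists_distTriang_of_shortExact (t : TStructure C)
    (S : ShortComplex t.heart.FullSubcategory) (hS : S.ShortExact) :
    ∃ h : S.X₃.obj ⟶ S.X₁.obj⟦(1 : ℤ)⟧, Triangle.mk S.f.hom S.g.hom h ∈ distTriang C := by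
  obtain ⟨X₃, f₂, f₃, hT⟩ := distinguished_cocone_triangle S.f.hom
  obtain ⟨K, Q, α, β, γ, hT'⟩ := (show AbelianSubcategory.admissibleMorphism t.heart.ι S.f by
    rw [heart_admissibleMorphism]; trivial) f₂ f₃ hT
  have := hS.mono_f
  have hK : IsZero K := by
    have := AbelianSubcategory.mono_ιK (ι := t.heart.ι) t.heart_hom_shift_eq_zero hT hT'
    have h0 := AbelianSubcategory.ιK_mor₁ (ι := t.heart.ι) hT α
    rw [← zero_comp (f := S.f), cancel_mono] at h0
    exact IsZero.of_mono_eq_zero _ h0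
  have hβ : IsIso β := (Triangle.isZero₁_iff_isIso₂ _ hT').1
    (Functor.map_isZero (shiftFunctor C (1 : ℤ)) (t.heart.ι.map_isZero hK))
  have hc := AbelianSubcategory.isColimitCokernelCofork (ι := t.heart.ι)
    t.heart_hom_shift_eq_zero hT hT'
  have := hS.epi_g
  let e : Q ≅ S.X₃ := hc.coconePointUniqueUpToIso hS.exact.gIsCokernel
  have he : f₂ ≫ β ≫ e.hom.hom = S.g.hom := by
    have := hc.comp_coconePointUniqueUpToIso_hom hS.exact.gIsCokernel WalkingParallelPair.one
    rw [← Category.assoc, ← AbelianSubcategory.ι_map_πQ (ι := t.heart.ι) f₂ β]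
    exact congr_arg t.heart.ι.map this
  let e' : X₃ ≅ S.X₃.obj := asIso β ≪≫ t.heart.ι.mapIso e
  refine ⟨e'.inv ≫ f₃, isomorphic_distinguished _ hT _
    (Triangle.isoMk _ _ (Iso.refl _) (Iso.refl _) e'.symm ?_ ?_ ?_)⟩
  · exact (Category.comp_id _).trans (Category.id_comp _).symm
  · change S.g.hom ≫ e'.inv = 𝟙 _ ≫ f₂
    rw [Category.id_comp, Iso.comp_inv_eq]
    exact he.symm
  · change (e'.inv ≫ f₃) ≫ (𝟙 _)⟦(1 : ℤ)⟧' = e'.inv ≫ f₃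
    rw [Functor.map_id, Category.comp_id]

end

end CategoryTheory.Triangulated.TStructure

/-! ### Exactness of induced functors on hearts -/

section

universe w' v' u'

namespace TorsionPair

open DerivedCategory

variable {A : Type u} [Category.{v} A] [Abelian A] {B : Type u'} [Category.{v'} B] [Abelian B]
  [HasDerivedCategory.{w} A] [HasDerivedCategory.{w'} B] {t : TorsionPair A} {s : TorsionPair B}

section

variable (Φ' : DerivedCategory A ⥤ DerivedCategory B) [Φ'.CommShift ℤ] [Φ'.IsTriangulated]
  (hΦ : ∀ X, t.tStructure.heart X → s.tStructure.heart (Φ'.obj X))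

instance : (heartFunctor Φ' hΦ).Additive where
  map_add {X Y f g} := by
    ext
    exact Φ'.map_add

/-- Short exact sequences of hearts are triangles, and `Φ'` preserves triangles. -/
lemma shortExact_map_heartFunctor (S : ShortComplex t.Heart) (hS : S.ShortExact) :
    (S.map (heartFunctor Φ' hΦ)).ShortExact := by
  obtain ⟨h, hT⟩ := t.tStructure.heart_exists_distTriang_of_shortExact S hS
  exact s.tStructure.heart_shortExact_of_distTriang _ _ (Φ'.map_distinguished _ hT)

lemma preservesFiniteLimits_heartFunctor : PreservesFiniteLimits (heartFunctor Φ' hΦ) :=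
  ((heartFunctor Φ' hΦ).exact_tfae.out 0 3 :).1 (shortExact_map_heartFunctor Φ' hΦ) |>.1

end

end TorsionPair

/-! ### Colimits in the heart -/

namespace TorsionPair

open DerivedCategory

variable {A : Type u} [Category.{v} A] [Abelian A] (t : TorsionPair A)
  (I : Type u') [Category.{v'} I]

instance : (Functor.const I : A ⥤ I ⥤ A).Additive where

variable [HasDerivedCategory.{w} A] [HasDerivedCategory.{w'} (I ⥤ A)]

/-- The evaluations of a constant diagram in the derived category. -/
noncomputable def constToFunctorIso :
    (Functor.const I : A ⥤ I ⥤ A).mapDerivedCategory ⋙ toFunctor I A ≅ Functor.const I :=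
  letI : Localization.Lifting Q (HomologicalComplex.quasiIso A (ComplexShape.up ℤ))
      ((Functor.const I : A ⥤ I ⥤ A).mapHomologicalComplex (ComplexShape.up ℤ) ⋙
        complexToFunctor I A)
      ((Functor.const I : A ⥤ I ⥤ A).mapDerivedCategory ⋙ toFunctor I A) :=
    ⟨(Functor.associator _ _ _).symm ≪≫
      Functor.isoWhiskerRight (Functor.const I).mapDerivedCategoryFactors _ ≪≫
      Functor.associator _ _ _ ≪≫ Functor.isoWhiskerLeft _ (toFunctorFactors I A)⟩
  letI : Localization.Lifting Q (HomologicalComplex.quasiIso A (ComplexShape.up ℤ))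
      (Q ⋙ Functor.const I : CochainComplex A ℤ ⥤ I ⥤ DerivedCategory A) (Functor.const I) :=
    ⟨Iso.refl _⟩
  Localization.liftNatIso Q (HomologicalComplex.quasiIso A (ComplexShape.up ℤ))
    ((Functor.const I : A ⥤ I ⥤ A).mapHomologicalComplex (ComplexShape.up ℤ) ⋙
        complexToFunctor I A)
    (Q ⋙ Functor.const I : CochainComplex A ℤ ⥤ I ⥤ DerivedCategory A) _ _
    (NatIso.ofComponents (fun K ↦ NatIso.ofComponents (fun i ↦ Iso.refl _)
      (fun f ↦ by
        refine (Category.comp_id _).trans ((Q.map_id _).trans (Category.id_comp _).symm)))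
      (fun f ↦ by
        ext i
        exact (Category.comp_id _).trans (Category.id_comp _).symm))

lemma heart_const (X : DerivedCategory A) (hX : t.tStructure.heart X) :
    (t.functorCategory I).tStructure.heart ((Functor.const I).mapDerivedCategory.obj X) :=
  heart_of_exact t (t.functorCategory I) (Functor.const I) _ (fun _ h _ ↦ h) (fun _ h _ ↦ h) X hX

/-- The constant diagram functor for the hearts. -/
noncomputable abbrev heartConst : t.Heart ⥤ (t.functorCategory I).Heart :=
  heartFunctor (Functor.const I).mapDerivedCategory (t.heart_const I)

/-- The evaluations of a constant diagram in the heart. -/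
noncomputable def heartConstToHeartFunctorIso :
    t.heartConst I ⋙ t.toHeartFunctor I ≅ Functor.const I :=
  NatIso.ofComponents (fun X ↦ NatIso.ofComponents
    (fun i ↦ t.tStructure.heart.isoMk (((constToFunctorIso I).app X.obj).app i))
    (fun f ↦ by
      ext
      exact ((constToFunctorIso I).hom.app X.obj).naturality f))
    (fun f ↦ by
      ext i
      exact NatTrans.congr_app ((constToFunctorIso I).hom.naturality f.hom) i)

section

variable [HasColimitsOfShape I A] [HasExactColimitsOfShape I A]

instance : (colim : (I ⥤ A) ⥤ A).Additive :=
  Functor.additive_of_preserves_binary_products _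

variable [t.torsionFree.IsClosedUnderColimitsOfShape I]

/-- Torsion objects are stable under all colimits; for torsion-free objects this is where closure
under colimits of shape `I` enters. -/
lemma heart_colim (X : DerivedCategory (I ⥤ A)) (hX : (t.functorCategory I).tStructure.heart X) :
    t.tStructure.heart ((colim : (I ⥤ A) ⥤ A).mapDerivedCategory.obj X) :=
  heart_of_exact (t.functorCategory I) t colim _ (fun _ h ↦ t.torsion.prop_colimit _ h)
    (fun _ h ↦ t.torsionFree.prop_colimit _ h) X hX

/-- The colimit functor from the heart of the pointwise torsion pair. -/
noncomputable abbrev heartColim : (t.functorCategory I).Heart ⥤ t.Heart :=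
  heartFunctor (colim : (I ⥤ A) ⥤ A).mapDerivedCategory (t.heart_colim I)

/-- The functor `heartColim` is left adjoint to the constant diagram functor. -/
noncomputable def heartColimAdj : t.heartColim I ⊣ t.heartConst I :=
  heartAdjunction (adjunctionOfExact colimConstAdj _ _) _ _

variable [(t.toHeartFunctor I).IsEquivalence]

/-- The left adjoint of the functor `Functor.const I` for the heart. -/
noncomputable def heartDiagramColimAdj :
    (t.toHeartFunctor I).inv ⋙ t.heartColim I ⊣ Functor.const I :=
  ((t.toHeartFunctor I).asEquivalence.symm.toAdjunction.comp (t.heartColimAdj I)).ofNatIsoRight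
    (t.heartConstToHeartFunctorIso I)

lemma hasColimitsOfShape_heart : HasColimitsOfShape I t.Heart :=
  hasColimitsOfShape_iff_isRightAdjoint_const.2 ⟨_, ⟨t.heartDiagramColimAdj I⟩⟩

/-- By uniqueness of adjoints, the colimit functor is the inverse equivalence followed by
`heartColim`, which is exact as the restriction of a triangulated functor. -/
lemma hasExactColimitsOfShape_heart [HasColimitsOfShape I t.Heart] :
    HasExactColimitsOfShape I t.Heart := by
  have := preservesFiniteLimits_heartFunctor (colim : (I ⥤ A) ⥤ A).mapDerivedCategory
    (t.heart_colim I)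
  have : PreservesFiniteLimits ((t.toHeartFunctor I).inv ⋙ t.heartColim I) :=
    comp_preservesFiniteLimits _ _
  exact ⟨preservesFiniteLimits_of_natIso
    ((t.heartDiagramColimAdj I).leftAdjointUniq colimConstAdj)⟩

end

end TorsionPair

end

/-! ### A criterion for a functor to a category of diagrams to be an equivalence -/

section

namespace CategoryTheory.Functor

/-- The data of left and right adjoints of the evaluations of a functor `E : K ⥤ I ⥤ H`,
such that the right adjoints look like the right adjoints of the evaluation functors on
`I ⥤ H` when there is at most one morphism between two objects of `I`. -/
structure EvaluationAdjunctions {I K H : Type*} [Category* I] [Category* K] [Category* H]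
    [HasZeroMorphisms H] (E : K ⥤ I ⥤ H) where
  /-- the left adjoints of the evaluations -/
  left (i : I) : H ⥤ K
  /-- the right adjoints of the evaluations -/
  right (i : I) : H ⥤ K
  /-- the adjunctions for the left adjoints -/
  adjLeft (i : I) : left i ⊣ E ⋙ (evaluation I H).obj i
  /-- the adjunctions for the right adjoints -/
  adjRight (i : I) : E ⋙ (evaluation I H).obj i ⊣ right i
  isIso {i j : I} (f : i ⟶ j) (Z : H) :
    IsIso ((E.obj ((right j).obj Z)).map f ≫ (adjRight j).counit.app Z)
  isZero {i j : I} (hij : IsEmpty (i ⟶ j)) (Z : H) : IsZero ((E.obj ((right j).obj Z)).obj i)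

namespace EvaluationAdjunctions

variable {I K H : Type*} [Category* I] [Category* K] [Category* H] [Abelian H] {E : K ⥤ I ⥤ H}
  (h : E.EvaluationAdjunctions)

lemma preservesFiniteColimits (h : E.EvaluationAdjunctions) : PreservesFiniteColimits E :=
  preservesFiniteColimits_of_evaluation E fun i ↦
    have := (h.adjRight i).leftAdjoint_preservesColimits
    ⟨fun _ ↦ inferInstance⟩

variable [∀ (X : I → K), HasCoproduct X]

/-- The object of `K` which is freely generated by a family of objects. -/
noncomputable def free (X : I → H) : K := ∐ fun i ↦ (h.left i).obj (X i)

/-- The generators of a free object. -/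
noncomputable def gen (X : I → H) (i : I) : X i ⟶ (E.obj (h.free X)).obj i :=
  (h.adjLeft i).homEquiv _ _ (Sigma.ι (fun i ↦ (h.left i).obj (X i)) i)

variable {h} in
lemma gen_map {X : I → H} {Y : K} (p : h.free X ⟶ Y) (i : I) :
    h.gen X i ≫ (E.map p).app i =
      (h.adjLeft i).homEquiv _ _ (Sigma.ι (fun i ↦ (h.left i).obj (X i)) i ≫ p) :=
  ((h.adjLeft i).homEquiv_naturality_right _ _).symm

variable {h} in
lemma free_hom_ext {X : I → H} {Y : K} {p q : h.free X ⟶ Y}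
    (hpq : ∀ i, h.gen X i ≫ (E.map p).app i = h.gen X i ≫ (E.map q).app i) : p = q := by
  refine Sigma.hom_ext _ _ fun i ↦ ((h.adjLeft i).homEquiv _ _).injective ?_
  rw [← gen_map, ← gen_map, hpq]

lemma exists_free_desc {X : I → H} {Y : K} (y : ∀ i, X i ⟶ (E.obj Y).obj i) :
    ∃ p : h.free X ⟶ Y, ∀ i, h.gen X i ≫ (E.map p).app i = y i :=
  ⟨Limits.Sigma.desc fun i ↦ ((h.adjLeft i).homEquiv _ _).symm (y i), fun i ↦
    (gen_map _ i).trans (by simp)⟩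

variable {h} in
-- Passing to the adjoint morphism into `right j` does not change the values on the generators, once
-- `(right j Z)_i` is compared with `Z` along `f`.
lemma gen_right {X : I → H} {j : I} {Z : H} (g : (E.obj (h.free X)).obj j ⟶ Z) {i : I} (f : i ⟶ j) :
    (h.gen X i ≫ (E.map ((h.adjRight j).homEquiv _ _ g)).app i) ≫
        (E.obj ((h.right j).obj Z)).map f ≫ (h.adjRight j).counit.app Z =
      h.gen X i ≫ (E.obj (h.free X)).map f ≫ g := by
  have h₁ := (h.adjRight j).homEquiv_counit (g := (h.adjRight j).homEquiv _ _ g)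
  rw [Equiv.symm_apply_apply] at h₁
  conv_rhs => rw [h₁]
  simp

variable {h} in
-- By adjunction, maps from `(E.obj (h.free X)).obj j` to `Z` are families `X i ⟶ (right j Z)_i`,
-- and the target is `Z` if there is an arrow `i ⟶ j` and zero otherwise. So this object behaves
-- like the coproduct of the `X i` over the `i` below `j`.
lemma free_obj_hom_ext {X : I → H} {j : I} {Z : H} {g g' : (E.obj (h.free X)).obj j ⟶ Z}
    (hg : ∀ (i : I) (f : i ⟶ j), h.gen X i ≫ (E.obj (h.free X)).map f ≫ g =
      h.gen X i ≫ (E.obj (h.free X)).map f ≫ g') : g = g' := by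
  apply ((h.adjRight j).homEquiv (h.free X) Z).injective
  refine free_hom_ext fun i ↦ ?_
  by_cases hij : IsEmpty (i ⟶ j)
  · exact (h.isZero hij Z).eq_of_tgt _ _
  · rw [not_isEmpty_iff] at hij
    obtain ⟨f⟩ := hij
    have := h.isIso f Z
    rw [← cancel_mono ((E.obj ((h.right j).obj Z)).map f ≫ (h.adjRight j).counit.app Z)]
    rw [gen_right, gen_right, hg]

lemma exists_free_obj_desc [Quiver.IsThin I] {X : I → H} {j : I} {Z : H} (y : ∀ (i : I) (_ : i ⟶ j), X i ⟶ Z) :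
    ∃ g : (E.obj (h.free X)).obj j ⟶ Z, ∀ (i : I) (f : i ⟶ j),
      h.gen X i ≫ (E.obj (h.free X)).map f ≫ g = y i f := by
  classical
  have {i : I} (f : i ⟶ j) := h.isIso f Z
  -- The value `0` is for the `i` without arrow to `j`, where the target is zero; thinness makes the
  -- chosen arrow immaterial.
  obtain ⟨p, hp⟩ := h.exists_free_desc (X := X) (Y := (h.right j).obj Z) fun i ↦
    if hij : Nonempty (i ⟶ j) then y i hij.some ≫
      CategoryTheory.inv ((E.obj ((h.right j).obj Z)).map hij.some ≫ (h.adjRight j).counit.app Z) else 0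
  refine ⟨((h.adjRight j).homEquiv _ _).symm p, fun i f ↦ ?_⟩
  have hij : Nonempty (i ⟶ j) := ⟨f⟩
  rw [← gen_right, Equiv.apply_symm_apply, hp, dif_pos hij, Subsingleton.elim hij.some f]
  simp

variable {h} in
lemma map_free_hom_ext {X : I → H} {M : I ⥤ H} {φ ψ : E.obj (h.free X) ⟶ M}
    (hφ : ∀ i, h.gen X i ≫ φ.app i = h.gen X i ≫ ψ.app i) : φ = ψ := by
  ext j
  refine free_obj_hom_ext fun i f ↦ ?_
  rw [φ.naturality, ψ.naturality, reassoc_of% hφ]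

/-- With `map_free_hom_ext`, this says that `E` sends free objects of `K` to free diagrams. -/
lemma exists_map_free_desc [Quiver.IsThin I] {X : I → H} {M : I ⥤ H} (m : ∀ i, X i ⟶ M.obj i) :
    ∃ φ : E.obj (h.free X) ⟶ M, ∀ i, h.gen X i ≫ φ.app i = m i := by
  choose φ hφ using fun j ↦ h.exists_free_obj_desc (X := X) (j := j) (Z := M.obj j)
    fun i f ↦ m i ≫ M.map f
  refine ⟨{ app := φ, naturality := fun j k a ↦ free_obj_hom_ext fun i f ↦ ?_ }, fun i ↦ ?_⟩
  · rw [reassoc_of% hφ j i f, ← M.map_comp, ← hφ k i (f ≫ a)]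
    simp
  · simpa using hφ i i (𝟙 i)

variable [Abelian K] [E.Additive]

lemma exists_epi_free (hE : ∀ Y : K, (∀ i, IsZero ((E.obj Y).obj i)) → IsZero Y) (Y : K) :
    ∃ p : h.free (E.obj Y).obj ⟶ Y,
      (∀ i, h.gen _ i ≫ (E.map p).app i = 𝟙 _) ∧ Epi p ∧ Epi (E.map p) := by
  obtain ⟨p, hp⟩ := h.exists_free_desc (X := (E.obj Y).obj) (fun i ↦ 𝟙 _)
  have := h.preservesFiniteColimits
  have h₁ : Epi (E.map p) := by
    have (i : I) : Epi ((E.map p).app i) := by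
      have : IsSplitEpi ((E.map p).app i) := ⟨⟨_, hp i⟩⟩
      infer_instance
    exact NatTrans.epi_of_epi_app _
  refine ⟨p, hp, ?_, h₁⟩
  -- `E` preserves epimorphisms, so the cokernel of `p` has zero image under `E`, and `hE` makes it
  -- zero.
  refine Abelian.epi_of_cokernel_π_eq_zero _ ((hE _ fun i ↦ ?_).eq_of_tgt _ _)
  have h₂ : E.map (cokernel.π p) = 0 := by
    rw [← cancel_epi (E.map p), ← E.map_comp, cokernel.condition, E.map_zero, comp_zero]
  have h₃ : IsZero (E.obj (cokernel p)) := IsZero.of_epi_eq_zero _ h₂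
  exact (Functor.isZero_iff _).1 h₃ i

lemma faithful (h : E.EvaluationAdjunctions)
    (hE : ∀ Y : K, (∀ i, IsZero ((E.obj Y).obj i)) → IsZero Y) : E.Faithful where
  map_injective {Y Y'} f g hfg := by
    obtain ⟨p, hp, _, _⟩ := h.exists_epi_free hE Y
    rw [← cancel_epi p]
    exact free_hom_ext fun i ↦ by rw [E.map_comp, E.map_comp, hfg]

/-- Freeness lifts the composite of `g` with a free cover `p`; by faithfulness the lift kills the
kernel of `p`, hence descends. -/
lemma full (h : E.EvaluationAdjunctions)
    (hE : ∀ Y : K, (∀ i, IsZero ((E.obj Y).obj i)) → IsZero Y) : E.Full where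
  map_surjective {Y Y'} g := by
    have := h.faithful hE
    obtain ⟨p, hp, _, _⟩ := h.exists_epi_free hE Y
    obtain ⟨p', hp'⟩ := h.exists_free_desc (fun i ↦ g.app i)
    have h₁ : E.map p' = E.map p ≫ g := map_free_hom_ext fun i ↦ by
      rw [hp', NatTrans.comp_app, reassoc_of% hp]
    have h₂ : kernel.ι p ≫ p' = 0 := E.map_injective (by
      rw [E.map_comp, h₁, ← E.map_comp_assoc, kernel.condition, E.map_zero, E.map_zero, zero_comp])
    refine ⟨Abelian.epiDesc p p' h₂, ?_⟩
    rw [← cancel_epi (E.map p), ← E.map_comp, Abelian.comp_epiDesc, h₁]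

/-- A diagram is the cokernel of a map between images of free objects. Fullness lifts this map to
`K`, and `E` preserves its cokernel. -/
lemma essSurj [Quiver.IsThin I] (h : E.EvaluationAdjunctions)
    (hE : ∀ Y : K, (∀ i, IsZero ((E.obj Y).obj i)) → IsZero Y) : E.EssSurj where
  mem_essImage M := by
    have := h.full hE
    have := h.preservesFiniteColimits
    have key (M : I ⥤ H) : ∃ (X : I → H) (φ : E.obj (h.free X) ⟶ M), Epi φ := by
      obtain ⟨φ, hφ⟩ := h.exists_map_free_desc (M := M) (fun i ↦ 𝟙 (M.obj i))
      have (i : I) : Epi (φ.app i) := by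
        have : IsSplitEpi (φ.app i) := ⟨⟨_, hφ i⟩⟩
        infer_instance
      exact ⟨_, φ, NatTrans.epi_of_epi_app _⟩
    obtain ⟨X, φ, _⟩ := key M
    obtain ⟨X', ψ, _⟩ := key (Limits.kernel φ)
    obtain ⟨θ, hθ⟩ := E.map_surjective (ψ ≫ kernel.ι φ)
    exact ⟨cokernel θ, ⟨PreservesCokernel.iso E θ ≪≫ cokernelIsoOfEq hθ ≪≫ cokernelEpiComp _ _ ≪≫
      (cokernelIsCokernel (kernel.ι φ)).coconePointUniqueUpToIso
        (Abelian.epiIsCokernelOfKernel (Fork.ofι (kernel.ι φ) _) (kernelIsKernel φ))⟩⟩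

lemma isEquivalence [Quiver.IsThin I] (h : E.EvaluationAdjunctions)
    (hE : ∀ Y : K, (∀ i, IsZero ((E.obj Y).obj i)) → IsZero Y) : E.IsEquivalence where
  faithful := h.faithful hE
  full := h.full hE
  essSurj := h.essSurj hE

end EvaluationAdjunctions

end CategoryTheory.Functor

end

/-! ### Diagrams in the heart indexed by preordered sets -/

section

universe w' v' u'

namespace CategoryTheory

variable (I : Type u') [Category.{v'} I] [Quiver.IsThin I] (A : Type u) [Category.{v} A] [Abelian A]

instance (i : I) : PreservesFiniteColimits (evaluationLeftAdjoint A i) :=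
  have := (evaluationAdjunctionRight A i).leftAdjoint_preservesColimits
  ⟨fun _ ↦ inferInstance⟩

instance (i : I) : PreservesFiniteLimits (evaluationRightAdjoint A i) :=
  have := (evaluationAdjunctionLeft A i).rightAdjoint_preservesLimits
  ⟨fun _ ↦ inferInstance⟩

instance (i : I) : (evaluationLeftAdjoint A i).Additive :=
  have := preservesBinaryBiproducts_of_preservesBinaryCoproducts (evaluationLeftAdjoint A i)
  Functor.additive_of_preservesBinaryBiproducts _

instance (i : I) : (evaluationRightAdjoint A i).Additive :=
  Functor.additive_of_preserves_binary_products _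

/-- The value at `j` is a coproduct indexed by `i ⟶ j`, which has at most one element; finite
coproducts are exact in an abelian category. The right adjoint is treated dually, with products. -/
instance (i : I) : PreservesFiniteLimits (evaluationLeftAdjoint A i) := by
  have : (evaluationLeftAdjoint A i).PreservesMonomorphisms := ⟨fun {X Y} f _ ↦ by
    have (j : I) : Mono (((evaluationLeftAdjoint A i).map f).app j) := by
      let τ := Discrete.natTrans (F := Discrete.functor fun _ : i ⟶ j ↦ X)
        (G := Discrete.functor fun _ : i ⟶ j ↦ Y) fun _ ↦ f
      have h : ((evaluationLeftAdjoint A i).map f).app j = colim.map τ :=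
        Limits.Sigma.hom_ext _ _ fun g ↦
          (colimit.ι_desc _ _).trans (ι_colimMap τ ⟨g⟩).symm
      have (k : Discrete (i ⟶ j)) : Mono (τ.app k) := inferInstanceAs (Mono f)
      have : Mono τ := NatTrans.mono_of_mono_app _
      have := HasFiniteBiproducts.of_hasFiniteProducts (C := A)
      have := HasExactColimitsOfShape.preservesFiniteLimits (J := Discrete (i ⟶ j)) (C := A)
      rw [h]
      exact colim.map_mono τ
    exact NatTrans.mono_of_mono_app _⟩
  have := Functor.preservesHomology_of_preservesMonos_and_cokernels (evaluationLeftAdjoint A i)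
  exact Functor.preservesFiniteLimits_of_preservesHomology _

instance (i : I) : PreservesFiniteColimits (evaluationRightAdjoint A i) := by
  have : (evaluationRightAdjoint A i).PreservesEpimorphisms := ⟨fun {X Y} f _ ↦ by
    have (j : I) : Epi (((evaluationRightAdjoint A i).map f).app j) := by
      let τ := Discrete.natTrans (F := Discrete.functor fun _ : j ⟶ i ↦ X)
        (G := Discrete.functor fun _ : j ⟶ i ↦ Y) fun _ ↦ f
      have h : ((evaluationRightAdjoint A i).map f).app j = lim.map τ :=
        Limits.Pi.hom_ext _ _ fun g ↦
          (limit.lift_π _ _).trans (limMap_π τ ⟨g⟩).symm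
      have (k : Discrete (j ⟶ i)) : Epi (τ.app k) := inferInstanceAs (Epi f)
      have : Epi τ := NatTrans.epi_of_epi_app _
      have := HasFiniteBiproducts.of_hasFiniteProducts (C := A)
      have := HasExactLimitsOfShape.preservesFiniteColimits (J := Discrete (j ⟶ i)) (C := A)
      rw [h]
      exact lim.map_epi τ
    exact NatTrans.epi_of_epi_app _⟩
  have := Functor.preservesHomology_of_preservesEpis_and_kernels (evaluationRightAdjoint A i)
  exact Functor.preservesFiniteColimits_of_preservesHomology _

end CategoryTheory

namespace TorsionPair

open DerivedCategory

variable {A : Type u} [Category.{v} A] [Abelian A] (t : TorsionPair A)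

lemma torsion_pi {J : Type*} [Finite J] (X : J → A) (h : ∀ j, t.torsion (X j)) :
    t.torsion (∏ᶜ X) :=
  have := HasFiniteBiproducts.of_hasFiniteProducts (C := A)
  t.torsion.prop_of_iso ((biproduct.isoCoproduct X).symm ≪≫ biproduct.isoProduct X)
    (t.torsion.prop_colimit _ fun j : Discrete J ↦ h j.as)

lemma torsionFree_sigma {J : Type*} [Finite J] (X : J → A) (h : ∀ j, t.torsionFree (X j)) :
    t.torsionFree (∐ X) :=
  have := HasFiniteBiproducts.of_hasFiniteProducts (C := A)
  t.torsionFree.prop_of_iso ((biproduct.isoProduct X).symm ≪≫ biproduct.isoCoproduct X)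
    (t.torsionFree.prop_limit _ fun j : Discrete J ↦ h j.as)

variable {I : Type u'} [Category.{v'} I] [Quiver.IsThin I]

/-- The composite is the projection from a product indexed by `i ⟶ j`, and thinness leaves the
single factor `f`. -/
lemma isIso_evaluationAdjunctionLeft_counit {i j : I} (f : i ⟶ j) (X : A) :
    IsIso (((evaluationRightAdjoint A j).obj X).map f ≫
      (evaluationAdjunctionLeft A j).counit.app X) := by
  have h : ((evaluationRightAdjoint A j).obj X).map f ≫
      (evaluationAdjunctionLeft A j).counit.app X = Pi.π (fun _ : i ⟶ j ↦ X) f := by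
    rw [evaluationAdjunctionLeft_counit_app]
    refine (limit.lift_π (F := Discrete.functor fun _ : j ⟶ j ↦ X) _ ⟨𝟙 j⟩).trans ?_
    change Pi.π (fun _ : i ⟶ j ↦ X) (f ≫ 𝟙 j) = _
    rw [Category.comp_id]
  have : IsIso (Pi.π (fun _ : i ⟶ j ↦ X) f) :=
    ⟨Pi.lift fun _ ↦ 𝟙 X, Limits.Pi.hom_ext _ _ fun g ↦ by
      rw [Subsingleton.elim g f, Category.assoc, Limits.Pi.lift_π, Category.comp_id,
        Category.id_comp], Limits.Pi.lift_π _ _⟩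
  rw [h]
  exact this

variable [HasDerivedCategory.{w} A] [HasDerivedCategory.{w'} (I ⥤ A)]

lemma heartAdjunction_counit_app {B : Type*} [Category* B] [Abelian B] {s : TorsionPair B}
    [HasDerivedCategory B] {t : TorsionPair A}
    {Φ' : DerivedCategory A ⥤ DerivedCategory B} {Ψ' : DerivedCategory B ⥤ DerivedCategory A}
    (adj : Φ' ⊣ Ψ') (hΦ : ∀ X, t.tStructure.heart X → s.tStructure.heart (Φ'.obj X))
    (hΨ : ∀ X, s.tStructure.heart X → t.tStructure.heart (Ψ'.obj X)) (Z : s.Heart) :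
    s.tStructure.heart.ι.map ((heartAdjunction adj hΦ hΨ).counit.app Z) =
      adj.counit.app Z.obj := by
  refine (Adjunction.map_restrictFullyFaithful_counit_app adj _ _ _ _ Z).trans ?_
  refine (Category.id_comp _).trans ?_
  exact (congr_arg (· ≫ adj.counit.app Z.obj) (Φ'.map_id _)).trans (Category.id_comp _)

lemma heart_evaluationLeftAdjoint (i : I) (X : DerivedCategory A) (hX : t.tStructure.heart X) :
    (t.functorCategory I).tStructure.heart ((evaluationLeftAdjoint A i).mapDerivedCategory.obj X) :=
  heart_of_exact t (t.functorCategory I) (evaluationLeftAdjoint A i) _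
    (fun _ h _ ↦ t.torsion.prop_colimit _ fun _ ↦ h) (fun _ h _ ↦ t.torsionFree_sigma _ fun _ ↦ h)
    X hX

lemma heart_evaluationRightAdjoint (i : I) (X : DerivedCategory A) (hX : t.tStructure.heart X) :
    (t.functorCategory I).tStructure.heart
      ((evaluationRightAdjoint A i).mapDerivedCategory.obj X) :=
  heart_of_exact t (t.functorCategory I) (evaluationRightAdjoint A i) _
    (fun _ h _ ↦ t.torsion_pi _ fun _ ↦ h) (fun _ h _ ↦ t.torsionFree.prop_limit _ fun _ ↦ h)
    X hX

section

variable (I A)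

/-- The left adjoint of the evaluation functor on the derived category. -/
noncomputable def evalAdjLeft (i : I) :
    (evaluationLeftAdjoint A i).mapDerivedCategory ⊣ eval I A i :=
  adjunctionOfExact (evaluationAdjunctionRight A i) _ _

/-- The right adjoint of the evaluation functor on the derived category. -/
noncomputable def evalAdjRight (i : I) :
    eval I A i ⊣ (evaluationRightAdjoint A i).mapDerivedCategory :=
  adjunctionOfExact (evaluationAdjunctionLeft A i) _ _

/-- Evaluating at `i`, then mapping to the evaluation at `j`, and then applying the counit. -/
noncomputable def evalMapCounit {i j : I} (f : i ⟶ j) :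
    (evaluationRightAdjoint A j).mapDerivedCategory ⋙ eval I A i ⟶ 𝟭 _ :=
  Functor.whiskerLeft ((evaluationRightAdjoint A j).mapDerivedCategory ⋙ toFunctor I A)
    ((evaluation I _).map f) ≫ (evalAdjRight A I j).counit

end

/-- On a complex representing `Z`, the morphism is given termwise by the isomorphism already known
in `A`. -/
lemma isIso_evalMapCounit {i j : I} (f : i ⟶ j) (Z : DerivedCategory A) :
    IsIso ((evalMapCounit A I f).app Z) := by
  obtain ⟨K, ⟨e⟩⟩ := exists_iso_Q_obj Z
  rw [← NatTrans.isIso_app_iff_of_iso _ e]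
  let r := (evaluationRightAdjoint A j).mapHomologicalComplex (ComplexShape.up ℤ)
  let g : (HomologicalComplex.complexOfFunctorsToFunctorToComplex.obj (r.obj K)).obj i ⟶ K :=
    (HomologicalComplex.complexOfFunctorsToFunctorToComplex.obj (r.obj K)).map f ≫
      ((evaluationAdjunctionLeft A j).mapHomologicalComplex _).counit.app K
  have hg : IsIso g := by
    have (n : ℤ) : IsIso (g.f n) := isIso_evaluationAdjunctionLeft_counit f (K.X n)
    exact HomologicalComplex.Hom.isIso_of_components _
  let s := (CatCommSq.iso r Q Q (evaluationRightAdjoint A j).mapDerivedCategory).symm.app K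
  have h : (evalMapCounit A I f).app (Q.obj K) =
      ((toFunctor I A).map s.hom).app i ≫ ((toFunctorFactors I A).hom.app (r.obj K)).app i ≫
        Q.map g := by
    have h₁ : (evalMapCounit A I f).app (Q.obj K) =
      ((toFunctor I A).obj ((evaluationRightAdjoint A j).mapDerivedCategory.obj (Q.obj K))).map f ≫
        ((toFunctor I A).map s.hom).app j ≫ ((toFunctorFactors I A).hom.app (r.obj K)).app j ≫
          Q.map (((evaluationAdjunctionLeft A j).mapHomologicalComplex _).counit.app K) :=
      congr_arg (_ ≫ ·) (adjunctionOfExact_counit_app _ _ _ K)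
    refine h₁.trans ((((toFunctor I A).map s.hom).naturality_assoc f _).trans
      (congr_arg (_ ≫ ·) ?_))
    refine (((toFunctorFactors I A).hom.app (r.obj K)).naturality_assoc f _).trans ?_
    exact congr_arg (_ ≫ ·) (Q.map_comp _ _).symm
  rw [h]
  infer_instance

lemma isZero_eval_evaluationRightAdjoint {i j : I} (hij : IsEmpty (i ⟶ j))
    (Z : DerivedCategory A) :
    IsZero ((eval I A i).obj ((evaluationRightAdjoint A j).mapDerivedCategory.obj Z)) := by
  obtain ⟨K, ⟨e⟩⟩ := exists_iso_Q_obj Z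
  let r := (evaluationRightAdjoint A j).mapHomologicalComplex (ComplexShape.up ℤ)
  let ev := ((evaluation I A).obj i).mapHomologicalComplex (ComplexShape.up ℤ)
  have h : IsZero (ev.obj (r.obj K)) := by
    rw [IsZero.iff_id_eq_zero]
    ext n
    exact Limits.Pi.hom_ext _ _ fun g ↦ (hij.false g).elim
  exact (Q.map_isZero h).of_iso ((eval I A i).mapIso
    ((evaluationRightAdjoint A j).mapDerivedCategory.mapIso e.symm ≪≫
      ((CatCommSq.iso r Q Q (evaluationRightAdjoint A j).mapDerivedCategory).app K).symm) ≪≫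
    ((CatCommSq.iso ev Q Q (eval I A i)).app (r.obj K)).symm)

variable (I)

/-- The adjoints of the evaluations on the heart of a pointwise torsion pair. -/
noncomputable def evaluationAdjunctions : (t.toHeartFunctor I).EvaluationAdjunctions where
  left i := heartFunctor (evaluationLeftAdjoint A i).mapDerivedCategory
    (t.heart_evaluationLeftAdjoint i)
  right i := heartFunctor (evaluationRightAdjoint A i).mapDerivedCategory
    (t.heart_evaluationRightAdjoint i)
  adjLeft i := heartAdjunction (evalAdjLeft A I i) (t.heart_evaluationLeftAdjoint i)
    (fun X hX ↦ (t.functorCategory_heart_iff X).1 hX i)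
  adjRight i := heartAdjunction (evalAdjRight A I i)
    (fun X hX ↦ (t.functorCategory_heart_iff X).1 hX i) (t.heart_evaluationRightAdjoint i)
  isIso {i j} f Z := by
    have := isIso_evalMapCounit f Z.obj
    refine (isIso_iff_of_reflects_iso _ t.tStructure.heart.ι).1 ?_
    exact (congr_arg (fun φ ↦ IsIso φ) ((t.tStructure.heart.ι.map_comp _ _).trans
      (congr_arg (_ ≫ ·) (heartAdjunction_counit_app (evalAdjRight A I j)
        (fun X hX ↦ (t.functorCategory_heart_iff X).1 hX j) (t.heart_evaluationRightAdjoint j)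
          Z)))).mpr this
  isZero {i j} hij Z := by
    have := isZero_eval_evaluationRightAdjoint hij Z.obj
    rw [IsZero.iff_id_eq_zero]
    ext
    exact this.eq_of_src _ _

end TorsionPair

end

/-! ### Closure under direct limits implies that the heart is AB5 -/

section

universe w' v' u'

/-- Every small filtered category receives a final functor from a directed poset. -/
lemma IsClosedUnderDirectLimits.of_isFiltered {C : Type u} [Category.{v} C]
    {P : ObjectProperty C} [P.IsClosedUnderIsomorphisms] (hP : IsClosedUnderDirectLimits.{w} P)
    (J : Type w) [SmallCategory J] [IsFiltered J] : P.IsClosedUnderColimitsOfShape J where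
  colimitsOfShape_le := by
    rintro X ⟨F, hF⟩
    obtain ⟨α, _, _, _, Φ, _⟩ := IsFiltered.exists_directed J
    have : IsDirectedOrder α := ‹_›
    have := hP α
    exact P.prop_of_isColimit ((Functor.Final.isColimitWhiskerEquiv Φ _).symm F.isColimit) fun j ↦ hF _

/-- A coproduct is the filtered colimit of its finite subcoproducts. -/
lemma CategoryTheory.ObjectProperty.isClosedUnderColimitsOfShape_discrete {C : Type u}
    [Category.{v} C] (P : ObjectProperty C) [P.IsClosedUnderIsomorphisms] (S : Type u')
    [HasFiniteCoproducts C] [HasColimitsOfShape (Finset (Discrete S)) C]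
    [P.IsClosedUnderColimitsOfShape (Finset (Discrete S))]
    (hP : ∀ (J : Type u') [Finite J] (X : J → C), (∀ j, P (X j)) → P (∐ X)) :
    P.IsClosedUnderColimitsOfShape (Discrete S) where
  colimitsOfShape_le := by
    rintro X ⟨F, hF⟩
    let c := CoproductsFromFiniteFiltered.liftToFinsetColimitCocone F.diag
    exact P.prop_of_iso (c.isColimit.coconePointUniqueUpToIso F.isColimit)
      (P.prop_colimit (CoproductsFromFiniteFiltered.liftToFinsetObj F.diag)
        fun s ↦ hP s (fun j ↦ F.diag.obj j.1) fun j ↦ hF j.1)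

namespace TorsionPair

open DerivedCategory

variable {A : Type u} [Category.{v} A] [Abelian A] (t : TorsionPair A)

instance (I : Type*) [Category* I] (J : Type*) [Category* J] [HasColimitsOfShape J A]
    [t.torsionFree.IsClosedUnderColimitsOfShape J] :
    (t.functorCategory I).torsionFree.IsClosedUnderColimitsOfShape J where
  colimitsOfShape_le := by
    rintro X ⟨F, hF⟩ i
    exact t.torsionFree.prop_of_isColimit (isColimitOfPreserves ((evaluation I A).obj i) F.isColimit)
      fun j ↦ hF j i

lemma torsionFree_isClosedUnderColimitsOfShape_discrete [HasFilteredColimitsOfSize.{w, w} A]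
    (ht : IsClosedUnderDirectLimits.{w} t.torsionFree) (S : Type w) :
    t.torsionFree.IsClosedUnderColimitsOfShape (Discrete S) := by
  classical
  have := ht.of_isFiltered (Finset (Discrete S))
  exact t.torsionFree.isClosedUnderColimitsOfShape_discrete S fun _ _ X hX ↦
    t.torsionFree_sigma X hX

variable [HasDerivedCategory.{w} A]

lemma hasColimitsOfShape_discrete_heart (S : Type u') [HasColimitsOfShape (Discrete S) A]
    [HasExactColimitsOfShape (Discrete S) A]
    [t.torsionFree.IsClosedUnderColimitsOfShape (Discrete S)] :
    HasColimitsOfShape (Discrete S) t.Heart := by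
  let := HasDerivedCategory.standard (Discrete S ⥤ A)
  have : (t.toHeartFunctor (Discrete S)).IsEquivalence := { }
  exact t.hasColimitsOfShape_heart (Discrete S)

lemma isEquivalence_toHeartFunctor (I : Type u') [Category.{v'} I] [Quiver.IsThin I]
    [HasDerivedCategory.{w'} (I ⥤ A)] [HasColimitsOfShape (Discrete I) A]
    [HasExactColimitsOfShape (Discrete I) A]
    [t.torsionFree.IsClosedUnderColimitsOfShape (Discrete I)] :
    (t.toHeartFunctor I).IsEquivalence := by
  -- Free objects are coproducts in the heart over `I ⥤ A`; these come from the discrete case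
  -- applied to the pointwise torsion pair.
  have := (t.functorCategory I).hasColimitsOfShape_discrete_heart I
  exact (t.evaluationAdjunctions I).isEquivalence
    (fun Y hY ↦ t.isZero_of_isZero_toHeartFunctor I Y hY)

/-- If the torsion-free class of a torsion pair in a Grothendieck category is closed under direct
limits, then the heart of the Happel-Reiten-Smalø t-structure is an AB5 category. -/
lemma isAB5_heart [IsGrothendieckAbelian.{v'} A]
    (ht : IsClosedUnderDirectLimits.{v'} t.torsionFree) : IsAB5.{v'} t.Heart := by
  have key (I : Type v') [PartialOrder I] [IsDirectedOrder I] [Nonempty I] :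
      ∃ _ : HasColimitsOfShape I t.Heart, HasExactColimitsOfShape I t.Heart := by
    have := ht I
    have := t.torsionFree_isClosedUnderColimitsOfShape_discrete ht I
    let := HasDerivedCategory.standard (I ⥤ A)
    have := t.isEquivalence_toHeartFunctor I
    have := t.hasColimitsOfShape_heart I
    exact ⟨this, t.hasExactColimitsOfShape_heart I⟩
  -- Filtered shapes reduce to directed posets along a final functor.
  have key' (J : Type v') [SmallCategory J] [IsFiltered J] :
      ∃ _ : HasColimitsOfShape J t.Heart, HasExactColimitsOfShape J t.Heart := by
    obtain ⟨α, _, _, _, Φ, _⟩ := IsFiltered.exists_directed J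
    have : IsDirectedOrder α := ‹_›
    obtain ⟨_, _⟩ := key α
    have : HasColimitsOfShape J t.Heart := Functor.Final.hasColimitsOfShape_of_final Φ
    exact ⟨this, hasExactColimitsOfShape_of_final _ Φ⟩
  have : HasFilteredColimitsOfSize.{v', v'} t.Heart := ⟨fun J _ _ ↦ (key' J).1⟩
  exact ⟨this, ⟨fun J _ _ ↦ (key' J).2⟩⟩

end TorsionPair

end

/-! ### Torsion and torsion-free objects in the heart -/

section

universe w' v' u'

namespace DerivedCategory

variable {A : Type u} [Category.{v} A] [Abelian A] [HasDerivedCategory.{w} A]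

lemma exists_singleFunctor_distTriang (n : ℤ) (S : ShortComplex A) (hS : S.ShortExact) :
    ∃ δ, Triangle.mk ((singleFunctor A n).map S.f) ((singleFunctor A n).map S.g) δ ∈
      distTriang (DerivedCategory A) :=
  ⟨_, triangleOfSES_distinguished
    (hS.map_of_exact (HomologicalComplex.single A (ComplexShape.up ℤ) n))⟩

end DerivedCategory

namespace TorsionPair

open DerivedCategory

variable {A : Type u} [Category.{v} A] [Abelian A] (t : TorsionPair A) [HasDerivedCategory.{w} A]

lemma heart_singleFunctor_zero (X : A) (hX : t.torsion X) :
    t.tStructure.heart ((singleFunctor A 0).obj X) := by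
  rw [mem_heart_iff]
  have : ((singleFunctor A 0).obj X).IsGE (-1) :=
    DerivedCategory.TStructure.t.isGE_of_ge _ (-1) 0
  exact ⟨⟨inferInstance,
    t.torsion.prop_of_iso ((singleFunctorCompHomologyFunctorIso A 0).app X).symm hX⟩, this,
    t.torsionFree_of_isZero (isZero_of_isGE _ 0 (-1) (by simp))⟩

lemma heart_singleFunctor_neg_one (X : A) (hX : t.torsionFree X) :
    t.tStructure.heart ((singleFunctor A (-1)).obj X) := by
  rw [mem_heart_iff]
  have : ((singleFunctor A (-1)).obj X).IsLE 0 :=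
    DerivedCategory.TStructure.t.isLE_of_le _ (-1) 0
  exact ⟨⟨this, t.torsion_of_isZero (isZero_of_isLE _ (-1) 0 (by simp))⟩, inferInstance,
    t.torsionFree.prop_of_iso ((singleFunctorCompHomologyFunctorIso A (-1)).app X).symm hX⟩

/-- The functor which sends a torsion object to the corresponding complex in degree `0`. -/
noncomputable def torsionToHeart : t.torsion.FullSubcategory ⥤ t.Heart :=
  t.tStructure.heart.lift (t.torsion.ι ⋙ singleFunctor A 0)
    fun X ↦ t.heart_singleFunctor_zero X.obj X.property

/-- The functor which sends a torsion-free object to the corresponding complex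
in degree `-1`. -/
noncomputable def freeToHeart : t.torsionFree.FullSubcategory ⥤ t.Heart :=
  t.tStructure.heart.lift (t.torsionFree.ι ⋙ singleFunctor A (-1))
    fun X ↦ t.heart_singleFunctor_neg_one X.obj X.property

instance : t.torsionToHeart.Full := by unfold torsionToHeart; infer_instance
instance : t.torsionToHeart.Faithful := by unfold torsionToHeart; infer_instance

instance : t.freeToHeart.Full := by unfold freeToHeart; infer_instance
instance : t.freeToHeart.Faithful := by unfold freeToHeart; infer_instance
instance : t.freeToHeart.Additive where
  map_add {X Y f g} := by
    ext
    exact (singleFunctor A (-1)).map_add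

/-- The source lives in degree `-1` and the target in degree `0`. In the heart the roles are thus
exchanged: shifted torsion-free objects play the part of the torsion class. -/
lemma freeToHeart_hom_eq_zero {X : t.torsionFree.FullSubcategory}
    {Y : t.torsion.FullSubcategory} (f : t.freeToHeart.obj X ⟶ t.torsionToHeart.obj Y) :
    f = 0 := by
  ext
  exact DerivedCategory.TStructure.t.zero_of_isLE_of_isGE f.hom (-1) 0 (by simp)
    (inferInstanceAs (((singleFunctor A (-1)).obj X.obj).IsLE (-1)))
    (inferInstanceAs (((singleFunctor A 0).obj Y.obj).IsGE 0))

lemma shortExact_freeToHeart {X₁ X₂ X₃ : t.torsionFree.FullSubcategory} (f : X₁ ⟶ X₂)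
    (g : X₂ ⟶ X₃) (w : f.hom ≫ g.hom = 0) (h : (ShortComplex.mk f.hom g.hom w).ShortExact)
    (w' : t.freeToHeart.map f ≫ t.freeToHeart.map g = 0) :
    (ShortComplex.mk (t.freeToHeart.map f) (t.freeToHeart.map g) w').ShortExact := by
  obtain ⟨δ, hδ⟩ := exists_singleFunctor_distTriang (-1) _ h
  exact t.tStructure.heart_shortExact_of_distTriang _ δ hδ

/-- This is the truncation triangle for the standard t-structure: its outer terms have one homology
object each, `H⁻¹(M)` and `H⁰(M)`. -/
lemma exists_shortExact_heart (M : t.Heart) :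
    ∃ (X : t.torsionFree.FullSubcategory) (Y : t.torsion.FullSubcategory)
      (i : t.freeToHeart.obj X ⟶ M) (p : M ⟶ t.torsionToHeart.obj Y) (w : i ≫ p = 0),
      (ShortComplex.mk i p w).ShortExact := by
  obtain ⟨⟨hM₀, hM₀'⟩, hM₁, hM₁'⟩ := (t.mem_heart_iff _).1 M.property
  obtain ⟨B, C, hB, hC, a, b, c, hT⟩ :=
    DerivedCategory.TStructure.t.exists_triangle M.obj (-1) 0 (by simp)
  replace hB : B.IsLE (-1) := ⟨hB⟩
  replace hC : C.IsGE 0 := ⟨hC⟩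
  have lB : IsLE (B⟦(1 : ℤ)⟧) (-2) := DerivedCategory.TStructure.t.isLE_shift B (-1) 1 (-2)
  have lB' : IsLE (B⟦(1 : ℤ)⟧) 0 := DerivedCategory.TStructure.t.isLE_of_le _ (-2) 0
  have lC : C.IsLE 0 := DerivedCategory.TStructure.t.isLE₂ _ (rot_of_distTriang _ hT) 0 ‹_› lB'
  have gC : IsGE (C⟦(-1 : ℤ)⟧) 1 := DerivedCategory.TStructure.t.isGE_shift C 0 (-1) 1
  have gC' : IsGE (C⟦(-1 : ℤ)⟧) (-1) := DerivedCategory.TStructure.t.isGE_of_ge _ (-1) 1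
  have gB : B.IsGE (-1) :=
    DerivedCategory.TStructure.t.isGE₂ _ (inv_rot_of_distTriang _ hT) (-1) gC' ‹_›
  obtain ⟨X, ⟨eX⟩⟩ := exists_iso_singleFunctor_obj_of_isGE_of_isLE B (-1)
  obtain ⟨Y, ⟨eY⟩⟩ := exists_iso_singleFunctor_obj_of_isGE_of_isLE C 0
  have h₁ : IsIso ((homologyFunctor A (-1)).map a) :=
    isIso_homologyMap_mor₁ _ hT (-2) (-1) rfl (isZero_of_isGE C 0 (-2) (by simp))
      (isZero_of_isGE C 0 (-1) (by simp))
  have h₂ : IsIso ((homologyFunctor A 0).map b) :=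
    isIso_homologyMap_mor₂ _ hT 0 1 rfl (isZero_of_isLE B (-1) 0 (by simp))
      (isZero_of_isLE B (-1) 1 (by simp))
  have hX : t.torsionFree X := t.torsionFree.prop_of_iso
    ((asIso ((homologyFunctor A (-1)).map a)).symm ≪≫ (homologyFunctor A (-1)).mapIso eX ≪≫
      (singleFunctorCompHomologyFunctorIso A (-1)).app X) hM₁'
  have hY : t.torsion Y := t.torsion.prop_of_iso
    (asIso ((homologyFunctor A 0).map b) ≪≫ (homologyFunctor A 0).mapIso eY ≪≫
      (singleFunctorCompHomologyFunctorIso A 0).app Y) hM₀'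
  let i : t.freeToHeart.obj ⟨X, hX⟩ ⟶ M := ObjectProperty.homMk (eX.inv ≫ a)
  let p : M ⟶ t.torsionToHeart.obj ⟨Y, hY⟩ := ObjectProperty.homMk (b ≫ eY.hom)
  have w : i ≫ p = 0 := t.freeToHeart_hom_eq_zero _
  refine ⟨⟨X, hX⟩, ⟨Y, hY⟩, i, p, w, t.tStructure.heart_shortExact_of_distTriang _
    (eY.inv ≫ c ≫ eX.hom⟦(1 : ℤ)⟧') ?_⟩
  refine isomorphic_distinguished _ hT _
    (Triangle.isoMk _ _ eX.symm (Iso.refl _) eY.symm ?_ ?_ ?_)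
  · exact Category.comp_id _
  · change (b ≫ eY.hom) ≫ eY.inv = 𝟙 _ ≫ b
    simp
  · change (eY.inv ≫ c ≫ eX.hom⟦(1 : ℤ)⟧') ≫ eX.inv⟦(1 : ℤ)⟧' = eY.inv ≫ c
    rw [Category.assoc, Category.assoc, ← Functor.map_comp, eX.hom_inv_id, CategoryTheory.Functor.map_id,
      Category.comp_id]

/-! ### If the heart is AB5, then the torsion-free class is closed under direct limits -/

/-- A cocone lands in the subobject `H⁻¹[1]` of its point, so by full faithfulness it comes from a
cocone in `A` with torsion-free point. The latter factors through the torsion object `c.pt`, hence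
is zero. -/
lemma freeToHeart_cocone_eq_zero {J : Type*} [Category* J] {F : J ⥤ A} {c : Cocone F}
    (hc : IsColimit c) (hF : ∀ j, t.torsionFree (F.obj j)) (hT : t.torsion c.pt)
    (s : Cocone (t.torsionFree.lift F hF ⋙ t.freeToHeart)) (j : J) : s.ι.app j = 0 := by
  obtain ⟨X, Y, i, p, w, h⟩ := t.exists_shortExact_heart s.pt
  have := h.mono_f
  choose φ hφ using fun j ↦ t.freeToHeart.map_surjective
    (X := (t.torsionFree.lift F hF).obj j) (h.exact.lift (s.ι.app j) (t.freeToHeart_hom_eq_zero _))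
  have hφ' (j) : t.freeToHeart.map (φ j) ≫ i = s.ι.app j := by
    rw [hφ]
    exact h.exact.lift_f _ _
  have hφc {j j'} (f : j ⟶ j') : F.map f ≫ (φ j').hom = (φ j).hom := by
    refine congr_arg (·.hom) (t.freeToHeart.map_injective
      (a₁ := (t.torsionFree.lift F hF).map f ≫ φ j') ?_)
    rw [← cancel_mono i, Functor.map_comp, Category.assoc, hφ', hφ']
    exact s.w f
  let s' : Cocone F :=
    { pt := X.obj
      ι := { app j := (φ j).hom, naturality _ _ f := (hφc f).trans (Category.comp_id _).symm } }
  have h0 : (φ j).hom = 0 := by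
    rw [show (φ j).hom = c.ι.app j ≫ hc.desc s' from (hc.fac s' j).symm,
      t.hom_eq_zero (hc.desc s') hT X.property, comp_zero]
  rw [← hφ', show φ j = 0 from by ext; exact h0, Functor.map_zero, zero_comp]

end TorsionPair

end

/-! ### Embedding coproducts in products, and the splitting argument. -/

section

universe w' v' u'

namespace CategoryTheory.Limits

attribute [local instance] IsFiltered.isConnected

lemma mono_sigmaDesc_of_finite {C : Type u} [Category.{v} C] [Abelian C] {J K : Type*} [Finite J]
    [DecidableEq K] (X : K → C) [HasProduct X] (e : J → K) (he : Function.Injective e)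
    (φ : (∐ fun j ↦ X (e j)) ⟶ ∏ᶜ X)
    (hφ : ∀ j, Sigma.ι (fun j ↦ X (e j)) j ≫ φ = Pi.ι X (e j)) : Mono φ := by
  classical
  have := Fintype.ofFinite J
  -- A retraction: project to the finitely many factors `e j` and include them back.
  let r : ∏ᶜ X ⟶ ∐ fun j ↦ X (e j) := ∑ j, Pi.π X (e j) ≫ Sigma.ι (fun j ↦ X (e j)) j
  have hr : φ ≫ r = 𝟙 _ := Limits.Sigma.hom_ext _ _ fun j ↦ by
    rw [← Category.assoc, hφ, Preadditive.comp_sum, Category.comp_id, Finset.sum_eq_single j]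
    · rw [Pi.ι_π_eq_id_assoc]
    · intro k _ hk
      rw [Pi.ι_π_of_ne_assoc _ (fun h ↦ hk (he h).symm), zero_comp]
    · simp
  exact mono_of_mono_fac hr

/-- In an abelian category with exact filtered colimits, the canonical morphism from a coproduct to
the product is a monomorphism. -/
lemma mono_sigmaDesc_piι {C : Type u} [Category.{v} C] [Abelian C] {S : Type u'} [DecidableEq S]
    (X : S → C) [HasCoproduct X] [HasProduct X] [HasColimitsOfShape (Finset (Discrete S)) C]
    [HasExactColimitsOfShape (Finset (Discrete S)) C] :
    Mono (Limits.Sigma.desc fun s ↦ Pi.ι X s) := by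
  classical
  have := HasExactColimitsOfShape.preservesFiniteLimits (J := Finset (Discrete S)) (C := C)
  let F := CoproductsFromFiniteFiltered.liftToFinsetObj (Discrete.functor X)
  let c := CoproductsFromFiniteFiltered.finiteSubcoproductsCocone X
  let σ : ∐ X ⟶ ∏ᶜ X := Limits.Sigma.desc fun s ↦ Pi.ι X s
  let φ : F ⟶ (Functor.const _).obj (∏ᶜ X) := c.ι ≫ (Functor.const _).map σ
  have (s : Finset (Discrete S)) : Mono (φ.app s) :=
    mono_sigmaDesc_of_finite X (fun j : s ↦ j.1.as)
      (fun j j' h ↦ Subtype.ext (Discrete.ext h)) _ fun j ↦ by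
        have h : Sigma.ι (fun j : s ↦ X j.1.as) j ≫ c.ι.app s = Sigma.ι X j.1.as :=
          Limits.Sigma.ι_desc _ _
        exact (Category.assoc _ _ _).symm.trans ((congr_arg (· ≫ σ) h).trans
          (Limits.Sigma.ι_desc _ _))
  have := NatTrans.mono_of_mono_app φ
  exact colim.map_mono' φ (CoproductsFromFiniteFiltered.isColimitFiniteSubproductsCocone X)
    (isColimitConstCocone _ _) σ fun s ↦ (Category.comp_id _).symm

end CategoryTheory.Limits

namespace TorsionPair

open DerivedCategory

attribute [local instance] IsFiltered.isConnected

variable {A : Type u} [Category.{v} A] [Abelian A] (t : TorsionPair A)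

/-- The coproduct embeds in the product, which is torsion-free. This supplies torsion-free covers of
colimits of torsion-free objects. -/
lemma torsionFree_sigma_of_isGrothendieckAbelian [IsGrothendieckAbelian.{v'} A] {S : Type v'}
    (X : S → A) (hX : ∀ s, t.torsionFree (X s)) : t.torsionFree (∐ X) := by
  classical
  have := mono_sigmaDesc_piι X
  exact t.torsionFree_of_mono (Limits.Sigma.desc fun s ↦ Pi.ι X s)
    (t.torsionFree.prop_limit _ fun s : Discrete S ↦ hX s.as)

variable [HasDerivedCategory.{w} A]

section

variable {I : Type u'} [Category.{v'} I] [IsFiltered I] [HasColimitsOfShape I t.Heart]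
  [HasExactColimitsOfShape I t.Heart]

/-- If filtered colimits are exact in the heart, a short exact sequence of diagrams of torsion-free
objects, with constant first term and where the colimit of the third term is torsion, has a
retraction. -/
lemma exists_retraction_of_torsion (K : A) (P F : I ⥤ A) (f : (Functor.const I).obj K ⟶ P)
    (g : P ⟶ F) (w : f ≫ g = 0) (h : (ShortComplex.mk f g w).ShortExact)
    (hK : t.torsionFree K) (hP : ∀ i, t.torsionFree (P.obj i)) (hF : ∀ i, t.torsionFree (F.obj i))
    (c : Cocone F) (hc : IsColimit c) (hT : t.torsion c.pt) :
    ∃ r : P ⟶ (Functor.const I).obj K, f ≫ r = 𝟙 _ := by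
  have := HasExactColimitsOfShape.preservesFiniteLimits (J := I) (C := t.Heart)
  let P' := t.torsionFree.lift P hP ⋙ t.freeToHeart
  let F' := t.torsionFree.lift F hF ⋙ t.freeToHeart
  let K' := t.freeToHeart.obj ⟨K, hK⟩
  let f' : (Functor.const I).obj K' ⟶ P' :=
    { app i := t.freeToHeart.map (ObjectProperty.homMk (f.app i))
      naturality i j φ := by
        refine (Category.id_comp _).trans (Eq.trans (congr_arg _ ?_) (t.freeToHeart.map_comp _ _))
        ext
        exact (Category.id_comp _).symm.trans (f.naturality φ) }
  let g' : P' ⟶ F' :=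
    { app i := t.freeToHeart.map (ObjectProperty.homMk (g.app i))
      naturality i j φ := by
        refine (t.freeToHeart.map_comp _ _).symm.trans
          (Eq.trans (congr_arg _ ?_) (t.freeToHeart.map_comp _ _))
        ext
        exact g.naturality φ }
  have w' : f' ≫ g' = 0 := by
    ext i : 2
    refine (t.freeToHeart.map_comp _ _).symm.trans
      ((congr_arg _ ?_).trans (t.freeToHeart.map_zero _ _))
    ext
    exact NatTrans.congr_app w i
  have h' : (ShortComplex.mk f' g' w').ShortExact :=
    ShortComplex.shortExact_of_evaluation _ fun i ↦
      t.shortExact_freeToHeart _ _ _ (h.map_of_exact ((evaluation I A).obj i)) _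
  have hf' : Mono f' := h'.mono_f
  let c₁ := constCocone I K'
  have hc₁ : IsColimit c₁ := isColimitConstCocone I K'
  let c₂ := colimit.cocone P'
  let u : c₁.pt ⟶ c₂.pt := hc₁.desc ⟨c₂.pt, f' ≫ c₂.ι⟩
  have hu (i) : c₁.ι.app i ≫ u = f'.app i ≫ c₂.ι.app i := hc₁.fac _ i
  -- All cocones on `F'` vanish, so its colimit in the heart is zero although `c.pt` need not be.
  let c₃ : Cocone F' := ⟨0, 0⟩
  have hc₃ : IsColimit c₃ :=
    { desc s := 0
      fac s i := by
        rw [comp_zero]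
        exact (t.freeToHeart_cocone_eq_zero hc hF hT s i).symm
      uniq s m _ := (isZero_zero _).eq_of_src _ _ }
  -- AB5 makes the colimit sequence exact: `u` is a monomorphism, and an epimorphism because the
  -- third term is zero.
  have : Mono u := colim.map_mono' f' hc₁ (colimit.isColimit P') u hu
  have : Epi u := (colim.exact_mapShortComplex h'.exact hc₁ (colimit.isColimit P') hc₃ u
    (0 : c₂.pt ⟶ c₃.pt) hu (fun i ↦ (isZero_zero _).eq_of_tgt _ _)).epi_f rfl
  have : IsIso u := isIso_of_mono_of_epi u
  obtain ⟨v, huv, -⟩ : ∃ v : c₂.pt ⟶ K', u ≫ v = 𝟙 K' ∧ v ≫ u = 𝟙 c₂.pt :=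
    this.out
  -- The inverse of `u` retracts the shifted diagram; its components come from `A` because
  -- `freeToHeart` is full.
  choose ρ hρ using fun i ↦ t.freeToHeart.map_surjective
    (X := (t.torsionFree.lift P hP).obj i) (Y := ⟨K, hK⟩) (c₂.ι.app i ≫ v)
  have hρ' {i j} (φ : i ⟶ j) : P.map φ ≫ (ρ j).hom = (ρ i).hom := by
    refine congr_arg (·.hom) (t.freeToHeart.map_injective
      (a₁ := (t.torsionFree.lift P hP).map φ ≫ ρ j) ?_)
    rw [Functor.map_comp, hρ, hρ]
    exact (Category.assoc _ _ _).symm.trans (congr_arg (· ≫ v) (c₂.w φ))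
  refine ⟨{ app i := (ρ i).hom, naturality i j φ := (hρ' φ).trans (Category.comp_id _).symm }, ?_⟩
  ext i
  refine congr_arg (·.hom) (t.freeToHeart.map_injective
      (a₁ := ObjectProperty.homMk (f.app i) ≫ ρ i) (a₂ := 𝟙 (⟨K, hK⟩ : t.torsionFree.FullSubcategory)) ?_)
  rw [Functor.map_comp, hρ, CategoryTheory.Functor.map_id]
  refine (Category.assoc _ _ _).symm.trans ((congr_arg (· ≫ v) (hu i).symm).trans ?_)
  exact (congr_arg (· ≫ v) (Category.id_comp u)).trans huv

variable [HasColimitsOfShape I A] [HasExactColimitsOfShape I A]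

/-- Pulling the diagram back along `p` gives extensions of the `F i` by the constant diagram on
`kernel p`. The heart splits off this kernel, so the colimit of the pullbacks maps to `c.pt` with a
section. This section, followed by the map to `P`, is zero. -/
lemma isZero_of_isColimit_of_torsion (F : I ⥤ A) (c : Cocone F) (hc : IsColimit c)
    (hF : ∀ i, t.torsionFree (F.obj i)) (hT : t.torsion c.pt) {P : A} (hP : t.torsionFree P)
    (p : P ⟶ c.pt) [Epi p] : IsZero c.pt := by
  have := HasExactColimitsOfShape.preservesFiniteLimits (J := I) (C := A)
  have hS := (ShortComplex.ShortExact.mk' (ShortComplex.exact_kernel p) inferInstance ‹_›).map_of_exact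
    (Functor.const I)
  have : Epi ((Functor.const I).map p) := hS.epi_g
  have := hS.mono_f
  let Q := pullback ((Functor.const I).map p) c.ι
  let f : (Functor.const I).obj (kernel p) ⟶ Q :=
    pullback.lift ((Functor.const I).map (kernel.ι p)) 0 (by
      rw [zero_comp, ← Functor.map_comp, kernel.condition, Functor.map_zero])
  let g : Q ⟶ F := pullback.snd _ _
  have w : f ≫ g = 0 := pullback.lift_snd _ _ _
  have hf : f ≫ pullback.fst _ _ = (Functor.const I).map (kernel.ι p) := pullback.lift_fst _ _ _
  have : Mono ((Functor.const I).map (kernel.ι p)) := hS.mono_f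
  have : Mono f := mono_of_mono_fac hf
  have hPB := IsPullback.of_hasPullback ((Functor.const I).map p) c.ι
  have h : (ShortComplex.mk f g w).ShortExact :=
    { exact := ShortComplex.exact_of_f_is_kernel _ (KernelFork.IsLimit.ofι' _ _ fun k hk ↦
        ⟨hS.exact.lift (k ≫ pullback.fst _ _) (by
          refine (Category.assoc _ _ _).trans ((congr_arg (k ≫ ·) hPB.w).trans ?_)
          exact (Category.assoc _ _ _).symm.trans ((congr_arg (· ≫ c.ι) hk).trans zero_comp)),
          hPB.hom_ext
            ((Category.assoc _ _ _).trans ((congr_arg (_ ≫ ·) hf).trans (hS.exact.lift_f _ _)))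
            ((Category.assoc _ _ _).trans ((congr_arg (_ ≫ ·) w).trans
              (comp_zero.trans hk.symm)))⟩)
      mono_f := ‹_›
      epi_g := inferInstanceAs (Epi (pullback.snd _ _)) }
  -- The pullback embeds in the product of `P` and `F i`.
  have hQ (i) : t.torsionFree (Q.obj i) := by
    rw [torsionFree_iff]
    intro X k hX
    exact (hPB.map ((evaluation I A).obj i)).hom_ext
      ((t.hom_eq_zero _ hX hP).trans zero_comp.symm)
      ((t.hom_eq_zero _ hX (hF i)).trans zero_comp.symm)
  obtain ⟨r, hr⟩ := t.exists_retraction_of_torsion (kernel p) Q F f g w h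
    (t.torsionFree_of_mono (kernel.ι p) hP) hQ hF c hc hT
  let hc₁ := isColimitConstCocone I (kernel p)
  let c₂ := colimit.cocone Q
  let hc₂ : IsColimit c₂ := colimit.isColimit Q
  let k : kernel p ⟶ c₂.pt := hc₁.desc ⟨c₂.pt, f ≫ c₂.ι⟩
  let π : c₂.pt ⟶ c.pt := hc₂.desc ⟨c.pt, g ≫ c.ι⟩
  have hk (i) : (constCocone I (kernel p)).ι.app i ≫ k = f.app i ≫ c₂.ι.app i := hc₁.fac _ i
  have hπ (i) : c₂.ι.app i ≫ π = g.app i ≫ c.ι.app i := hc₂.fac _ i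
  have : ∀ i, Epi (g.app i) := fun i ↦ (h.map_of_exact ((evaluation I A).obj i)).epi_g
  have hπ' : Epi π := colim.map_epi' g c₂ hc π hπ
  let ρ : c₂.pt ⟶ kernel p := hc₂.desc ⟨kernel p, r⟩
  have hρ (i) : c₂.ι.app i ≫ ρ = r.app i := hc₂.fac _ i
  let q : c₂.pt ⟶ P := hc₂.desc ⟨P, pullback.fst _ _⟩
  have hq (i) : c₂.ι.app i ≫ q = (pullback.fst ((Functor.const I).map p) c.ι).app i :=
    hc₂.fac _ i
  have hqp : q ≫ p = π := hc₂.hom_ext fun i ↦ by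
    rw [hπ, ← Category.assoc, hq]
    exact NatTrans.congr_app hPB.w i
  have hkρ : k ≫ ρ = 𝟙 _ := hc₁.hom_ext fun i ↦ by
    refine (Category.assoc _ _ _).symm.trans ((congr_arg (· ≫ ρ) (hk i)).trans ?_)
    refine (Category.assoc _ _ _).trans ((congr_arg (_ ≫ ·) (hρ i)).trans ?_)
    exact (NatTrans.congr_app hr i).trans (Category.comp_id _).symm
  let s := ShortComplex.Splitting.ofExactOfRetraction _
    (colim.exact_mapShortComplex h.exact hc₁ hc₂ hc k π hk hπ) ρ hkρ hπ'
  rw [IsZero.iff_id_eq_zero]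
  refine s.s_g.symm.trans ?_
  -- The identity of `c.pt` is `s' ≫ q ≫ p`, where `s' ≫ q` goes from a torsion to a torsion-free
  -- object.
  let s' : c.pt ⟶ c₂.pt := s.s
  change s' ≫ π = 0
  rw [← hqp, ← Category.assoc, t.hom_eq_zero (s' ≫ q) hT hP, zero_comp]

/-- By exactness of colimits, the torsion part of the colimit is itself the colimit of a diagram of
subobjects of the `F i`, so the torsion case applies to it. -/
lemma torsionFree_of_isColimit (F : I ⥤ A) (c : Cocone F) (hc : IsColimit c)
    (hF : ∀ i, t.torsionFree (F.obj i))
    (hA : ∀ (F : I ⥤ A) (_ : ∀ i, t.torsionFree (F.obj i)) (c : Cocone F) (_ : IsColimit c),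
      ∃ (P : A) (p : P ⟶ c.pt), t.torsionFree P ∧ Epi p) :
    t.torsionFree c.pt := by
  have := HasExactColimitsOfShape.preservesFiniteLimits (J := I) (C := A)
  let τ : F ⟶ (Functor.const I).obj (t.freePart c.pt) :=
    c.ι ≫ (Functor.const I).map (t.freePartπ c.pt)
  let c' := colimit.cocone (kernel τ)
  let hc' : IsColimit c' := colimit.isColimit (kernel τ)
  let hc₃ := isColimitConstCocone I (t.freePart c.pt)
  let m : c'.pt ⟶ c.pt := hc'.desc ⟨c.pt, kernel.ι τ ≫ c.ι⟩
  have hm (i) : c'.ι.app i ≫ m = (kernel.ι τ).app i ≫ c.ι.app i := hc'.fac _ i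
  have : Mono m := colim.map_mono' (kernel.ι τ) hc' hc m hm
  have hS := colim.exact_mapShortComplex (ShortComplex.exact_kernel τ) hc' hc hc₃ m
    (t.freePartπ c.pt) hm (fun i ↦ (Category.comp_id _).symm)
  have : Mono (ShortComplex.mk _ _ (t.torsionPartι_freePartπ c.pt)).f :=
    inferInstanceAs (Mono (t.torsionPartι c.pt))
  let e : c'.pt ≅ t.torsionPart c.pt := IsLimit.conePointUniqueUpToIso
    (@ShortComplex.Exact.fIsKernel _ _ _ _ _ hS ‹Mono m›) (t.shortExact_torsionPart c.pt).exact.fIsKernel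
  have hF' (i) : t.torsionFree ((kernel τ).obj i) :=
    t.torsionFree_of_mono ((kernel.ι τ).app i) (hF i)
  obtain ⟨P, p, hP, _⟩ := hA _ hF' c' hc'
  have hz : IsZero c'.pt := t.isZero_of_isColimit_of_torsion _ c' hc' hF'
    (t.torsion.prop_of_iso e.symm (t.torsion_torsionPart _)) hP p
  have : Mono (t.freePartπ c.pt) := hS.mono_g (hz.eq_of_src _ _)
  exact t.torsionFree_of_mono (t.freePartπ c.pt) (t.torsionFree_freePart _)

end

/-- If the heart of the Happel-Reiten-Smalø t-structure of a torsion pair in a Grothendieck category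
is AB5, then the torsion-free class is closed under direct limits. -/
lemma isClosedUnderDirectLimits_of_isAB5_heart [IsGrothendieckAbelian.{v'} A]
    (h : IsAB5.{v'} t.Heart) : IsClosedUnderDirectLimits.{v'} t.torsionFree := by
  obtain ⟨_, _⟩ := h
  intro I _ _ _
  constructor
  rintro X ⟨⟨F, ι, hι⟩, hF⟩
  refine t.torsionFree_of_isColimit F ⟨X, ι⟩ hι hF fun F hF c hc ↦
    ⟨∐ F.obj, Limits.Sigma.desc c.ι.app, t.torsionFree_sigma_of_isGrothendieckAbelian _ hF, ⟨?_⟩⟩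
  intro Z a b hab
  exact hc.hom_ext fun i ↦ by
    have := congr_arg (Sigma.ι F.obj i ≫ ·) hab
    simpa using this

end TorsionPair

end

/-! ### The heart is locally small -/

section

universe w' v' u'

lemma AddMonoidHom.small_of_small_ker {M N : Type*} [AddCommGroup M] [AddCommGroup N] (f : M →+ N)
    [Small.{w} N] [Small.{w} f.ker] : Small.{w} M := by
  choose σ hσ using fun y : f.range ↦ y.2
  -- An element is determined by its image and by its difference with a chosen preimage of that
  -- image.
  let g (x : M) : N × f.ker := ⟨f x, x - σ ⟨f x, x, rfl⟩, by simp [f.mem_ker, hσ]⟩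
  have hg : Function.Injective g := fun x y h ↦ by
    have h₁ : f x = f y := congr_arg Prod.fst h
    have h₂ : x - σ ⟨f x, x, rfl⟩ = y - σ ⟨f y, y, rfl⟩ := congr_arg (fun z ↦ (z.2 : M)) h
    have h₃ : σ ⟨f x, x, rfl⟩ = σ ⟨f y, y, rfl⟩ := by congr 1; exact Subtype.ext h₁
    rw [h₃] at h₂
    exact sub_left_injective h₂
  exact small_of_injective hg

namespace CategoryTheory.ShortComplex

variable {C : Type u} [Category.{v} C] [Abelian C] {S : ShortComplex C}

lemma Exact.small_hom_to (hS : S.Exact) [Mono S.f] (X : C) [Small.{w} (X ⟶ S.X₁)]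
    [Small.{w} (X ⟶ S.X₃)] : Small.{w} (X ⟶ S.X₂) := by
  let f : (X ⟶ S.X₂) →+ (X ⟶ S.X₃) := Preadditive.rightComp X S.g
  have : Small.{w} f.ker := by
    refine small_of_injective (f := fun x : f.ker ↦ hS.lift x.1 x.2) fun x y h ↦ Subtype.ext ?_
    rw [← hS.lift_f x.1 x.2, ← hS.lift_f y.1 y.2]
    exact congr_arg (· ≫ S.f) h
  exact f.small_of_small_ker

lemma Exact.small_hom_from (hS : S.Exact) [Epi S.g] (X : C) [Small.{w} (S.X₁ ⟶ X)]
    [Small.{w} (S.X₃ ⟶ X)] : Small.{w} (S.X₂ ⟶ X) := by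
  let f : (S.X₂ ⟶ X) →+ (S.X₁ ⟶ X) := Preadditive.leftComp X S.f
  have : Small.{w} f.ker := by
    refine small_of_injective (f := fun x : f.ker ↦ hS.desc x.1 x.2) fun x y h ↦ Subtype.ext ?_
    rw [← hS.g_desc x.1 x.2, ← hS.g_desc y.1 y.2]
    exact congr_arg (S.g ≫ ·) h
  exact f.small_of_small_ker

end CategoryTheory.ShortComplex

namespace TorsionPair

open DerivedCategory

variable {A : Type u} [Category.{v} A] [Abelian A] (t : TorsionPair A) [HasDerivedCategory.{w} A]

/-- Devissage of both objects into their two pieces reduces to morphisms between objects of `A`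
placed in single degrees, which `HasExt` makes small. -/
lemma locallySmall_heart [HasExt.{w'} A] : LocallySmall.{w'} t.Heart where
  hom_small M N := by
    have h {M N : t.Heart} {a b : ℤ} {X Y : A} (hM : M.obj = (singleFunctor A a).obj X)
        (hN : N.obj = (singleFunctor A b).obj Y) : Small.{w'} (M ⟶ N) := by
      have : Small.{w'} (M.obj ⟶ N.obj) := by
        rw [hM, hN]
        infer_instance
      exact small_of_injective (f := fun f : M ⟶ N ↦ f.hom)
        (fun f g hfg ↦ ObjectProperty.hom_ext _ hfg)
    obtain ⟨X, Y, i, p, w, hS⟩ := t.exists_shortExact_heart M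
    obtain ⟨X', Y', i', p', w', hS'⟩ := t.exists_shortExact_heart N
    have := hS.epi_g
    have := hS'.mono_f
    have : Small.{w'} (t.freeToHeart.obj X ⟶ t.freeToHeart.obj X') := h rfl rfl
    have : Small.{w'} (t.freeToHeart.obj X ⟶ t.torsionToHeart.obj Y') := h rfl rfl
    have : Small.{w'} (t.torsionToHeart.obj Y ⟶ t.freeToHeart.obj X') := h rfl rfl
    have : Small.{w'} (t.torsionToHeart.obj Y ⟶ t.torsionToHeart.obj Y') := h rfl rfl
    have h₁ : Small.{w'} (t.freeToHeart.obj X ⟶ N) := hS'.exact.small_hom_to _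
    have h₂ : Small.{w'} (t.torsionToHeart.obj Y ⟶ N) := hS'.exact.small_hom_to _
    exact hS.exact.small_hom_from N

/-- The components of the cocone are jointly epimorphic in the heart. They factor through the kernel
of `g`, which is again a torsion object in degree `0`; the universal property in `A` then splits its
inclusion into `c.pt`. -/
lemma torsionToHeart_hom_eq_zero {J : Type*} [Category* J] {F : J ⥤ A} {c : Cocone F}
    (hc : IsColimit c) (hF : ∀ j, t.torsion (F.obj j)) (hT : t.torsion c.pt) {N : t.Heart}
    (g : t.torsionToHeart.obj ⟨c.pt, hT⟩ ⟶ N)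
    (h : ∀ j, t.torsionToHeart.map (X := ⟨F.obj j, hF j⟩) (ObjectProperty.homMk (c.ι.app j)) ≫ g =
      0) : g = 0 := by
  obtain ⟨X, Y, i, p, w, hS⟩ := t.exists_shortExact_heart (kernel g)
  have := hS.mono_f
  have := hS.epi_g
  -- The part in degree `-1` of the kernel maps by zero to an object in degree `0`, so it vanishes.
  have hi : i = 0 := by
    rw [← cancel_mono (kernel.ι g), t.freeToHeart_hom_eq_zero (i ≫ kernel.ι g), zero_comp]
  have : Mono p := hS.exact.mono_g hi
  have : IsIso p := isIso_of_mono_of_epi p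
  obtain ⟨z, hz⟩ := t.torsionToHeart.map_surjective (Y := ⟨c.pt, hT⟩) (inv p ≫ kernel.ι g)
  have : Mono (t.torsionToHeart.map z) := by rw [hz]; infer_instance
  choose φ hφ using fun j ↦ t.torsionToHeart.map_surjective (X := ⟨F.obj j, hF j⟩)
    (kernel.lift g _ (h j) ≫ p)
  have hφ' (j) : φ j ≫ z = ObjectProperty.homMk (c.ι.app j) := by
    refine t.torsionToHeart.map_injective ?_
    rw [Functor.map_comp, hφ, hz]
    simp
  let s : Cocone F :=
    { pt := Y.obj
      ι :=
        { app j := (φ j).hom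
          naturality j j' f := by
            let f' : (⟨F.obj j, hF j⟩ : t.torsion.FullSubcategory) ⟶ ⟨F.obj j', hF j'⟩ :=
              ObjectProperty.homMk (F.map f)
            have : f' ≫ φ j' = φ j := by
              refine t.torsionToHeart.map_injective ?_
              rw [← cancel_mono (t.torsionToHeart.map z), ← Functor.map_comp, ← Functor.map_comp,
                Category.assoc, hφ', hφ']
              congr 1
              ext
              exact c.w f
            exact (congr_arg (·.hom) this).trans (Category.comp_id _).symm } }
  let σ : (⟨c.pt, hT⟩ : t.torsion.FullSubcategory) ⟶ Y := ObjectProperty.homMk (hc.desc s)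
  have hσ : σ ≫ z = 𝟙 _ := by
    ext
    refine hc.hom_ext fun j ↦ ?_
    refine (hc.fac_assoc s j _).trans ?_
    exact (congr_arg (·.hom) (hφ' j)).trans (Category.comp_id _).symm
  have h0 : t.torsionToHeart.map z ≫ g = 0 := by
    rw [hz, Category.assoc, kernel.condition, comp_zero]
  rw [← Category.id_comp g, ← CategoryTheory.Functor.map_id, ← hσ, Functor.map_comp,
    Category.assoc, h0, comp_zero]

end TorsionPair

end

/-! ### Separators and filtered colimits of small objects -/

section

universe w' v' u'

namespace CategoryTheory

variable {A : Type u} [Category.{v} A] [Abelian A]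

/-- One map `X ⟶ W` is enough for each subobject of `V` which is the image of some composite `X ⟶ W
⟶ V`. The size of the coproduct thus depends on `V` only, not on `W`; this bounds the test objects.
-/
lemma IsSeparator.exists_epi_comp {X : A} (hX : IsSeparator X) {W V : A} (q : W ⟶ V) [Epi q]
    [Small.{w} (Subobject V)] [HasCoproduct fun _ : Shrink.{w} (Subobject V) ↦ X] :
    ∃ h : (∐ fun _ : Shrink.{w} (Subobject V) ↦ X) ⟶ W, Epi (h ≫ q) := by
  classical
  -- Subobjects which are not such images receive the zero map.
  have hσ (s : Shrink.{w} (Subobject V)) : ∃ y : X ⟶ W, ∀ x : X ⟶ W,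
      imageSubobject (x ≫ q) = (equivShrink _).symm s →
        imageSubobject (y ≫ q) = (equivShrink _).symm s := by
    by_cases h : ∃ y : X ⟶ W, imageSubobject (y ≫ q) = (equivShrink _).symm s
    · obtain ⟨y, hy⟩ := h
      exact ⟨y, fun _ _ ↦ hy⟩
    · exact ⟨0, fun x hx ↦ (h ⟨x, hx⟩).elim⟩
  choose σ hσ using hσ
  refine ⟨Limits.Sigma.desc σ, ⟨fun {Z} a b hab ↦ ?_⟩⟩
  rw [← cancel_epi q]
  refine IsSeparator.def hX _ _ fun x ↦ ?_
  let s := equivShrink.{w} _ (imageSubobject (x ≫ q))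
  have hs : imageSubobject (σ s ≫ q) = imageSubobject (x ≫ q) := by
    rw [hσ s x (by simp [s])]
    simp [s]
  have h₁ : (σ s ≫ q) ≫ a = (σ s ≫ q) ≫ b := by
    have := congr_arg (Sigma.ι (fun _ : Shrink.{w} (Subobject V) ↦ X) s ≫ ·) hab
    simpa using this
  have h₂ : (imageSubobject (σ s ≫ q)).arrow ≫ a = (imageSubobject (σ s ≫ q)).arrow ≫ b := by
    rw [← cancel_epi (factorThruImageSubobject (σ s ≫ q)), imageSubobject_arrow_comp_assoc, h₁,
      imageSubobject_arrow_comp_assoc]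
  rw [hs] at h₂
  rw [← Category.assoc, ← Category.assoc, ← imageSubobject_arrow_comp (x ≫ q), Category.assoc, h₂,
    Category.assoc]

attribute [local instance] IsFiltered.isConnected

/-- In a Grothendieck category with a separator `X`, any object is a filtered colimit of quotients
of finite coproducts of copies of `X`. -/
lemma IsSeparator.exists_isColimit [IsGrothendieckAbelian.{w} A] {X : A} (hX : IsSeparator X)
    (T : A) : ∃ (J : Type w) (_ : SmallCategory J) (_ : IsFiltered J) (F : J ⥤ A)
      (ι : F ⟶ (Functor.const J).obj T), Nonempty (IsColimit (Cocone.mk T ι)) ∧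
      (∀ j, Mono (ι.app j)) ∧ ∀ j, ∃ (n : ℕ) (p : (∐ fun _ : Fin n ↦ X) ⟶ F.obj j), Epi p := by
  classical
  let S := Shrink.{w} (X ⟶ T)
  let x : S → (X ⟶ T) := (equivShrink _).symm
  let f (s : Finset S) : (∐ fun _ : s ↦ X) ⟶ T := Limits.Sigma.desc fun y ↦ x y
  let D (s : Finset S) : Subobject T := imageSubobject (f s)
  have hD : Monotone D := fun s s' h ↦ by
    have : f s = (Limits.Sigma.desc fun y : s ↦ Sigma.ι (fun _ : s' ↦ X) ⟨y, h y.2⟩) ≫ f s' :=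
      Limits.Sigma.hom_ext _ _ fun y ↦ by simp [f]
    dsimp only [D]
    rw [this]
    exact imageSubobject_comp_le _ _
  let F : Finset S ⥤ A := hD.functor ⋙ Subobject.underlying
  let ι : F ⟶ (Functor.const _).obj T :=
    { app s := (D s).arrow
      naturality s s' h := (Subobject.underlying_arrow _).trans (Category.comp_id _).symm }
  let π (s : Finset S) : (∐ fun _ : s ↦ X) ⟶ F.obj s := factorThruImageSubobject (f s)
  have hπ (s : Finset S) : π s ≫ ι.app s = f s := imageSubobject_arrow_comp (f s)
  have hepi {Y Z : A} (g : Y ⟶ Z) : Epi (factorThruImageSubobject g) := inferInstance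
  have hπ' (s : Finset S) : Epi (π s) := hepi (f s)
  have hι (s) : Mono (ι.app s) := inferInstanceAs (Mono (D s).arrow)
  have := NatTrans.mono_of_mono_app ι
  have := HasExactColimitsOfShape.preservesFiniteLimits (J := Finset S) (C := A)
  refine ⟨Finset S, inferInstance, inferInstance, F, ι, ⟨?_⟩, hι, fun s ↦ ?_⟩
  -- The diagram consists of the images of finite families of maps from `X`: exactness gives a
  -- monomorphism, and one-element families give an epimorphism.
  · let m : colimit F ⟶ T := colimit.desc F ⟨T, ι⟩
    have hm (s) : colimit.ι F s ≫ m = ι.app s := colimit.ι_desc _ _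
    have : Mono m := colim.map_mono' ι (colimit.isColimit F) (isColimitConstCocone _ _) m
      fun s ↦ (hm s).trans (Category.comp_id _).symm
    have : Epi m := ⟨fun {Z} a b hab ↦ IsSeparator.def hX _ _ fun y ↦ by
      let s : Finset S := {equivShrink _ y}
      let i : s := ⟨equivShrink _ y, by simp [s]⟩
      have hy : y = (Sigma.ι (fun _ : s ↦ X) i ≫ π s ≫ colimit.ι F s) ≫ m := by
        rw [Category.assoc, Category.assoc, hm, hπ]
        simp [f, x, i]
      rw [hy, Category.assoc, hab, ← Category.assoc]⟩
    have : IsIso m := isIso_of_mono_of_epi m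
    have : IsIso ((colimit.isColimit F).desc ⟨T, ι⟩) := this
    exact IsColimit.ofPointIso (colimit.isColimit F)
  · let e := Sigma.reindex s.equivFin.symm (fun _ : s ↦ X)
    exact ⟨s.card, e.hom ≫ π s, epi_comp _ _⟩

end CategoryTheory

/-! ### Torsion radical and filtered colimits. -/

namespace TorsionPair

attribute [local instance] IsFiltered.isConnected

variable {A : Type u} [Category.{v} A] [Abelian A] (t : TorsionPair A)

/-- If filtered colimits of shape `J` are exact and preserve torsion-free objects, then they commute
with the torsion radical, for diagrams with a torsion colimit. -/
lemma nonempty_isColimit_torsionFunctor {J : Type*} [Category* J] [HasColimitsOfShape J A]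
    [HasExactColimitsOfShape J A] [t.torsionFree.IsClosedUnderColimitsOfShape J] (F : J ⥤ A)
    {T : A} (ι : F ⟶ (Functor.const J).obj T) (hι : IsColimit (Cocone.mk T ι))
    (hT : t.torsion T) :
    Nonempty (IsColimit (Cocone.mk T (Functor.whiskerLeft F t.torsionFunctorι ≫ ι))) := by
  have := HasExactColimitsOfShape.preservesFiniteLimits (J := J) (C := A)
  have hS := t.functorShortComplex_shortExact F
  let hc := colimit.isColimit (F ⋙ t.torsionFunctor)
  let hc₃ := colimit.isColimit (F ⋙ t.freeFunctor)
  let m : colimit (F ⋙ t.torsionFunctor) ⟶ T :=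
    hc.desc (Cocone.mk T (Functor.whiskerLeft F t.torsionFunctorι ≫ ι))
  have hm (j) : colimit.ι (F ⋙ t.torsionFunctor) j ≫ m = t.torsionPartι (F.obj j) ≫ ι.app j :=
    hc.fac _ j
  let g : T ⟶ colimit (F ⋙ t.freeFunctor) :=
    hι.desc (Cocone.mk _ (Functor.whiskerLeft F t.freeFunctorπ ≫ (colimit.cocone (F ⋙ t.freeFunctor)).ι))
  have hg (j) : ι.app j ≫ g = t.freePartπ (F.obj j) ≫ colimit.ι (F ⋙ t.freeFunctor) j :=
    hι.fac _ j
  have : Mono (t.functorShortComplex F).f := hS.mono_f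
  have : Mono m := colim.map_mono' (t.functorShortComplex F).f hc hι m hm
  -- The cokernel part is a colimit of torsion-free objects, hence torsion-free, and receives the
  -- zero map from the torsion object `T`.
  have : Epi m := (colim.exact_mapShortComplex hS.exact hc hι hc₃ m g hm hg).epi_f
    (t.hom_eq_zero _ hT (t.torsionFree.prop_colimit _ fun j ↦ t.torsionFree_freePart _))
  have : IsIso m := isIso_of_mono_of_epi m
  exact ⟨IsColimit.ofPointIso hc⟩

end TorsionPair

end

/-! ### Test objects in the heart -/

section

universe w' v' u'

/-- Quotients of `P` are replaced by cokernels of its subobjects, so that they can be indexed by a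
set. -/
lemma CategoryTheory.exists_subobject_cokernel_iso {A : Type u} [Category.{v} A] [Abelian A]
    {P Y : A} (p : P ⟶ Y) [Epi p] : ∃ R : Subobject P, Nonempty (cokernel R.arrow ≅ Y) := by
  refine ⟨Subobject.mk (kernel.ι p), ⟨?_⟩⟩
  exact cokernel.mapIso _ _ (Subobject.underlyingIso (kernel.ι p)) (Iso.refl _) (by simp) ≪≫
    (colimit.isColimit _).coconePointUniqueUpToIso
      (Abelian.epiIsCokernelOfKernel (limit.cone (parallelPair p 0)) (limit.isLimit _))

lemma CategoryTheory.ShortComplex.Exact.comp_mono {C : Type u} [Category.{v} C] [Abelian C]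
    {X₁ X₂ X₃ X₄ : C} {f : X₁ ⟶ X₂} {g : X₂ ⟶ X₃} {w : f ≫ g = 0}
    (h : (ShortComplex.mk f g w).Exact) (p : X₃ ⟶ X₄) [Mono p]
    (w' : f ≫ g ≫ p = 0) : (ShortComplex.mk f (g ≫ p) w').Exact := by
  let φ : ShortComplex.mk f g w ⟶ ShortComplex.mk f (g ≫ p) w' :=
    { τ₁ := 𝟙 _, τ₂ := 𝟙 _, τ₃ := p }
  have : Mono φ.τ₃ := ‹Mono p›
  exact (ShortComplex.exact_iff_of_epi_of_isIso_of_mono φ).1 h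

/-- The object `W` has uncontrolled size. It is cut down to a subobject which still covers the
kernel of `e` and is a quotient of a coproduct depending only on `X` and that kernel. -/
lemma CategoryTheory.IsSeparator.exists_exact_of_exact {A : Type u} [Category.{v} A] [Abelian A]
    {X : A} (hX : IsSeparator X) {W B T : A} {d : W ⟶ B} {e : B ⟶ T} {w : d ≫ e = 0}
    (h : (ShortComplex.mk d e w).Exact) [Small.{w'} (Subobject (kernelSubobject e : A))]
    [HasCoproduct fun _ : Shrink.{w'} (Subobject (kernelSubobject e : A)) ↦ X] :
    ∃ (R : Subobject (∐ fun _ : Shrink.{w'} (Subobject (kernelSubobject e : A)) ↦ X))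
      (m : cokernel R.arrow ⟶ W) (w' : (m ≫ d) ≫ e = 0), Mono m ∧
        (ShortComplex.mk (m ≫ d) e w').Exact := by
  let q := factorThruKernelSubobject e d w
  have hq : q ≫ (kernelSubobject e).arrow = d := factorThruKernelSubobject_comp_arrow _ _ _
  have : Epi q := by
    rw [epi_iff_surjective_up_to_refinements]
    intro Z y
    obtain ⟨Z', π, hπ, x, hx⟩ := h.exact_up_to_refinements (y ≫ (kernelSubobject e).arrow)
      (by simp)
    refine ⟨Z', π, hπ, x, ?_⟩
    rw [← cancel_mono (kernelSubobject e).arrow, Category.assoc, Category.assoc, hq]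
    exact hx
  obtain ⟨f, hf⟩ := hX.exists_epi_comp.{w'} q
  obtain ⟨R, ⟨eR⟩⟩ := exists_subobject_cokernel_iso (Abelian.factorThruImage f)
  let m : cokernel R.arrow ⟶ W := eR.hom ≫ Abelian.image.ι f
  have : Epi (m ≫ q) := by
    have : Epi ((Abelian.factorThruImage f ≫ eR.inv) ≫ m ≫ q) := by
      simpa [m] using hf
    exact epi_of_epi (Abelian.factorThruImage f ≫ eR.inv) _
  have hmd : m ≫ d = (m ≫ q) ≫ (kernelSubobject e).arrow :=
    (congr_arg (m ≫ ·) hq.symm).trans (Category.assoc _ _ _).symm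
  refine ⟨R, m, by rw [Category.assoc, w, comp_zero], mono_comp _ _, ?_⟩
  rw [ShortComplex.exact_iff_exact_up_to_refinements]
  intro Z y hy
  obtain ⟨Z', π, hπ, x, hx⟩ := surjective_up_to_refinements_of_epi (m ≫ q)
    (factorThruKernelSubobject e y hy)
  refine ⟨Z', π, hπ, x, ?_⟩
  dsimp
  rw [hmd, ← Category.assoc x, ← hx, Category.assoc, factorThruKernelSubobject_comp_arrow]

namespace DerivedCategory

variable {A : Type u} [Category.{v} A] [Abelian A] [HasDerivedCategory.{w} A]

/-- For a complex in degrees at most `0`, the term in degree `0` surjects onto `H⁰`. -/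
lemma exists_singleFunctor_epi_homologyMap (M : DerivedCategory A) [M.IsLE 0] :
    ∃ (K : A) (φ : (singleFunctor A 0).obj K ⟶ M), Epi ((homologyFunctor A 0).map φ) := by
  obtain ⟨K, hK, ⟨e⟩⟩ := exists_iso_Q_obj_of_isLE M 0
  have hd : K.d 0 1 = 0 := (K.isZero_of_isStrictlyLE 0 1).eq_of_tgt _ _
  let f : (HomologicalComplex.single A (ComplexShape.up ℤ) 0).obj (K.X 0) ⟶ K :=
    HomologicalComplex.mkHomFromSingle (𝟙 (K.X 0)) (by
      intro k hk
      obtain rfl : 1 = k := by simpa using hk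
      simp [hd])
  have : Epi (f.f 0) := by
    rw [HomologicalComplex.mkHomFromSingle_f]
    infer_instance
  have : Epi (HomologicalComplex.homologyMap f 0) :=
    ((MorphismProperty.epimorphisms A).arrow_mk_iso_iff
      (Arrow.isoMk (HomologicalComplex.isoHomologyι _ 0 1 (by simp) (by simp))
        (K.isoHomologyι 0 1 (by simp) hd) (HomologicalComplex.homologyι_naturality f 0).symm)).2
      (MorphismProperty.epimorphisms.infer_property (HomologicalComplex.opcyclesMap f 0))
  refine ⟨K.X 0, Q.map f ≫ e.inv, ?_⟩
  have : Epi ((homologyFunctor A 0).map (Q.map f)) :=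
    ((MorphismProperty.epimorphisms A).arrow_mk_iso_iff
      (((Functor.mapArrowFunctor _ _).mapIso (homologyFunctorFactors A 0)).app (Arrow.mk f))).2 this
  refine (congr_arg Epi (Functor.map_comp _ (Q.map f) e.inv)).mpr ?_
  exact epi_comp _ _

lemma homologyMap_singleFunctor_map {X Y : A} (f : X ⟶ Y) (n : ℤ) :
    (homologyFunctor A n).map ((singleFunctor A n).map f) =
      ((singleFunctorCompHomologyFunctorIso A n).app X).hom ≫ f ≫
        ((singleFunctorCompHomologyFunctorIso A n).app Y).inv :=
  ((singleFunctorCompHomologyFunctorIso A n).app X).inv_comp_eq.1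
    ((singleFunctorCompHomologyFunctorIso A n).inv.naturality f).symm

/-- The kernel in degree zero of a morphism to an object `M` from an object `B`
placed in degree `0`. -/
lemma exists_exact_of_distTriang {M L : DerivedCategory A} {B T Y : A} [L.IsGE 0]
    (l : L ⟶ (singleFunctor A 0).obj B) (ψ : (singleFunctor A 0).obj B ⟶ M) (δ : M ⟶ L⟦(1 : ℤ)⟧)
    (hL : Triangle.mk l ψ δ ∈ distTriang _) (p : M ⟶ (singleFunctor A 0).obj Y)
    [Mono ((homologyFunctor A 0).map p)] (e : B ⟶ T) (u : T ⟶ Y) [Mono u]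
    (hψ : ψ ≫ p = (singleFunctor A 0).map (e ≫ u)) :
    ∃ (W : A) (g : (singleFunctor A 0).obj W ⟶ L) (d : W ⟶ B) (w : d ≫ e = 0),
      IsIso ((homologyFunctor A 0).map g) ∧ (singleFunctor A 0).map d = g ≫ l ∧
        (ShortComplex.mk d e w).Exact := by
  obtain ⟨W, g, hg, -⟩ := exists_from_single L
  obtain ⟨d, hd⟩ := (singleFunctor A 0).map_surjective (g ≫ l)
  let E : ∀ N : A, (homologyFunctor A 0).obj ((singleFunctor A 0).obj N) ≅ N :=
    (singleFunctorCompHomologyFunctorIso A 0).app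
  have hd' : (homologyFunctor A 0).map g ≫ (homologyFunctor A 0).map l =
      (E W).hom ≫ d ≫ (E B).inv := by
    rw [← Functor.map_comp, ← hd, homologyMap_singleFunctor_map]
  have hψ' : (homologyFunctor A 0).map ψ ≫ (homologyFunctor A 0).map p =
      (E B).hom ≫ (e ≫ u) ≫ (E Y).inv := by
    rw [← Functor.map_comp, hψ, homologyMap_singleFunctor_map]
  have hlψ : (homologyFunctor A 0).map l ≫ (homologyFunctor A 0).map ψ = 0 := by
    have : l ≫ ψ = 0 := comp_distTriang_mor_zero₁₂ _ hL
    rw [← Functor.map_comp, this, Functor.map_zero]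
  have hde : d ≫ e = 0 := by
    rw [← cancel_mono (u ≫ (E Y).inv), zero_comp, ← cancel_epi (E W).hom, comp_zero]
    calc (E W).hom ≫ (d ≫ e) ≫ u ≫ (E Y).inv
        = ((E W).hom ≫ d ≫ (E B).inv) ≫ (E B).hom ≫ (e ≫ u) ≫ (E Y).inv := by simp
      _ = 0 := by
        rw [← hd', ← hψ', Category.assoc, reassoc_of% hlψ, zero_comp, comp_zero]
  refine ⟨W, g, d, hde, hg, hd, ?_⟩
  have h : (ShortComplex.mk _ _ hlψ).Exact := HomologySequence.exact₂ _ hL 0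
  have w : (homologyFunctor A 0).map l ≫ (homologyFunctor A 0).map ψ ≫
    (homologyFunctor A 0).map p = 0 := by rw [reassoc_of% hlψ, zero_comp]
  -- Comparison with the homology sequence of the triangle; its components are an epimorphism, an
  -- isomorphism and a monomorphism, so exactness transfers.
  let φ : ShortComplex.mk d e hde ⟶ ShortComplex.mk _ _ w :=
    { τ₁ := (E W).inv ≫ (homologyFunctor A 0).map g, τ₂ := (E B).inv, τ₃ := u ≫ (E Y).inv
      comm₁₂ := (Category.assoc _ _ _).trans ((congr_arg ((E W).inv ≫ ·) hd').trans
        ((E W).inv_hom_id_assoc _))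
      comm₂₃ := (congr_arg ((E B).inv ≫ ·) hψ').trans
        (((E B).inv_hom_id_assoc _).trans (Category.assoc _ _ _)) }
  have : Epi φ.τ₁ := inferInstanceAs (Epi ((E W).inv ≫ (homologyFunctor A 0).map g))
  have : IsIso φ.τ₂ := inferInstanceAs (IsIso (E B).inv)
  have : Mono φ.τ₃ := inferInstanceAs (Mono (u ≫ (E Y).inv))
  exact (ShortComplex.exact_iff_of_epi_of_isIso_of_mono φ).2 (h.comp_mono _ w)

end DerivedCategory

namespace TorsionPair

open DerivedCategory HomologySequence

variable {A : Type u} [Category.{v} A] [Abelian A] (t : TorsionPair A) [HasDerivedCategory.{w} A]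

/-- Since `a` factors through `l`, the cone of `a` maps to `M`, the cone of `l`. Its `H⁰` is a
quotient of `T` and its `H⁻¹` a subobject of `H⁻¹(M)`. -/
lemma exists_heart_cone {M L S : DerivedCategory A} (hM : t.tStructure.heart M) {B T W Z : A}
    (hT : t.torsion T) (l : L ⟶ (singleFunctor A 0).obj B) (ψ : (singleFunctor A 0).obj B ⟶ M)
    (δ : M ⟶ L⟦(1 : ℤ)⟧) (hL : Triangle.mk l ψ δ ∈ distTriang _)
    (g : (singleFunctor A 0).obj W ⟶ L) [IsIso ((homologyFunctor A 0).map g)] (m : Z ⟶ W) [Mono m]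
    (a : Z ⟶ B) (ha : (singleFunctor A 0).map a = (singleFunctor A 0).map m ≫ g ≫ l)
    (e : B ⟶ T) [Epi e] (w : a ≫ e = 0) (he : (ShortComplex.mk a e w).Exact)
    (α : (singleFunctor A 0).obj B ⟶ S) (ε : S ⟶ ((singleFunctor A 0).obj Z)⟦(1 : ℤ)⟧)
    (hS : Triangle.mk ((singleFunctor A 0).map a) α ε ∈ distTriang _) :
    t.tStructure.heart S ∧ ∃ c : S ⟶ M, α ≫ c = ψ := by
  obtain ⟨-, hM₁, hM₁'⟩ := (t.mem_heart_iff _).1 hM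
  let E : ∀ N : A, (homologyFunctor A 0).obj ((singleFunctor A 0).obj N) ≅ N :=
    (singleFunctorCompHomologyFunctorIso A 0).app
  have hm : (singleFunctor A 0).map a ≫ 𝟙 _ = ((singleFunctor A 0).map m ≫ g) ≫ l :=
    (Category.comp_id _).trans (ha.trans (Category.assoc _ _ _).symm)
  obtain ⟨c, hc, hc'⟩ : ∃ c : S ⟶ M, α ≫ c = 𝟙 _ ≫ ψ ∧
      ε ≫ ((singleFunctor A 0).map m ≫ g)⟦(1 : ℤ)⟧' = c ≫ δ :=
    complete_distinguished_triangle_morphism _ _ hS hL _ (𝟙 _) hm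
  let φ : Triangle.mk ((singleFunctor A 0).map a) α ε ⟶ Triangle.mk l ψ δ :=
    { hom₁ := (singleFunctor A 0).map m ≫ g
      hom₂ := 𝟙 _
      hom₃ := c
      comm₁ := hm
      comm₂ := hc
      comm₃ := hc' }
  have lZ : (((singleFunctor A 0).obj Z)⟦(1 : ℤ)⟧).IsLE (-1) :=
    DerivedCategory.TStructure.t.isLE_shift _ 0 1 (-1)
  have lZ' : (((singleFunctor A 0).obj Z)⟦(1 : ℤ)⟧).IsLE 0 :=
    DerivedCategory.TStructure.t.isLE_of_le _ (-1) 0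
  have gZ : (((singleFunctor A 0).obj Z)⟦(1 : ℤ)⟧).IsGE (-1) :=
    DerivedCategory.TStructure.t.isGE_shift _ 0 1 (-1)
  have lB : ((singleFunctor A 0).obj B).IsLE 0 := inferInstance
  have gB : ((singleFunctor A 0).obj B).IsGE (-1) :=
    DerivedCategory.TStructure.t.isGE_of_ge _ (-1) 0
  refine ⟨(t.mem_heart_iff _).2 ⟨⟨?_, ?_⟩, ?_, ?_⟩, c, hc.trans (Category.id_comp _)⟩
  · exact DerivedCategory.TStructure.t.isLE₂ _ (rot_of_distTriang _ hS) 0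
      lB lZ'
  -- The map from `B` onto `H⁰(S)` kills `a`, so it factors through `e`.
  · have : Epi ((homologyFunctor A 0).map α) :=
      (epi_homologyMap_mor₂_iff _ hS 0 1).2 
        ((isZero_of_isLE ((singleFunctor A 0).obj Z) 0 1 (by simp)).eq_of_tgt _ _)
    have h₀ : (singleFunctor A 0).map a ≫ α = 0 := comp_distTriang_mor_zero₁₂ _ hS
    let y : B ⟶ (homologyFunctor A 0).obj S := (E B).inv ≫ (homologyFunctor A 0).map α
    have hy : a ≫ y = 0 := by
      rw [← cancel_epi (E Z).hom, comp_zero]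
      have h := (homologyFunctor A 0).congr_map h₀
      rw [Functor.map_comp, homologyMap_singleFunctor_map, Functor.map_zero, Category.assoc,
        Category.assoc] at h
      exact h
    have hz : e ≫ he.desc y hy = y := he.g_desc y hy
    have : Epi (e ≫ he.desc y hy) := by
      rw [hz]
      exact epi_comp _ _
    have := epi_of_epi e (he.desc y hy)
    exact t.torsion_of_epi (he.desc y hy) hT
  · exact DerivedCategory.TStructure.t.isGE₂ _ (rot_of_distTriang _ hS) (-1) gB gZ
  -- The connecting map embeds `H⁻¹(S)` in `Z`, which embeds in `H⁰(L)`; by naturality `H⁻¹(c)` is a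
  -- monomorphism.
  · have : Mono ((homologyFunctor A 0).map ((singleFunctor A 0).map m ≫ g)) := by
      rw [Functor.map_comp, homologyMap_singleFunctor_map]
      infer_instance
    let D : (homologyFunctor A (-1)).obj S ⟶ (homologyFunctor A 0).obj ((singleFunctor A 0).obj Z) :=
      HomologySequence.δ (Triangle.mk ((singleFunctor A 0).map a) α ε) (-1) 0
    let D' : (homologyFunctor A (-1)).obj M ⟶ (homologyFunctor A 0).obj L :=
      HomologySequence.δ (Triangle.mk l ψ δ) (-1) 0
    have : Mono D := (exact₃ _ hS (-1) 0).mono_g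
      ((isZero_of_isGE ((singleFunctor A 0).obj B) 0 (-1) (by simp)).eq_of_src _ _)
    have h : D ≫ (homologyFunctor A 0).map ((singleFunctor A 0).map m ≫ g) =
        (homologyFunctor A (-1)).map c ≫ D' :=
      ((homologyFunctor A 0).homologySequenceδ_naturality _ _ φ (-1) 0 rfl).symm
    have : Mono ((homologyFunctor A (-1)).map c ≫ D') := by
      rw [← h]
      exact mono_comp _ _
    have := mono_of_mono ((homologyFunctor A (-1)).map c) D'
    exact t.torsionFree_of_mono ((homologyFunctor A (-1)).map c) hM₁'

end TorsionPair

end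

/-! ### A separator of the heart -/

section

universe w' v' u'

namespace TorsionPair

open DerivedCategory HomologySequence

variable {A : Type u} [Category.{v} A] [Abelian A] (t : TorsionPair A) [HasDerivedCategory.{w} A]

lemma isIso_homologyMap_heart {M : t.Heart} {N : t.torsionFree.FullSubcategory}
    {Y : t.torsion.FullSubcategory} (i : t.freeToHeart.obj N ⟶ M) (p : M ⟶ t.torsionToHeart.obj Y)
    (w : i ≫ p = 0) (h : (ShortComplex.mk i p w).ShortExact) :
    IsIso ((homologyFunctor A 0).map p.hom) := by
  obtain ⟨δ, hδ⟩ := t.tStructure.heart_exists_distTriang_of_shortExact _ h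
  exact isIso_homologyMap_mor₂ _ hδ 0 1 rfl
    (isZero_of_isLE ((singleFunctor A (-1)).obj N.obj) (-1) 0 (by simp))
    (isZero_of_isLE ((singleFunctor A (-1)).obj N.obj) (-1) 1 (by simp))

/-- The morphism lands in the degree `-1` part of `P`, so it comes from a nonzero `φ` in `A`. Some
`X ⟶ N` detects `φ`; its image is a quotient of `X`, torsion-free as a subobject of `N`. -/
lemma exists_freeToHeart_comp_ne_zero {X : A} (hX : IsSeparator X)
    {N : t.torsionFree.FullSubcategory} {P : t.Heart} (f : t.freeToHeart.obj N ⟶ P) (hf : f ≠ 0) :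
    ∃ (R : Subobject X) (hR : t.torsionFree (cokernel R.arrow))
      (c : t.freeToHeart.obj ⟨_, hR⟩ ⟶ t.freeToHeart.obj N), c ≫ f ≠ 0 := by
  obtain ⟨N', Y, i, p, w, hS⟩ := t.exists_shortExact_heart P
  have := hS.mono_f
  obtain ⟨φ, hφ⟩ := t.freeToHeart.map_surjective (hS.exact.lift f (t.freeToHeart_hom_eq_zero _))
  have hφ' : t.freeToHeart.map φ ≫ i = f := by
    rw [hφ]
    exact hS.exact.lift_f _ _
  by_contra! H
  refine hf ?_
  suffices h : φ.hom = 0 by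
    rw [← hφ', show φ = 0 from by ext; exact h, Functor.map_zero, zero_comp]
  refine IsSeparator.def hX _ _ fun x ↦ ?_
  obtain ⟨R, ⟨e⟩⟩ := exists_subobject_cokernel_iso (Abelian.factorThruImage x)
  have hR : t.torsionFree (cokernel R.arrow) :=
    t.torsionFree_of_mono (e.hom ≫ Abelian.image.ι x) N.property
  let c : (⟨cokernel R.arrow, hR⟩ : t.torsionFree.FullSubcategory) ⟶ N :=
    ObjectProperty.homMk (e.hom ≫ Abelian.image.ι x)
  have h := H R hR (t.freeToHeart.map c)
  rw [← hφ', ← Category.assoc, ← zero_comp (f := i), cancel_mono, ← Functor.map_comp] at h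
  have h' : (e.hom ≫ Abelian.image.ι x) ≫ φ.hom = 0 :=
    congr_arg (·.hom) (t.freeToHeart.map_injective (h.trans (Functor.map_zero _ _ _).symm))
  rw [← Abelian.image.fac x, comp_zero, Category.assoc, ← e.inv_hom_id_assoc (Abelian.image.ι x),
    Category.assoc, h', comp_zero, comp_zero]

/-- Both `v` and `u` factor through the torsion quotient `Y'` of `S`: the former because `Y` sits in
degree `0`, the latter because `B ⟶ Y'` kills `a`. As `S` maps epimorphically to `Y'`, `g` vanishes
on it, hence on `T`. The contrapositive detects `g` from `S`. -/
lemma torsionToHeart_map_comp_eq_zero {S : t.Heart} {Z B T : A} {a : Z ⟶ B} {e : B ⟶ T} [Epi e]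
    {w : a ≫ e = 0} (h : (ShortComplex.mk a e w).Exact) (hT : t.torsion T)
    (α : (singleFunctor A 0).obj B ⟶ S.obj) (hα : (singleFunctor A 0).map a ≫ α = 0)
    {Y : t.torsion.FullSubcategory} (v : S ⟶ t.torsionToHeart.obj Y) (u : T ⟶ Y.obj)
    (hv : α ≫ v.hom = (singleFunctor A 0).map (e ≫ u)) {P : t.Heart}
    (g : t.torsionToHeart.obj Y ⟶ P) (hg : v ≫ g = 0) :
    t.torsionToHeart.map (X := ⟨T, hT⟩) (ObjectProperty.homMk u) ≫ g = 0 := by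
  obtain ⟨N, Y', i, p, w', hS⟩ := t.exists_shortExact_heart S
  have := hS.epi_g
  obtain ⟨s, hs⟩ := t.torsionToHeart.map_surjective (hS.exact.desc v (t.freeToHeart_hom_eq_zero _))
  have hs' : p ≫ t.torsionToHeart.map s = v := by
    rw [hs]
    exact hS.exact.g_desc _ _
  let p' : S.obj ⟶ (singleFunctor A 0).obj Y'.obj := p.hom
  obtain ⟨β, hβ⟩ := (singleFunctor A 0).map_surjective (α ≫ p')
  have haβ : a ≫ β = 0 := (singleFunctor A 0).map_injective (by
    rw [Functor.map_comp, hβ, reassoc_of% hα, zero_comp, Functor.map_zero])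
  let b : T ⟶ Y'.obj := h.desc β haβ
  have hb : e ≫ b = β := h.g_desc β haβ
  have hbs : b ≫ s.hom = u := by
    rw [← cancel_epi e, reassoc_of% hb]
    refine (singleFunctor A 0).map_injective ?_
    rw [← hv, Functor.map_comp, hβ, Category.assoc, ← hs']
    rfl
  let b' : (⟨T, hT⟩ : t.torsion.FullSubcategory) ⟶ Y' := ObjectProperty.homMk b
  have hu : (ObjectProperty.homMk u : (⟨T, hT⟩ : t.torsion.FullSubcategory) ⟶ Y) = b' ≫ s := by
    ext
    exact hbs.symm
  have hsg : t.torsionToHeart.map s ≫ g = 0 := by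
    rw [← cancel_epi p, comp_zero, ← Category.assoc, hs', hg]
  rw [hu, Functor.map_comp, Category.assoc, hsg, comp_zero]

/-- Let `M` be an object of the heart, and `ψ` a morphism to `M` from an object `B`, placed in
degree `0`, which induces a morphism `B ⟶ H⁰(M)` with torsion image `T`. Then, `ψ` factors through
an object of the heart which is the cone of a morphism `a` whose source is a quotient of a given
coproduct of copies of a separator. -/
lemma exists_heart_cone_of_isSeparator {X : A} (hX : IsSeparator X) {M : DerivedCategory A}
    (hM : t.tStructure.heart M) {B T Y : A} (ψ : (singleFunctor A 0).obj B ⟶ M)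
    (p : M ⟶ (singleFunctor A 0).obj Y) [Mono ((homologyFunctor A 0).map p)] (e : B ⟶ T) [Epi e]
    (hT : t.torsion T) (u : T ⟶ Y) [Mono u] (hψ : ψ ≫ p = (singleFunctor A 0).map (e ≫ u))
    [Small.{w'} (Subobject (kernelSubobject e : A))]
    [HasCoproduct fun _ : Shrink.{w'} (Subobject (kernelSubobject e : A)) ↦ X] :
    ∃ (R : Subobject (∐ fun _ : Shrink.{w'} (Subobject (kernelSubobject e : A)) ↦ X))
      (a : cokernel R.arrow ⟶ B) (w : a ≫ e = 0), (ShortComplex.mk a e w).Exact ∧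
      ∀ (S : DerivedCategory A) (α : (singleFunctor A 0).obj B ⟶ S)
        (δ : S ⟶ ((singleFunctor A 0).obj (cokernel R.arrow))⟦(1 : ℤ)⟧),
        Triangle.mk ((singleFunctor A 0).map a) α δ ∈ distTriang _ →
          t.tStructure.heart S ∧ ∃ c : S ⟶ M, α ≫ c = ψ := by
  obtain ⟨-, hM₁, -⟩ := (t.mem_heart_iff _).1 hM
  obtain ⟨L, l, δ, hL⟩ := distinguished_cocone_triangle₁ ψ
  have gM : IsGE (M⟦(-1 : ℤ)⟧) 0 := DerivedCategory.TStructure.t.isGE_shift M (-1) (-1) 0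
  have gB : ((singleFunctor A 0).obj B).IsGE 0 := inferInstance
  have gL : L.IsGE 0 := DerivedCategory.TStructure.t.isGE₂ _ (inv_rot_of_distTriang _ hL) 0 gM gB
  obtain ⟨W, x, d, wde, hx, hd, hde⟩ := exists_exact_of_distTriang l ψ δ hL p e u hψ
  obtain ⟨R, m, wm, hm, hme⟩ := hX.exists_exact_of_exact.{v, u, w'} hde
  exact ⟨R, m ≫ d, wm, hme, fun S α ε hS ↦ t.exists_heart_cone hM hT l ψ δ hL x m
    (m ≫ d) (by rw [Functor.map_comp, hd]) e wm hme α ε hS⟩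

/-- The cone of a morphism of `A`. -/
noncomputable def cone {Z B : A} (a : Z ⟶ B) : DerivedCategory A :=
  (distinguished_cocone_triangle ((singleFunctor A 0).map a)).choose

lemma exists_cone_distTriang {Z B : A} (a : Z ⟶ B) :
    ∃ (α : (singleFunctor A 0).obj B ⟶ cone a)
      (δ : cone a ⟶ ((singleFunctor A 0).obj Z)⟦(1 : ℤ)⟧),
      Triangle.mk ((singleFunctor A 0).map a) α δ ∈ distTriang _ :=
  (distinguished_cocone_triangle ((singleFunctor A 0).map a)).choose_spec

variable [IsGrothendieckAbelian.{w'} A]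

/-- A coproduct of copies of `X` indexed by the subobjects of `T`. -/
noncomputable abbrev coproductCopies (X T : A) : A := ∐ fun _ : Shrink.{w'} (Subobject T) ↦ X

/-- Indices of the torsion-detecting test objects. -/
structure TestIndex (X : A) where
  n : ℕ
  R : Subobject (∐ fun _ : Fin n ↦ X)
  V : Subobject (coproductCopies.{v, u, w'} X (t.torsionPart (cokernel R.arrow)))
  R' : Subobject (coproductCopies.{v, u, w'} X (V : A))
  a : cokernel R'.arrow ⟶ coproductCopies.{v, u, w'} X (t.torsionPart (cokernel R.arrow))
  heart : t.tStructure.heart (cone a)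

/-- The object of the heart attached to an index. -/
noncomputable def TestIndex.obj {X : A} (i : t.TestIndex.{w, v, u, w'} X) : t.Heart := ⟨cone i.a, i.heart⟩

instance (X : A) : Small.{w'} (t.TestIndex.{w, v, u, w'} X) := by
  -- The field `heart` is a proposition, so the data fields determine the index.
  let f (i : t.TestIndex.{w, v, u, w'} X) : Σ (n : ℕ) (R : Subobject (∐ fun _ : Fin n ↦ X))
    (V : Subobject (coproductCopies.{v, u, w'} X (t.torsionPart (cokernel R.arrow))))
    (R' : Subobject (coproductCopies.{v, u, w'} X (V : A))),
    (cokernel R'.arrow ⟶ coproductCopies.{v, u, w'} X (t.torsionPart (cokernel R.arrow))) :=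
      ⟨i.n, i.R, i.V, i.R', i.a⟩
  refine small_of_injective (f := f) ?_
  rintro ⟨⟩ ⟨⟩ h
  cases h
  rfl

/-- `Y` is a filtered colimit of quotients of finite sums of copies of `X`, hence of their torsion
parts, and the latter are jointly epimorphic in the heart. -/
lemma exists_torsionPart_comp_ne_zero {X : A} (hX : IsSeparator X)
    (ht : IsClosedUnderDirectLimits.{w'} t.torsionFree) {Y : t.torsion.FullSubcategory}
    {P : t.Heart} (g : t.torsionToHeart.obj Y ⟶ P) (hg : g ≠ 0) :
    ∃ (n : ℕ) (R : Subobject (∐ fun _ : Fin n ↦ X)) (u : t.torsionPart (cokernel R.arrow) ⟶ Y.obj),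
      Mono u ∧ t.torsionToHeart.map (X := ⟨_, t.torsion_torsionPart _⟩) (ObjectProperty.homMk u) ≫ g
        ≠ 0 := by
  obtain ⟨J, _, _, F, ι, ⟨hι⟩, hι', hF⟩ := hX.exists_isColimit.{w'} Y.obj
  have := ht.of_isFiltered J
  obtain ⟨hc⟩ := t.nonempty_isColimit_torsionFunctor F ι hι Y.property
  by_contra! H
  refine hg (t.torsionToHeart_hom_eq_zero hc (fun j ↦ t.torsion_torsionPart (F.obj j)) Y.property g
    fun j ↦ ?_)
  obtain ⟨n, q, _⟩ := hF j
  obtain ⟨R, ⟨e⟩⟩ := exists_subobject_cokernel_iso q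
  have := hι' j
  let k : t.torsionPart (cokernel R.arrow) ≅ t.torsionPart (F.obj j) := t.torsionFunctor.mapIso e
  have h := H n R (k.hom ≫ t.torsionPartι _ ≫ ι.app j) (mono_comp _ _)
  let k' : (⟨t.torsionPart (F.obj j), t.torsion_torsionPart _⟩ : t.torsion.FullSubcategory) ⟶
    ⟨t.torsionPart (cokernel R.arrow), t.torsion_torsionPart _⟩ := ObjectProperty.homMk k.inv
  have h' := congr_arg (t.torsionToHeart.map k' ≫ ·) h
  rw [← Category.assoc, ← Functor.map_comp, comp_zero] at h'
  refine Eq.trans ?_ h'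
  congr 2
  ext
  exact (k.inv_hom_id_assoc _).symm

/-- The test objects detect the morphisms which factor through a torsion object. -/
lemma TestIndex.exists_comp_ne_zero {X : A} (hX : IsSeparator X)
    (ht : IsClosedUnderDirectLimits.{w'} t.torsionFree) {M : t.Heart}
    {N : t.torsionFree.FullSubcategory} {Y : t.torsion.FullSubcategory}
    (i : t.freeToHeart.obj N ⟶ M) (p : M ⟶ t.torsionToHeart.obj Y) (w : i ≫ p = 0)
    (h : (ShortComplex.mk i p w).ShortExact) {P : t.Heart} (g : t.torsionToHeart.obj Y ⟶ P)
    (hg : g ≠ 0) : ∃ (k : t.TestIndex.{w, v, u, w'} X) (c : k.obj ⟶ M), c ≫ p ≫ g ≠ 0 := by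
  obtain ⟨n, R, u, hu, hug⟩ := t.exists_torsionPart_comp_ne_zero hX ht g hg
  obtain ⟨⟨hM, -⟩, -⟩ := (t.mem_heart_iff _).1 M.property
  let p' : M.obj ⟶ (singleFunctor A 0).obj Y.obj := p.hom
  have hp : IsIso ((homologyFunctor A 0).map p') := t.isIso_homologyMap_heart i p w h
  obtain ⟨K, φ, hφ⟩ := exists_singleFunctor_epi_homologyMap M.obj
  obtain ⟨q, hq⟩ := (singleFunctor A 0).map_surjective (φ ≫ p')
  have : Epi q := by
    have h := congr_arg (homologyFunctor A 0).map hq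
    rw [homologyMap_singleFunctor_map, Functor.map_comp] at h
    let E : ∀ N : A, (homologyFunctor A 0).obj ((singleFunctor A 0).obj N) ≅ N :=
      (singleFunctorCompHomologyFunctorIso A 0).app
    have hq' : q = (E K).inv ≫ ((homologyFunctor A 0).map φ ≫ (homologyFunctor A 0).map p') ≫
        (E Y.obj).hom := by
      rw [← h]
      simp [E]
    rw [hq']
    exact epi_comp' inferInstance (epi_comp' (epi_comp' hφ inferInstance) inferInstance)
  -- The part of `K` lying over the torsion subobject is covered by copies of `X` indexed by the
  -- subobjects of that torsion object, so the cover does not depend on `M`.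
  let e₀ : pullback q u ⟶ t.torsionPart (cokernel R.arrow) := pullback.snd q u
  obtain ⟨b, hb⟩ := hX.exists_epi_comp.{w'} e₀
  let e := b ≫ e₀
  let ψ := (singleFunctor A 0).map (b ≫ pullback.fst q u) ≫ φ
  have hψ : ψ ≫ p' = (singleFunctor A 0).map (e ≫ u) := by
    rw [Category.assoc, ← hq, ← Functor.map_comp, Category.assoc, Category.assoc,
      pullback.condition]
  obtain ⟨R', a, w', hae, ha⟩ := t.exists_heart_cone_of_isSeparator.{w, v, u, w'} hX M.property ψ p' e
    (t.torsion_torsionPart _) u hψ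
  obtain ⟨α, ε, hS⟩ := exists_cone_distTriang a
  obtain ⟨hcone, c, hc⟩ := ha _ α ε hS
  let S : t.Heart := ⟨cone a, hcone⟩
  let c' : S ⟶ M := ObjectProperty.homMk c
  -- If the test object did not detect `p ≫ g`, then `g` would vanish on the torsion subobject `u`,
  -- against its choice.
  refine ⟨⟨n, R, kernelSubobject e, R', a, hcone⟩, c', fun hz ↦ hug ?_⟩
  refine t.torsionToHeart_map_comp_eq_zero hae (t.torsion_torsionPart _) α
    (comp_distTriang_mor_zero₁₂ _ hS) (c' ≫ p) u ?_ g ((Category.assoc _ _ _).trans hz)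
  refine Eq.trans ?_ hψ
  rw [← hc, Category.assoc]
  rfl

/-- The separator is the coproduct of two small families: shifted torsion-free quotients of `X`,
which detect morphisms nonzero on the degree `-1` part, and the test cones, which detect those
factoring through the degree `0` part. -/
lemma hasSeparator_heart (ht : IsClosedUnderDirectLimits.{w'} t.torsionFree)
    [HasCoproducts.{w'} t.Heart] : HasSeparator t.Heart := by
  obtain ⟨X, hX⟩ := IsGrothendieckAbelian.hasSeparator.{w'} (C := A)
  let I := t.TestIndex.{w, v, u, w'} X ⊕ { R : Subobject X // t.torsionFree (cokernel R.arrow) }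
  let S : I → t.Heart := Sum.elim (fun k ↦ k.obj) (fun R ↦ t.freeToHeart.obj ⟨_, R.2⟩)
  refine ⟨⟨∐ fun k : Shrink.{w'} I ↦ S ((equivShrink I).symm k),
    ObjectProperty.IsSeparating.isSeparator_coproduct ?_⟩⟩
  rw [Preadditive.isSeparating_iff]
  intro M P f hf
  replace hf (k : I) (c : S k ⟶ M) : c ≫ f = 0 := by
    obtain ⟨k, rfl⟩ := (equivShrink I).symm.surjective k
    exact hf _ (ObjectProperty.ofObj_apply _ k) c
  obtain ⟨N, Y, i, p, w, hS⟩ := t.exists_shortExact_heart M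
  have := hS.epi_g
  have hif : i ≫ f = 0 := by
    by_contra h
    obtain ⟨R, hR, c, hc⟩ := t.exists_freeToHeart_comp_ne_zero hX (i ≫ f) h
    refine hc ?_
    rw [← Category.assoc]
    exact hf (Sum.inr ⟨R, hR⟩) (c ≫ i)
  obtain ⟨g, rfl⟩ : ∃ g, p ≫ g = f := ⟨hS.exact.desc f hif, hS.exact.g_desc _ _⟩
  by_contra h
  obtain ⟨k, c, hc⟩ := TestIndex.exists_comp_ne_zero t hX ht i p w hS g
    (fun hg ↦ h (by rw [hg, comp_zero]))
  exact hc (hf (Sum.inl k) c)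

/-- If the torsion-free class of a torsion pair in a Grothendieck category is closed under direct
limits, then the heart of the Happel-Reiten-Smalø t-structure is a Grothendieck category. -/
theorem isGrothendieckAbelian_heart (ht : IsClosedUnderDirectLimits.{w'} t.torsionFree) :
    IsGrothendieckAbelian.{w'} t.Heart := by
  obtain ⟨_, _⟩ := t.isAB5_heart ht
  have : HasCoproducts.{w'} t.Heart := hasCoproducts_of_finite_and_filtered
  have := IsGrothendieckAbelian.hasExt.{w'} A
  exact
    { locallySmall := t.locallySmall_heart
      hasSeparator := t.hasSeparator_heart ht }

theorem isGrothendieckAbelian_heart_tfae :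
    List.TFAE
      [IsGrothendieckAbelian.{w'} t.Heart, IsAB5.{w'} t.Heart,
        IsClosedUnderDirectLimits.{w'} t.torsionFree] := by
  tfae_have 1 → 2 := fun h ↦ ⟨h.hasFilteredColimitsOfSize, h.ab5OfSize⟩
  tfae_have 2 → 3 := t.isClosedUnderDirectLimits_of_isAB5_heart
  tfae_have 3 → 1 := t.isGrothendieckAbelian_heart
  tfae_finish

end TorsionPair

end

theorem mainTheorem4 {G : Type u} [Category.{v} G] [Abelian G] [IsGrothendieckAbelian.{v} G]
    [HasDerivedCategory.{w} G] (t : TorsionPair G) :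
    ((t.IsHereditary ∨
        t.HeartRepresentedByTwoTermComplexes t.torsionFree ∨
        t.HeartRepresentedByTwoTermComplexes t.torsion) →
      List.TFAE
        [IsGrothendieckAbelian.{v} t.Heart,
          IsAB5.{v} t.Heart,
          IsClosedUnderDirectLimits.{v} t.torsionFree]) ∧
    ((IsGeneratingClass t.torsionFree ∨ IsCogeneratingClass t.torsion) →
      (IsGrothendieckAbelian.{v} t.Heart ↔ IsClosedUnderDirectLimits.{v} t.torsionFree)) := by
  exact ⟨fun _ ↦ t.isGrothendieckAbelian_heart_tfae,
    fun _ ↦ t.isGrothendieckAbelian_heart_tfae.out 0 2⟩
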